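/- Let $\rho>0$, $a_0>0$ be real and $\ell\in\mathbb Z$ with $|\ell|\ge 2$. For real $\varepsilon$ let $V_\varepsilon=-(a_0^2-\varepsilon)\mathbf 1_{\{|x|\le\rho\}}$ on $\mathbb R^2$. Suppose that for some $\varepsilon_1>0$ there are, for every $\varepsilon\in(-\varepsilon_1,0)$, a real number $E_\varepsilon$ and a nontrivial $\psi_\varepsilon\in L^2(\mathbb R^2)$ with $\partial_\theta\psi_\varepsilon=i\ell\psi_\varepsilon$ and $(-\Delta+V_\varepsilon-E_\varepsilon)\psi_\varepsilon=0$ in the sense of distributions, and that $E_\varepsilon\uparrow 0$ as $\varepsilon\uparrow 0$. (The monotonicity of $E_\varepsilon$ is not needed: it suffices that $E_\varepsilon$ tends to $0$ through negative values.) A number $\lambda\in\mathbb C\setminus -i(0,\infty)$ is called a resonance of $-\Delta+V_\varepsilon$ if there is a nontrivial $u\in L^2_{\mathrm{loc}}(\mathbb R^2)$ that solves $(-\Delta+V_\varepsilon-\lambda^2)u=0$ and is outgoing, that is, $u(r,\theta)=\sum_{m\in\mathbb Z}c_mH^{(1)}_m(\lambda r)e^{im\theta}$ for $r>\rho$ with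 some $c_m\in\mathbb C$; here $H^{(1)}_m$ is the Hankel function, continued from the positive axis to the plane cut along $-i[0,\infty)$. (At $\lambda=0$ the functions $H^{(1)}_m(\lambda r)$ are replaced by $r^{-|m|}$.) Then there is an $\varepsilon_0>0$ such that for all real $\varepsilon$ with $0<|\varepsilon|<\varepsilon_0$ the operator $-\Delta+V_\varepsilon$ has a resonance $\lambda_\varepsilon$ satisfying, as $\varepsilon\to0$, $$\lambda_\varepsilon=\sqrt{\varepsilon\,\frac{|\ell|-1}{|\ell|}}+O\!\left(|\varepsilon|^{3/2}\bigl(1+\delta_{|\ell|,2}\log|\varepsilon|\bigr)\right),$$ where the square root has nonnegative real and imaginary parts. Moreover, as $\varepsilon\uparrow0$, $$E_\varepsilon=\frac{|\ell|-1}{|\ell|}\,\varepsilon+O\!\left(\varepsilon^2\bigl(1+\delta_{|\ell|,2}\log|\varepsilon|\bigr)\right).$$ -/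

import Mathlib

open Filter Topology MeasureTheory Asymptotics

open scoped ContDiff

noncomputable section

/-- The Bessel function `J_ν(z) = (z/2)^ν ∑ (-z²/4)^k / (k! Γ(ν+k+1))` of complex order `ν`.
The power `(z/2)^ν` is taken with the branch cut along the negative imaginary axis: as
`z/2 = e^{iπ/2} · (z/(2i))`, it is `e^{iπν/2} (z/(2i))^ν` with the principal power, that is,
`arg z` is chosen in `(-π/2, 3π/2]`.  At the poles of `Γ` the summand is `0`, in agreement with
`1/Γ = 0` there. -/
def besselJ (ν z : ℂ) : ℂ :=
  Complex.exp (Real.pi * Complex.I * ν / 2) * (z / (2 * Complex.I)) ^ ν *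
    ∑' k : ℕ, (-z ^ 2 / 4) ^ k / ((k.factorial : ℂ) * Complex.Gamma (ν + k + 1))

/-- The Bessel function of the second kind of integer order,
`Y_ℓ(z) = (1/π) ∂_ν J_ν(z)|_{ν = ℓ} + ((-1)^ℓ/π) ∂_ν J_ν(z)|_{ν = -ℓ}`. -/
def besselY (ℓ : ℤ) (z : ℂ) : ℂ :=
  (1 / Real.pi) * deriv (fun ν : ℂ => besselJ ν z) (ℓ : ℂ) +
    ((-1) ^ ℓ / Real.pi) * deriv (fun ν : ℂ => besselJ ν z) (-(ℓ : ℂ))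

/-- The Hankel function `H_ℓ^{(1)} = J_ℓ + i Y_ℓ` on the plane cut along the negative imaginary
axis. -/
def hankelOne (ℓ : ℤ) (z : ℂ) : ℂ :=
  besselJ ℓ z + Complex.I * besselY ℓ z

/-- `φ` is a test function on the plane: smooth with compact support.  Here and below `ℝ²` is
identified with `ℂ`, with its Euclidean norm and Lebesgue measure. -/
def IsTestFunction (φ : ℂ → ℂ) : Prop :=
  ContDiff ℝ ∞ φ ∧ HasCompactSupport φ

/-- `u` is an `L²_loc(ℝ²)` solution of `(-Δ + V - E) u = 0` in the sense of distributions. -/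
def IsSolution (V : ℂ → ℝ) (E : ℂ) (u : ℂ → ℂ) : Prop :=
  (∀ K : Set ℂ, IsCompact K → MemLp u 2 (volume.restrict K)) ∧
    ∀ φ : ℂ → ℂ, IsTestFunction φ →
      ∫ z : ℂ, u z * (-(Laplacian.laplacian φ z) + ((V z : ℂ) - E) * φ z) = 0

/-- `∂_θ ψ = i ℓ ψ` in the sense of distributions, where `(∂_θ φ)(z)` is the derivative of `φ` at
`z` in the direction `i z`. -/
def HasAngularMode (ℓ : ℤ) (ψ : ℂ → ℂ) : Prop :=
  ∀ φ : ℂ → ℂ, IsTestFunction φ →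
    ∫ z : ℂ, ψ z * fderiv ℝ φ z (Complex.I * z) = -∫ z : ℂ, (Complex.I * ℓ * ψ z) * φ z

/-- The radial factor of the `ℓ`th outgoing mode: `H_ℓ^{(1)}(lam r)` for `lam ≠ 0` and `r^{-|ℓ|}`
for `lam = 0`. -/
def outgoingFactor (lam : ℂ) (ℓ : ℤ) (r : ℝ) : ℂ :=
  if lam = 0 then (r : ℂ) ^ (-|ℓ|) else hankelOne ℓ (lam * r)

/-- `u` is outgoing: `u(r, θ) = ∑_ℓ c_ℓ H_ℓ^{(1)}(lam r) e^{iℓθ}` for `r > ρ` (and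
`u(r, θ) = ∑_ℓ c_ℓ r^{-|ℓ|} e^{iℓθ}` if `lam = 0`). -/
def IsOutgoing (ρ : ℝ) (lam : ℂ) (u : ℂ → ℂ) : Prop :=
  ∃ c : ℤ → ℂ, ∀ᵐ z : ℂ, ρ < ‖z‖ →
    HasSum (fun ℓ : ℤ => c ℓ * outgoingFactor lam ℓ ‖z‖ * (z / (‖z‖ : ℂ)) ^ ℓ) (u z)

/-- For a potential `V` that vanishes outside the disk of radius `ρ`, the number
`lam ∈ ℂ ∖ -i(0,∞)` is a resonance of `-Δ + V`: there is a nontrivial outgoing solution of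
`(-Δ + V - lam²) u = 0`. -/
def IsResonance (V : ℂ → ℝ) (ρ : ℝ) (lam : ℂ) : Prop :=
  ¬ (lam.re = 0 ∧ lam.im < 0) ∧
    ∃ u : ℂ → ℂ, ¬ u =ᵐ[volume] 0 ∧ IsSolution V (lam ^ 2) u ∧ IsOutgoing ρ lam u

/-- The circular well of radius `ρ` and depth `A = a²`: `-A` on `|z| ≤ ρ` and `0` elsewhere. -/
def circularWell (ρ A : ℝ) (z : ℂ) : ℝ :=
  if ‖z‖ ≤ ρ then -A else 0

end

/-!
Write `n + 2 = |ℓ|`. In the variable `t = -z²/4` the Bessel functions of order `m` become `t ^ m`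
times an entire function, plus a logarithmic solution which equals `(-1)^(m-1) (m-1)!` at `t = 0`
up to `O(t)`, or `O(t log t)` if `m = 1`. With `t = -λ² ρ²/4` outside the well and `τ + e + t`
inside it, where `τ = -a₀²ρ²/4` and `e = ερ²/4`, continuity of the mode and of its derivative at
the boundary becomes one analytic equation `F(e, t) = 0` in a half plane where `log t` is defined.
The eigenvalues are solutions with `e ↑ 0` and `t ↓ 0`. Hence `F(0, 0) = 0`, which means that
`J_{|ℓ|-1}(a₀ρ) = 0`. Then `∂ₜF` has a nonzero limit at `0`, and `t = -(n+1)/(n+2) e` solves the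
equation up to the stated error. As `F(e, ·)` is close to a linear function of nonzero slope, there
is a genuine zero `t` next to this approximate one, hence a resonance, and every small zero, in
particular the one of the given eigenvalue, is equally close to it.
-/

namespace CircularWell

noncomputable section

/-! ### Exponential generating functions -/

/-- The exponential generating function of the sequence `c`; every series below has this form. -/
def expGenFun (c : ℕ → ℂ) (t : ℂ) : ℂ := ∑' k : ℕ, t ^ k / (k.factorial : ℂ) * c k

section ExpGenFun

variable {c : ℕ → ℂ} {C : ℝ}

lemma expGenFun_zero (c : ℕ → ℂ) : expGenFun c 0 = c 0 := by
  rw [expGenFun, tsum_eq_single 0 fun k hk => by simp [hk]]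
  simp

lemma norm_pow_div_factorial_mul_le (hc : ∀ k, ‖c k‖ ≤ C) {t : ℂ} {R : ℝ} (ht : ‖t‖ ≤ R) (k : ℕ) :
    ‖t ^ k / (k.factorial : ℂ) * c k‖ ≤ R ^ k / k.factorial * C := by
  rw [norm_mul, norm_div, norm_pow, Complex.norm_natCast]
  have hR : 0 ≤ R := (norm_nonneg t).trans ht
  gcongr
  exact hc k

lemma hasSum_expGenFun (hc : ∀ k, ‖c k‖ ≤ C) (t : ℂ) :
    HasSum (fun k : ℕ => t ^ k / (k.factorial : ℂ) * c k) (expGenFun c t) :=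
  (Summable.of_norm_bounded ((Real.summable_pow_div_factorial ‖t‖).mul_right C)
    (norm_pow_div_factorial_mul_le hc le_rfl)).hasSum

lemma hasSum_natCast_mul_expGenFun (hc : ∀ k, ‖c k‖ ≤ C) (t : ℂ) :
    HasSum (fun k : ℕ => t ^ k / (k.factorial : ℂ) * (k * c k))
      (t * expGenFun (fun k => c (k + 1)) t) := by
  rw [← hasSum_nat_add_iff' 1]
  simp only [Finset.range_one, Finset.sum_singleton, Nat.cast_zero, zero_mul, mul_zero, sub_zero]
  refine ((hasSum_expGenFun (fun k => hc (k + 1)) t).mul_left t).congr_fun fun k => ?_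
  have hk : ((k : ℂ) + 1) ≠ 0 := by exact_mod_cast k.succ_ne_zero
  have hfac : (k.factorial : ℂ) ≠ 0 := by exact_mod_cast k.factorial_ne_zero
  rw [Nat.factorial_succ]
  push_cast
  field_simp
  ring

lemma hasDerivAt_expGenFun (hc : ∀ k, ‖c k‖ ≤ C) (t : ℂ) :
    HasDerivAt (expGenFun c) (expGenFun (fun k => c (k + 1)) t) t := by
  have ht : t ∈ Metric.ball (0 : ℂ) (‖t‖ + 1) := by simp
  have hsummable := (Real.summable_pow_div_factorial (‖t‖ + 1)).mul_right C
  have hterm : ∀ k : ℕ, DifferentiableOn ℂ (fun s : ℂ => s ^ k / (k.factorial : ℂ) * c k)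
      (Metric.ball 0 (‖t‖ + 1)) := fun k => by fun_prop
  have hbound : ∀ (k : ℕ), ∀ s ∈ Metric.ball (0 : ℂ) (‖t‖ + 1),
      ‖s ^ k / (k.factorial : ℂ) * c k‖ ≤ (‖t‖ + 1) ^ k / k.factorial * C := fun k s hs =>
    norm_pow_div_factorial_mul_le hc (mem_ball_zero_iff.1 hs).le k
  have hsum := Complex.hasSum_deriv_of_summable_norm hsummable hterm Metric.isOpen_ball hbound ht
  have hdiff := (Complex.differentiableOn_tsum_of_summable_norm hsummable hterm Metric.isOpen_ball
    hbound).differentiableAt (Metric.isOpen_ball.mem_nhds ht)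
  refine hdiff.hasDerivAt.congr_deriv (hsum.unique ?_)
  rw [← hasSum_nat_add_iff' 1]
  simp only [Finset.range_one, Finset.sum_singleton, pow_zero, deriv_const', sub_zero]
  refine (hasSum_expGenFun (fun k => hc (k + 1)) t).congr_fun fun k => ?_
  have hk : ((k : ℂ) + 1) ≠ 0 := by exact_mod_cast k.succ_ne_zero
  have hfac : (k.factorial : ℂ) ≠ 0 := by exact_mod_cast k.factorial_ne_zero
  rw [(((hasDerivAt_pow (k + 1) t).div_const _).mul_const _).deriv, Nat.factorial_succ,
    Nat.add_sub_cancel]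
  push_cast
  field_simp

end ExpGenFun

/-! ### The reciprocal Gamma function -/

/-- The entire function `1/Γ`, the source of the coefficients of the Bessel series.  The junk value
`Γ(-n) = 0` at the poles is harmless here, since `1/Γ` vanishes there. -/
def rGamma (z : ℂ) : ℂ := (Complex.Gamma z)⁻¹

lemma differentiable_rGamma : Differentiable ℂ rGamma := Complex.differentiable_one_div_Gamma

lemma rGamma_eq_mul_rGamma_add_one (z : ℂ) : rGamma z = z * rGamma (z + 1) :=
  Complex.one_div_Gamma_eq_self_mul_one_div_Gamma_add_one z

lemma deriv_rGamma_eq (z : ℂ) : deriv rGamma z = rGamma (z + 1) + z * deriv rGamma (z + 1) := by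
  have hshift : HasDerivAt (fun w => rGamma (w + 1)) (deriv rGamma (z + 1)) z :=
    (differentiable_rGamma (z + 1)).hasDerivAt.comp_add_const z 1
  have hmul : HasDerivAt (fun w => w * rGamma (w + 1)) _ z := (hasDerivAt_id z).mul hshift
  conv_lhs => rw [funext rGamma_eq_mul_rGamma_add_one]
  simpa using hmul.deriv

lemma rGamma_neg_natCast (n : ℕ) : rGamma (-n) = 0 := by
  simp [rGamma, Complex.Gamma_neg_nat_eq_zero]

lemma rGamma_natCast_add_one (n : ℕ) : rGamma (n + 1) = (n.factorial : ℂ)⁻¹ := by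
  simp [rGamma, Complex.Gamma_nat_eq_factorial]

lemma deriv_rGamma_neg_natCast (n : ℕ) : deriv rGamma (-n) = (-1) ^ n * n.factorial := by
  induction n with
  | zero =>
    rw [deriv_rGamma_eq]
    simp [rGamma]
  | succ n ih =>
    have hshift : -((n + 1 : ℕ) : ℂ) + 1 = -n := by push_cast; ring
    rw [deriv_rGamma_eq, hshift, rGamma_neg_natCast, ih, Nat.factorial_succ]
    push_cast
    ring

lemma neg_one_pow_mul_factorial_ne_zero (n : ℕ) : (-1 : ℂ) ^ n * n.factorial ≠ 0 := by
  simp [Nat.factorial_ne_zero]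

lemma norm_rGamma_add_one_le {z : ℂ} (hz : 1 ≤ ‖z‖) : ‖rGamma (z + 1)‖ ≤ ‖rGamma z‖ := by
  rw [rGamma_eq_mul_rGamma_add_one z, norm_mul]
  exact le_mul_of_one_le_left (norm_nonneg _) hz

lemma exists_bound_rGamma (R : ℝ) :
    ∃ C : ℝ, ∀ ν : ℂ, ‖ν‖ ≤ R → ∀ k : ℕ, ‖rGamma (ν + k)‖ ≤ C := by
  obtain ⟨N, hN⟩ := exists_nat_gt (R + 1)
  obtain ⟨C, hC⟩ := (isCompact_closedBall (0 : ℂ) (R + N)).exists_bound_of_continuousOn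
    differentiable_rGamma.continuous.continuousOn
  have hsmall : ∀ ν : ℂ, ‖ν‖ ≤ R → ∀ k ≤ N, ‖rGamma (ν + k)‖ ≤ C := fun ν hν k hk => by
    refine hC _ (mem_closedBall_zero_iff.2 ((norm_add_le _ _).trans ?_))
    rw [Complex.norm_natCast]
    gcongr
  refine ⟨C, fun ν hν k => ?_⟩
  rcases le_total k N with hk | hk
  · exact hsmall ν hν k hk
  induction k, hk using Nat.le_induction with
  | base => exact hsmall ν hν N le_rfl
  | succ k hNk ih =>
    have hfar : 1 ≤ ‖ν + k‖ := by
      have hsub := norm_sub_le_norm_add (k : ℂ) ν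
      rw [Complex.norm_natCast, add_comm] at hsub
      have : (N : ℝ) ≤ k := by exact_mod_cast hNk
      linarith
    rw [Nat.cast_succ, ← add_assoc]
    exact (norm_rGamma_add_one_le hfar).trans ih

lemma exists_bound_deriv_rGamma (R : ℝ) :
    ∃ C : ℝ, ∀ ν : ℂ, ‖ν‖ ≤ R → ∀ k : ℕ, ‖deriv rGamma (ν + k)‖ ≤ C := by
  obtain ⟨C, hC⟩ := exists_bound_rGamma (R + 1)
  refine ⟨C, fun ν hν k => ?_⟩
  have hcauchy := Complex.norm_deriv_le_of_forall_mem_sphere_norm_le (c := ν + k) (f := rGamma)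
    (C := C) one_pos differentiable_rGamma.diffContOnCl fun z hz => by
      have hdist : ‖z - (ν + k)‖ = 1 := by simpa [dist_eq_norm] using hz
      rw [← sub_add_cancel z (k : ℂ)]
      refine hC _ ?_ k
      calc ‖z - k‖ = ‖ν + (z - (ν + k))‖ := by congr 1; ring
        _ ≤ R + 1 := (norm_add_le _ _).trans (add_le_add hν hdist.le)
  simpa using hcauchy

lemma exists_bound_rGamma_add_one (ν : ℂ) : ∃ C : ℝ, ∀ k : ℕ, ‖rGamma (ν + k + 1)‖ ≤ C := by
  obtain ⟨C, hC⟩ := exists_bound_rGamma ‖ν + 1‖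
  exact ⟨C, fun k => by simpa [add_right_comm] using hC (ν + 1) le_rfl k⟩

lemma exists_bound_deriv_rGamma_add_one (ν : ℂ) :
    ∃ C : ℝ, ∀ k : ℕ, ‖deriv rGamma (ν + k + 1)‖ ≤ C := by
  obtain ⟨C, hC⟩ := exists_bound_deriv_rGamma ‖ν + 1‖
  exact ⟨C, fun k => by simpa [add_right_comm] using hC (ν + 1) le_rfl k⟩

/-! ### The Bessel–Clifford function -/

/-- The Bessel–Clifford function `∑ t^k / (k! Γ(ν+k+1))`, the entire factor of the Bessel function:
`J_ν(z) = (z/2)^ν besselClifford ν (-z²/4)`. -/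
def besselClifford (ν t : ℂ) : ℂ := expGenFun (fun k => rGamma (ν + k + 1)) t

/-- The derivative of `besselClifford ν t` with respect to the order `ν`, which enters the Bessel
function of the second kind. -/
def dBesselClifford (ν t : ℂ) : ℂ := expGenFun (fun k => deriv rGamma (ν + k + 1)) t

lemma hasDerivAt_besselClifford (ν t : ℂ) :
    HasDerivAt (besselClifford ν) (besselClifford (ν + 1) t) t := by
  obtain ⟨C, hC⟩ := exists_bound_rGamma_add_one ν
  refine (hasDerivAt_expGenFun hC t).congr_deriv ?_
  simp only [besselClifford, Nat.cast_succ, add_comm, add_left_comm]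

lemma hasDerivAt_dBesselClifford (ν t : ℂ) :
    HasDerivAt (dBesselClifford ν) (dBesselClifford (ν + 1) t) t := by
  obtain ⟨C, hC⟩ := exists_bound_deriv_rGamma_add_one ν
  refine (hasDerivAt_expGenFun hC t).congr_deriv ?_
  simp only [dBesselClifford, Nat.cast_succ, add_comm, add_left_comm]

lemma continuous_besselClifford (ν : ℂ) : Continuous (besselClifford ν) :=
  continuous_iff_continuousAt.2 fun t => (hasDerivAt_besselClifford ν t).continuousAt

lemma continuous_dBesselClifford (ν : ℂ) : Continuous (dBesselClifford ν) :=
  continuous_iff_continuousAt.2 fun t => (hasDerivAt_dBesselClifford ν t).continuousAt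

lemma hasDerivAt_besselClifford_order (ν t : ℂ) :
    HasDerivAt (fun μ => besselClifford μ t) (dBesselClifford ν t) ν := by
  obtain ⟨C, hC⟩ := exists_bound_rGamma (‖ν + 1‖ + 1)
  have hν : ν ∈ Metric.ball ν 1 := Metric.mem_ball_self one_pos
  have hsummable := (Real.summable_pow_div_factorial ‖t‖).mul_right C
  have hterm : ∀ k : ℕ, DifferentiableOn ℂ
      (fun μ : ℂ => t ^ k / (k.factorial : ℂ) * rGamma (μ + k + 1)) (Metric.ball ν 1) := fun k =>
    ((differentiable_rGamma.comp (by fun_prop)).const_mul _).differentiableOn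
  have hbound : ∀ (k : ℕ), ∀ μ ∈ Metric.ball ν 1,
      ‖t ^ k / (k.factorial : ℂ) * rGamma (μ + k + 1)‖ ≤ ‖t‖ ^ k / k.factorial * C :=
    fun k μ hμ => by
      have hdist : ‖μ - ν‖ < 1 := by simpa [dist_eq_norm] using hμ
      have hμ' : ‖μ + 1‖ ≤ ‖ν + 1‖ + 1 := by
        calc ‖μ + 1‖ = ‖(ν + 1) + (μ - ν)‖ := by congr 1; ring
          _ ≤ ‖ν + 1‖ + 1 := (norm_add_le _ _).trans (by gcongr)
      refine norm_pow_div_factorial_mul_le (c := fun k : ℕ => rGamma (μ + k + 1)) (fun j => ?_)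
        le_rfl k
      simpa [add_right_comm] using hC (μ + 1) hμ' j
  have hsum := Complex.hasSum_deriv_of_summable_norm hsummable hterm Metric.isOpen_ball hbound hν
  have hdiff := (Complex.differentiableOn_tsum_of_summable_norm hsummable hterm Metric.isOpen_ball
    hbound).differentiableAt (Metric.isOpen_ball.mem_nhds hν)
  refine hdiff.hasDerivAt.congr_deriv (hsum.tsum_eq.symm.trans (tsum_congr fun k => ?_))
  have hshift := (differentiable_rGamma (ν + (k + 1))).hasDerivAt.comp_add_const ν ((k : ℂ) + 1)
  simpa only [add_assoc] using (hshift.const_mul (t ^ k / (k.factorial : ℂ))).deriv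

lemma besselClifford_eq (ν t : ℂ) :
    besselClifford ν t = (ν + 1) * besselClifford (ν + 1) t + t * besselClifford (ν + 2) t := by
  obtain ⟨C, hC⟩ := exists_bound_rGamma_add_one (ν + 1)
  have hsum := ((hasSum_expGenFun hC t).mul_left (ν + 1)).add (hasSum_natCast_mul_expGenFun hC t)
  have hsum' : HasSum (fun k : ℕ => t ^ k / (k.factorial : ℂ) * rGamma (ν + k + 1)) _ :=
    hsum.congr_fun fun k => by
      rw [rGamma_eq_mul_rGamma_add_one (ν + k + 1), show ν + k + 1 + 1 = ν + 1 + k + 1 by ring]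
      ring
  rw [besselClifford, expGenFun, hsum'.tsum_eq]
  simp only [besselClifford]
  congr 3
  funext k
  congr 2
  push_cast
  ring

lemma dBesselClifford_eq (ν t : ℂ) :
    dBesselClifford ν t = besselClifford (ν + 1) t + (ν + 1) * dBesselClifford (ν + 1) t +
      t * dBesselClifford (ν + 2) t := by
  refine (hasDerivAt_besselClifford_order ν t).unique ?_
  have hord : ∀ a : ℂ, HasDerivAt (fun μ => besselClifford (μ + a) t)
      (dBesselClifford (ν + a) t) ν := fun a =>
    (hasDerivAt_besselClifford_order (ν + a) t).comp_add_const ν a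
  have hrec := (((hasDerivAt_id ν).add_const 1).mul (hord 1)).add ((hord 2).const_mul t)
  simp only [id, one_mul] at hrec
  exact hrec.congr_of_eventuallyEq (Eventually.of_forall fun μ => besselClifford_eq μ t)

lemma besselClifford_neg_natCast (n : ℕ) (t : ℂ) :
    besselClifford (-n) t = t ^ n * besselClifford n t := by
  obtain ⟨C, hC⟩ := exists_bound_rGamma_add_one (-n)
  obtain ⟨C', hC'⟩ := exists_bound_rGamma_add_one n
  have hvanish :
      ∑ i ∈ Finset.range n, t ^ i / (i.factorial : ℂ) * rGamma (-n + i + 1) = 0 := by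
    refine Finset.sum_eq_zero fun i hi => ?_
    obtain ⟨j, rfl⟩ := Nat.exists_eq_add_of_lt (Finset.mem_range.1 hi)
    have : -((i + j + 1 : ℕ) : ℂ) + i + 1 = -j := by push_cast; ring
    rw [this, rGamma_neg_natCast, mul_zero]
  have htail := hasSum_expGenFun hC t
  rw [← hasSum_nat_add_iff' n, hvanish, sub_zero] at htail
  refine htail.unique (((hasSum_expGenFun hC' t).mul_left (t ^ n)).congr_fun fun k => ?_)
  have hpos : (n : ℂ) + k + 1 = ((n + k : ℕ) : ℂ) + 1 := by push_cast; ring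
  have hneg : -(n : ℂ) + ((k + n : ℕ) : ℂ) + 1 = k + 1 := by push_cast; ring
  rw [hpos, hneg, rGamma_natCast_add_one, rGamma_natCast_add_one, add_comm n k, pow_add]
  ring

lemma besselClifford_natCast_eq (n : ℕ) (t : ℂ) :
    besselClifford n t =
      (n + 1) * besselClifford (n + 1 : ℕ) t + t * besselClifford (n + 2 : ℕ) t := by
  exact_mod_cast besselClifford_eq n t

lemma dBesselClifford_natCast_eq (n : ℕ) (t : ℂ) :
    dBesselClifford n t = besselClifford (n + 1 : ℕ) t + (n + 1) * dBesselClifford (n + 1 : ℕ) t +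
      t * dBesselClifford (n + 2 : ℕ) t := by
  exact_mod_cast dBesselClifford_eq n t

lemma hasDerivAt_besselClifford_natCast (n : ℕ) (t : ℂ) :
    HasDerivAt (besselClifford n) (besselClifford (n + 1 : ℕ) t) t := by
  exact_mod_cast hasDerivAt_besselClifford n t

lemma hasDerivAt_dBesselClifford_natCast (n : ℕ) (t : ℂ) :
    HasDerivAt (dBesselClifford n) (dBesselClifford (n + 1 : ℕ) t) t := by
  exact_mod_cast hasDerivAt_dBesselClifford n t

lemma besselClifford_natCast_zero (n : ℕ) : besselClifford n 0 = (n.factorial : ℂ)⁻¹ := by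
  simp [besselClifford, expGenFun_zero, rGamma_natCast_add_one]

lemma dBesselClifford_neg_natCast_succ_zero (n : ℕ) :
    dBesselClifford (-((n + 1 : ℕ) : ℂ)) 0 = (-1) ^ n * n.factorial := by
  rw [dBesselClifford, expGenFun_zero, ← deriv_rGamma_neg_natCast]
  congr 1
  push_cast
  ring

lemma exists_ofReal_eq_besselClifford_natCast (n : ℕ) (t : ℝ) :
    ∃ a : ℝ, besselClifford n t = a ∧ (0 ≤ t → (n.factorial : ℝ)⁻¹ ≤ a) := by
  have hterm : ∀ k : ℕ, (t : ℂ) ^ k / (k.factorial : ℂ) * rGamma (n + k + 1) =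
      ((t ^ k / k.factorial * ((n + k).factorial : ℝ)⁻¹ : ℝ) : ℂ) := fun k => by
    rw [show (n : ℂ) + k + 1 = ((n + k : ℕ) : ℂ) + 1 by push_cast; ring, rGamma_natCast_add_one]
    push_cast
    ring
  obtain ⟨C, hC⟩ := exists_bound_rGamma_add_one n
  have hsummable := (hasSum_expGenFun hC (t : ℂ)).summable
  simp only [hterm] at hsummable
  refine ⟨∑' k : ℕ, t ^ k / k.factorial * ((n + k).factorial : ℝ)⁻¹, ?_, fun ht => ?_⟩
  · rw [besselClifford, expGenFun, Complex.ofReal_tsum]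
    exact tsum_congr hterm
  · have hle := (Complex.summable_ofReal.1 hsummable).le_tsum 0 fun k _ => by positivity
    simpa using hle

/-! ### Regular and singular solutions -/

/-- The mode `t^k besselClifford k t = (z/2)^k J_k(z)` up to sign, where `t = -z²/4`: the solution
that is regular at the origin. -/
def regularSol (k : ℕ) (t : ℂ) : ℂ := t ^ k * besselClifford k t

/-- The solution that is singular at the origin, for a value `L` of `log t`.  With `t = -z²/4` it is
`(z/2)^k H_k(z)` up to a constant factor, for a suitable branch of the logarithm. -/
def singularSol (k : ℕ) (L t : ℂ) : ℂ :=
  dBesselClifford (-k) t + t ^ k * (L * besselClifford k t + dBesselClifford k t)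

lemma continuous_regularSol (k : ℕ) : Continuous (regularSol k) :=
  (continuous_pow k).mul (continuous_besselClifford k)

lemma hasDerivAt_regularSol (k : ℕ) (t : ℂ) :
    HasDerivAt (regularSol (k + 1)) (regularSol k t) t := by
  refine ((hasDerivAt_pow (k + 1) t).mul
    (hasDerivAt_besselClifford_natCast (k + 1) t)).congr_deriv ?_
  rw [regularSol, besselClifford_natCast_eq k t, Nat.add_sub_cancel]
  push_cast
  ring_nf

lemma regularSol_add_two (k : ℕ) (t : ℂ) :
    regularSol (k + 2) t = t * regularSol k t - (k + 1) * regularSol (k + 1) t := by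
  simp only [regularSol]
  rw [besselClifford_natCast_eq k t]
  ring

lemma hasDerivAt_singularSol (k : ℕ) {L : ℂ → ℂ} {t : ℂ} (hL : HasDerivAt L t⁻¹ t) (ht : t ≠ 0) :
    HasDerivAt (fun t => singularSol (k + 1) (L t) t) (singularSol k (L t) t) t := by
  have hneg := hasDerivAt_dBesselClifford (-((k + 1 : ℕ) : ℂ)) t
  rw [show -((k + 1 : ℕ) : ℂ) + 1 = -k by push_cast; ring] at hneg
  have hsum := hneg.add ((hL.mul (hasDerivAt_regularSol k t)).add
    ((hasDerivAt_pow (k + 1) t).mul (hasDerivAt_dBesselClifford_natCast (k + 1) t)))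
  have hfun : (fun t => singularSol (k + 1) (L t) t) = dBesselClifford (-((k + 1 : ℕ) : ℂ)) +
      (L * regularSol (k + 1) + (fun t => t ^ (k + 1)) * dBesselClifford (k + 1 : ℕ)) := by
    funext t
    simp only [singularSol, regularSol, Pi.add_apply, Pi.mul_apply]
    ring
  rw [hfun]
  refine hsum.congr_deriv ?_
  rw [singularSol, regularSol, regularSol, dBesselClifford_natCast_eq k t, Nat.add_sub_cancel]
  push_cast
  field_simp
  ring_nf

lemma singularSol_add_two (k : ℕ) (L t : ℂ) :
    singularSol (k + 2) L t = t * singularSol k L t - (k + 1) * singularSol (k + 1) L t := by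
  have hneg := dBesselClifford_eq (-((k + 2 : ℕ) : ℂ)) t
  rw [show -((k + 2 : ℕ) : ℂ) + 1 = -((k + 1 : ℕ) : ℂ) by push_cast; ring,
    show -((k + 2 : ℕ) : ℂ) + 2 = -(k : ℂ) by push_cast; ring, besselClifford_neg_natCast] at hneg
  simp only [singularSol]
  rw [hneg, besselClifford_natCast_eq k t, dBesselClifford_natCast_eq k t]
  push_cast
  ring

lemma singularSol_add (k : ℕ) (L c t : ℂ) :
    singularSol k (L + c) t = singularSol k L t + c * regularSol k t := by
  simp only [singularSol, regularSol]
  ring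

/-! ### Bessel and Hankel functions -/

lemma besselJ_eq (ν z : ℂ) :
    besselJ ν z = Complex.exp (Real.pi * Complex.I * ν / 2) * (z / (2 * Complex.I)) ^ ν *
      besselClifford ν (-z ^ 2 / 4) := by
  rw [besselJ, besselClifford, expGenFun]
  congr 1
  refine tsum_congr fun k => ?_
  rw [rGamma, div_mul_eq_mul_div, ← div_eq_mul_inv, div_div, mul_comm (Complex.Gamma _)]

lemma hasDerivAt_besselJ_order (ν : ℂ) {z : ℂ} (hz : z ≠ 0) :
    HasDerivAt (fun μ => besselJ μ z)
      (Complex.exp (Real.pi * Complex.I * ν / 2) * (z / (2 * Complex.I)) ^ ν *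
        ((Real.pi * Complex.I / 2 + Complex.log (z / (2 * Complex.I))) *
          besselClifford ν (-z ^ 2 / 4) + dBesselClifford ν (-z ^ 2 / 4))) ν := by
  have hbase : z / (2 * Complex.I) ≠ 0 := div_ne_zero hz (by simp)
  have hexp : HasDerivAt (fun μ : ℂ => Complex.exp (Real.pi * Complex.I * μ / 2))
      (Complex.exp (Real.pi * Complex.I * ν / 2) * (Real.pi * Complex.I / 2)) ν := by
    simpa using (((hasDerivAt_id ν).const_mul (Real.pi * Complex.I : ℂ)).div_const 2).cexp
  have hpow : HasDerivAt (fun μ : ℂ => (z / (2 * Complex.I)) ^ μ) _ ν :=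
    (hasDerivAt_id ν).const_cpow (Or.inl hbase)
  rw [funext fun μ => besselJ_eq μ z]
  refine ((hexp.mul hpow).mul (hasDerivAt_besselClifford_order ν (-z ^ 2 / 4))).congr_deriv ?_
  simp only [id, Pi.mul_apply]
  ring

lemma exp_mul_cpow_natCast (m : ℕ) (z : ℂ) :
    Complex.exp (Real.pi * Complex.I * m / 2) * (z / (2 * Complex.I)) ^ (m : ℂ) = (z / 2) ^ m := by
  rw [Complex.cpow_natCast, show (Real.pi * Complex.I * m / 2 : ℂ) = m * (Real.pi / 2 * Complex.I)
    by ring, Complex.exp_nat_mul, Complex.exp_pi_div_two_mul_I, ← mul_pow]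
  congr 1
  field_simp

lemma exp_mul_cpow_neg_natCast (m : ℕ) (z : ℂ) :
    Complex.exp (Real.pi * Complex.I * (-m) / 2) * (z / (2 * Complex.I)) ^ (-m : ℂ) =
      ((z / 2) ^ m)⁻¹ := by
  rw [← exp_mul_cpow_natCast, Complex.cpow_neg, mul_inv, ← Complex.exp_neg]
  congr 2
  ring

lemma hankelOne_natCast (m : ℕ) {z : ℂ} (hz : z ≠ 0) :
    hankelOne m z = Complex.I / Real.pi * (-1) ^ m * ((z / 2) ^ m)⁻¹ *
      singularSol m (2 * Complex.log (z / (2 * Complex.I))) (-z ^ 2 / 4) := by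
  simp only [hankelOne, besselY, Int.cast_natCast, zpow_natCast]
  rw [(hasDerivAt_besselJ_order (m : ℂ) hz).deriv, (hasDerivAt_besselJ_order (-m : ℂ) hz).deriv,
    besselJ_eq, exp_mul_cpow_natCast, exp_mul_cpow_neg_natCast, besselClifford_neg_natCast,
    singularSol]
  have hz_pow : (z / 2) ^ m ≠ 0 := pow_ne_zero _ (div_ne_zero hz two_ne_zero)
  have hpi : (Real.pi : ℂ) ≠ 0 := by exact_mod_cast Real.pi_ne_zero
  have hsign : ((-1 : ℂ) ^ m) * (-1) ^ m = 1 := by rw [← mul_pow]; simp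
  have hsq : (z / 2) ^ m * (z / 2) ^ m = (-1) ^ m * (-z ^ 2 / 4) ^ m := by
    rw [← mul_pow, ← mul_pow]
    congr 1
    ring
  set t := -z ^ 2 / 4
  set q := (z / 2) ^ m
  set L := Complex.log (z / (2 * Complex.I))
  set s : ℂ := (-1) ^ m
  have hq : q = s * t ^ m * q⁻¹ := by rw [← hsq, mul_inv_cancel_right₀ hz_pow]
  rw [show q * besselClifford m t = s * t ^ m * q⁻¹ * besselClifford m t by rw [← hq],
    show q * ((Real.pi * Complex.I / 2 + L) * besselClifford m t + dBesselClifford m t) =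
      s * t ^ m * q⁻¹ * ((Real.pi * Complex.I / 2 + L) * besselClifford m t + dBesselClifford m t)
      by rw [← hq]]
  field_simp
  linear_combination (2 * s * t ^ m * Real.pi * besselClifford m t) * Complex.I_mul_I

/-! ### The singular solution near the origin -/

/-- The half plane `0 < σ Re t`. -/
def halfPlane (σ : ℝ) : Set ℂ := {t | 0 < σ * t.re}

lemma mem_halfPlane {σ : ℝ} {t : ℂ} : t ∈ halfPlane σ ↔ 0 < σ * t.re := Iff.rfl

lemma ne_zero_of_mem_halfPlane {σ : ℝ} {t : ℂ} (ht : t ∈ halfPlane σ) : t ≠ 0 := by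
  rintro rfl
  simp [halfPlane] at ht

lemma isOpen_halfPlane (σ : ℝ) : IsOpen (halfPlane σ) :=
  isOpen_lt continuous_const (by fun_prop)

lemma convex_halfPlane (σ : ℝ) : Convex ℝ (halfPlane σ) :=
  convex_halfSpace_gt ⟨fun x y => by simp [mul_add], fun a x => by simp [mul_left_comm]⟩ 0

lemma ofReal_mul_mem_halfPlane {σ a : ℝ} (ha : 0 < a) {t : ℂ} (ht : t ∈ halfPlane σ) :
    (a : ℂ) * t ∈ halfPlane σ := by
  rw [mem_halfPlane] at ht ⊢
  rw [Complex.re_ofReal_mul, mul_left_comm]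
  exact mul_pos ha ht

/-- A branch of the logarithm on the half plane `0 < σ Re t`, shifted by the constant `c`. -/
def branchLog (σ : ℝ) (c t : ℂ) : ℂ := Complex.log (σ * t) + c

lemma hasDerivAt_branchLog {σ : ℝ} {c t : ℂ} (ht : t ∈ halfPlane σ) :
    HasDerivAt (branchLog σ c) t⁻¹ t := by
  have hslit : (σ : ℂ) * t ∈ Complex.slitPlane := Or.inl (by simpa [halfPlane] using ht)
  have ht0 : t ≠ 0 := ne_zero_of_mem_halfPlane ht
  have hσ0 : (σ : ℂ) ≠ 0 := left_ne_zero_of_mul (Complex.slitPlane_ne_zero hslit)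
  refine ((((hasDerivAt_id t).const_mul (σ : ℂ)).clog hslit).add_const c).congr_deriv ?_
  simp only [id]
  field_simp

lemma norm_branchLog_le {σ : ℝ} (hσ : |σ| = 1) (c t : ℂ) :
    ‖branchLog σ c t‖ ≤ |Real.log ‖t‖| + (Real.pi + ‖c‖) := by
  have hlog : ‖Complex.log (σ * t)‖ ≤ |Real.log ‖t‖| + Real.pi := by
    refine (Complex.norm_le_abs_re_add_abs_im _).trans (add_le_add ?_ ?_)
    · rw [Complex.log_re, norm_mul, Complex.norm_real, Real.norm_eq_abs, hσ, one_mul]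
    · rw [Complex.log_im]
      exact Complex.abs_arg_le_pi _
  rw [← add_assoc]
  exact (norm_add_le _ _).trans (add_le_add_left hlog _)

lemma mul_branchLog_isBigO {σ : ℝ} (hσ : |σ| = 1) (c : ℂ) :
    (fun t => t * branchLog σ c t) =O[𝓝 0] fun t => ‖t‖ * (1 + |Real.log ‖t‖|) := by
  refine IsBigO.of_bound (1 + (Real.pi + ‖c‖)) (Eventually.of_forall fun t => ?_)
  rw [norm_mul, Real.norm_of_nonneg (by positivity), mul_left_comm]
  refine mul_le_mul_of_nonneg_left ((norm_branchLog_le hσ c t).trans ?_) (norm_nonneg t)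
  have hK : 0 ≤ Real.pi + ‖c‖ := by positivity
  nlinarith [abs_nonneg (Real.log ‖t‖)]

lemma tendsto_mul_branchLog {σ : ℝ} (hσ : |σ| = 1) (c : ℂ) :
    Tendsto (fun t => t * branchLog σ c t) (𝓝 0) (𝓝 0) := by
  refine (mul_branchLog_isBigO hσ c).trans_tendsto ?_
  have hcont : Continuous fun t : ℂ => ‖t‖ + |‖t‖ * Real.log ‖t‖| :=
    continuous_norm.add (Real.continuous_mul_log.comp continuous_norm).abs
  have hlim := hcont.tendsto 0
  simp only [norm_zero, zero_mul, abs_zero, add_zero] at hlim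
  refine hlim.congr fun t => ?_
  rw [abs_mul, abs_norm, mul_add, mul_one]

/-- The singular solution on the branch `branchLog σ c` of the logarithm. -/
def singularBranch (σ : ℝ) (c : ℂ) (n : ℕ) (t : ℂ) : ℂ := singularSol n (branchLog σ c t) t

lemma hasDerivAt_singularBranch {σ : ℝ} {c t : ℂ} (n : ℕ) (ht : t ∈ halfPlane σ) :
    HasDerivAt (singularBranch σ c (n + 1)) (singularBranch σ c n t) t :=
  hasDerivAt_singularSol n (hasDerivAt_branchLog ht) (ne_zero_of_mem_halfPlane ht)

lemma singularBranch_add_two (σ : ℝ) (c : ℂ) (n : ℕ) (t : ℂ) :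
    singularBranch σ c (n + 2) t =
      t * singularBranch σ c n t - (n + 1) * singularBranch σ c (n + 1) t :=
  singularSol_add_two n _ t

lemma singularBranch_succ_eq (σ : ℝ) (c : ℂ) (n : ℕ) (t : ℂ) :
    singularBranch σ c (n + 1) t = dBesselClifford (-((n + 1 : ℕ) : ℂ)) t +
      t ^ n * ((t * branchLog σ c t) * besselClifford (n + 1 : ℕ) t +
        t * dBesselClifford (n + 1 : ℕ) t) := by
  rw [singularBranch, singularSol]
  ring

lemma tendsto_branchLog_remainder {σ : ℝ} (hσ : |σ| = 1) (c : ℂ) (n : ℕ) :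
    Tendsto (fun t => (t * branchLog σ c t) * besselClifford (n + 1 : ℕ) t +
      t * dBesselClifford (n + 1 : ℕ) t) (𝓝 0) (𝓝 0) := by
  have hA := (continuous_besselClifford (n + 1 : ℕ)).tendsto 0
  have hB := (continuous_dBesselClifford (n + 1 : ℕ)).tendsto 0
  simpa using ((tendsto_mul_branchLog hσ c).mul hA).add (tendsto_id.mul hB)

lemma tendsto_singularBranch {σ : ℝ} (hσ : |σ| = 1) (c : ℂ) (n : ℕ) :
    Tendsto (singularBranch σ c (n + 1)) (𝓝 0) (𝓝 ((-1) ^ n * n.factorial)) := by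
  have hB := (continuous_dBesselClifford (-((n + 1 : ℕ) : ℂ))).tendsto 0
  rw [dBesselClifford_neg_natCast_succ_zero] at hB
  have hsum := hB.add (((tendsto_id (x := 𝓝 (0 : ℂ))).pow n).mul
    (tendsto_branchLog_remainder hσ c n))
  rw [mul_zero, add_zero] at hsum
  exact hsum.congr fun t => (singularBranch_succ_eq σ c n t).symm

lemma dBesselClifford_sub_isBigO (n : ℕ) :
    (fun t => dBesselClifford (-((n + 1 : ℕ) : ℂ)) t - (-1) ^ n * n.factorial) =O[𝓝 0]
      fun t => t := by
  simpa only [dBesselClifford_neg_natCast_succ_zero, sub_zero] using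
    (hasDerivAt_dBesselClifford (-((n + 1 : ℕ) : ℂ)) 0).isBigO_sub

lemma singularBranch_add_two_sub_isBigO {σ : ℝ} (hσ : |σ| = 1) (c : ℂ) (n : ℕ) :
    (fun t => singularBranch σ c (n + 2) t - (-1) ^ (n + 1) * (n + 1).factorial) =O[𝓝 0]
      fun t => t := by
  have hrem := (((tendsto_id (x := 𝓝 (0 : ℂ))).pow n).mul
    (tendsto_branchLog_remainder hσ c (n + 1))).isBigO_one ℂ
  have hmul := (isBigO_refl (fun t : ℂ => t) (𝓝 0)).mul hrem
  simp only [mul_one] at hmul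
  refine ((dBesselClifford_sub_isBigO (n + 1)).add hmul).congr_left fun t => ?_
  rw [singularBranch_succ_eq, pow_succ t n, id]
  ring

lemma singularBranch_one_sub_isBigO {σ : ℝ} (hσ : |σ| = 1) (c : ℂ) :
    (fun t => singularBranch σ c 1 t - 1) =O[𝓝 0] fun t => ‖t‖ * (1 + |Real.log ‖t‖|) := by
  have hid : (fun t : ℂ => t) =O[𝓝 0] fun t => ‖t‖ * (1 + |Real.log ‖t‖|) := by
    refine IsBigO.of_bound 1 (Eventually.of_forall fun t => ?_)
    rw [one_mul, Real.norm_of_nonneg (by positivity)]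
    exact le_mul_of_one_le_right (norm_nonneg _) (by linarith [abs_nonneg (Real.log ‖t‖)])
  have hA := (mul_branchLog_isBigO hσ c).mul
    (((continuous_besselClifford (0 + 1 : ℕ)).tendsto 0).isBigO_one ℝ)
  have hB := hid.mul (((continuous_dBesselClifford (0 + 1 : ℕ)).tendsto 0).isBigO_one ℝ)
  simp only [mul_one] at hA hB
  refine (((dBesselClifford_sub_isBigO 0).trans hid).add (hA.add hB)).congr_left fun t => ?_
  rw [singularBranch_succ_eq, pow_zero, pow_zero, Nat.factorial_zero, Nat.cast_one]
  ring

lemma wronskian_besselClifford_singularBranch {σ : ℝ} (hσ : |σ| = 1) (c : ℂ) (n : ℕ) {t : ℂ}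
    (ht : t ∈ halfPlane σ) :
    besselClifford (n + 1 : ℕ) t * singularBranch σ c (n + 2) t -
      t * besselClifford (n + 2 : ℕ) t * singularBranch σ c (n + 1) t = (-1) ^ (n + 1) := by
  set w : ℂ → ℂ := fun t => besselClifford (n + 1 : ℕ) t * singularBranch σ c (n + 2) t -
    t * besselClifford (n + 2 : ℕ) t * singularBranch σ c (n + 1) t
  have hderiv : ∀ s ∈ halfPlane σ, HasDerivAt w 0 s := fun s hs => by
    refine (((hasDerivAt_besselClifford_natCast (n + 1) s).mul
      (hasDerivAt_singularBranch (c := c) (n + 1) hs)).sub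
      (((hasDerivAt_id s).mul (hasDerivAt_besselClifford_natCast (n + 2) s)).mul
        (hasDerivAt_singularBranch (c := c) n hs))).congr_deriv ?_
    simp only [id, Pi.mul_apply, one_mul]
    rw [singularBranch_add_two σ c n s, besselClifford_natCast_eq (n + 1) s]
    push_cast
    ring_nf
  have hconst : ∀ s ∈ halfPlane σ, w s = w t := fun s hs =>
    (isOpen_halfPlane σ).is_const_of_deriv_eq_zero (convex_halfPlane σ).isPreconnected
      (fun z hz => (hderiv z hz).differentiableAt.differentiableWithinAt)
      (fun z hz => (hderiv z hz).deriv) hs ht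
  have hlim : Tendsto w (𝓝 0) (𝓝 ((-1) ^ (n + 1))) := by
    have hfac : ((n + 1).factorial : ℂ) ≠ 0 := by exact_mod_cast (n + 1).factorial_ne_zero
    have hA : Tendsto (besselClifford (n + 1 : ℕ)) (𝓝 0) (𝓝 ((n + 1).factorial : ℂ)⁻¹) :=
      besselClifford_natCast_zero (n + 1) ▸ (continuous_besselClifford (n + 1 : ℕ)).tendsto 0
    have hprod := (hA.mul (tendsto_singularBranch hσ c (n + 1))).sub
      (((tendsto_id (x := 𝓝 (0 : ℂ))).mul
        ((continuous_besselClifford (n + 2 : ℕ)).tendsto 0)).mul (tendsto_singularBranch hσ c n))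
    rw [zero_mul, zero_mul, sub_zero, mul_left_comm, inv_mul_cancel₀ hfac, mul_one] at hprod
    exact hprod
  have hray : Tendsto (fun a : ℝ => (a : ℂ) * t) (𝓝[>] 0) (𝓝 0) := by
    have hcont : Continuous fun a : ℝ => (a : ℂ) * t := by fun_prop
    simpa using (hcont.tendsto 0).mono_left nhdsWithin_le_nhds
  refine tendsto_nhds_unique (tendsto_const_nhds.congr' ?_) (hlim.comp hray)
  filter_upwards [self_mem_nhdsWithin] with a ha
  exact (hconst _ (ofReal_mul_mem_halfPlane ha ht)).symm

lemma exists_mem_halfPlane {x : ℝ} (hx : x ≠ 0) : ∃ σ : ℝ, |σ| = 1 ∧ (x : ℂ) ∈ halfPlane σ := by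
  rcases lt_or_gt_of_ne hx with hx | hx
  · exact ⟨-1, by simp, by simpa [halfPlane] using hx⟩
  · exact ⟨1, by simp, by simpa [halfPlane] using hx⟩

lemma besselClifford_add_two_ne_zero (n : ℕ) {x : ℝ} (hx : besselClifford (n + 1 : ℕ) x = 0) :
    besselClifford (n + 2 : ℕ) x ≠ 0 := by
  intro h
  rcases eq_or_ne x 0 with rfl | h0
  · rw [Complex.ofReal_zero, besselClifford_natCast_zero] at h
    exact inv_ne_zero (by exact_mod_cast (n + 2).factorial_ne_zero) h
  · obtain ⟨σ, hσ, hmem⟩ := exists_mem_halfPlane h0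
    have hW := wronskian_besselClifford_singularBranch hσ 0 n hmem
    rw [hx, h, zero_mul, mul_zero, zero_mul, sub_zero] at hW
    exact pow_ne_zero (n + 1) (neg_ne_zero.2 one_ne_zero) hW.symm

/-! ### Zeros of almost linear functions -/

lemma approximatesLinearOn_of_norm_deriv_sub_le {𝕜 : Type*} [RCLike 𝕜] {f f' : 𝕜 → 𝕜} {D : 𝕜}
    {s : Set 𝕜} {C : NNReal} (hs : Convex ℝ s) (hf : ∀ z ∈ s, HasDerivAt f (f' z) z)
    (hC : ∀ z ∈ s, ‖f' z - D‖ ≤ C) :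
    ApproximatesLinearOn f (ContinuousLinearMap.toSpanSingleton 𝕜 D) s C := by
  intro x hx y hy
  have hmvt := hs.norm_image_sub_le_of_norm_hasDerivWithin_le (f := fun z => f z - z * D)
    (fun z hz => ((hf z hz).sub (hasDerivAt_mul_const D)).hasDerivWithinAt) hC hy hx
  refine (congrArg norm ?_).trans_le hmvt
  rw [ContinuousLinearMap.toSpanSingleton_apply, smul_eq_mul]
  ring

section ApproximatesLinear

variable {𝕜 : Type*} [NontriviallyNormedField 𝕜] {f : 𝕜 → 𝕜} {D : 𝕜} {s : Set 𝕜} {t z : 𝕜}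

lemma norm_sub_le_of_approximatesLinearOn (hD : D ≠ 0)
    (hf : ApproximatesLinearOn f (ContinuousLinearMap.toSpanSingleton 𝕜 D) s (‖D‖₊ / 2))
    (ht : t ∈ s) (hz : z ∈ s) (h0 : f t = 0) : ‖t - z‖ ≤ 2 / ‖D‖ * ‖f z‖ := by
  have happrox : ‖0 - f z - (t - z) * D‖ ≤ ‖D‖ / 2 * ‖t - z‖ := by
    simpa [h0] using hf t ht z hz
  have htri : ‖t - z‖ * ‖D‖ ≤ ‖0 - f z - (t - z) * D‖ + ‖f z‖ := by
    rw [← norm_mul, ← norm_neg ((t - z) * D)]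
    exact (congrArg norm (by ring)).trans_le (norm_add_le _ (f z))
  rw [div_mul_eq_mul_div, le_div_iff₀ (norm_pos_iff.2 hD)]
  linarith

lemma exists_zero_of_approximatesLinearOn [CompleteSpace 𝕜] (hD : D ≠ 0)
    (hf : ApproximatesLinearOn f (ContinuousLinearMap.toSpanSingleton 𝕜 D) s (‖D‖₊ / 2))
    (hs : Metric.closedBall z (2 / ‖D‖ * ‖f z‖) ⊆ s) :
    ∃ t ∈ Metric.closedBall z (2 / ‖D‖ * ‖f z‖), f t = 0 := by
  have hnorm : ‖D‖ ≠ 0 := norm_ne_zero_iff.2 hD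
  let inv : (ContinuousLinearMap.toSpanSingleton 𝕜 D).NonlinearRightInverse :=
    { toFun := fun y => y / D
      nnnorm := ‖D‖₊⁻¹
      bound' := fun y => by rw [norm_div, NNReal.coe_inv, coe_nnnorm, div_eq_inv_mul]
      right_inv' := fun y => by simp [hD] }
  have hradius : ((inv.nnnorm : ℝ)⁻¹ - ((‖D‖₊ / 2 : NNReal) : ℝ)) * (2 / ‖D‖ * ‖f z‖) = ‖f z‖ := by
    simp only [inv, NNReal.coe_inv, coe_nnnorm, inv_inv, NNReal.coe_div, NNReal.coe_ofNat]
    field_simp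
    ring
  refine hf.surjOn_closedBall_of_nonlinearRightInverse inv (by positivity) hs ?_
  rw [hradius]
  simp

end ApproximatesLinear

lemma taylor_two_isBigO {f : ℂ → ℂ} (hf : Differentiable ℂ f) (τ : ℂ) :
    (fun x => f (τ + x) - f τ - x * deriv f τ) =O[𝓝 0] fun x => x ^ 2 := by
  have hdslope : DifferentiableAt ℂ (dslope f τ) τ :=
    ((Complex.differentiableOn_dslope univ_mem).2 hf.differentiableOn).differentiableAt univ_mem
  have hshift : Tendsto (fun x => τ + x) (𝓝 0) (𝓝 τ) := by
    simpa using tendsto_const_nhds.add (tendsto_id (x := 𝓝 (0 : ℂ)))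
  have hO := (isBigO_refl (fun x : ℂ => x) (𝓝 0)).mul
    (hdslope.hasDerivAt.isBigO_sub.comp_tendsto hshift)
  refine hO.congr (fun x => ?_) fun x => by simp [sq]
  have := sub_smul_dslope f τ (τ + x)
  rw [add_sub_cancel_left, smul_eq_mul] at this
  rw [Function.comp_apply, mul_sub, this, dslope_same]

/-! ### The matching equation -/

/-- With `e = ερ²/4` and `t = -λ²ρ²/4`, the solution in the well and the one outside it are matched
at the boundary of the well if and only if this function of `(e, t)` vanishes.  Here `τ` stands for
`-a²ρ²/4`. -/
def matching (σ : ℝ) (c : ℂ) (n : ℕ) (τ e t : ℂ) : ℂ :=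
  besselClifford (n + 1 : ℕ) (τ + e + t) * singularBranch σ c (n + 2) t -
    t * besselClifford (n + 2 : ℕ) (τ + e + t) * singularBranch σ c (n + 1) t

lemma besselClifford_succ_eq (n : ℕ) (t : ℂ) :
    besselClifford (n + 1 : ℕ) t =
      (n + 2) * besselClifford (n + 2 : ℕ) t + t * besselClifford (n + 3 : ℕ) t := by
  refine (besselClifford_natCast_eq (n + 1) t).trans ?_
  congr 2
  push_cast
  ring

lemma hasDerivAt_matching {σ : ℝ} {c t : ℂ} (n : ℕ) (τ e : ℂ) (ht : t ∈ halfPlane σ) :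
    HasDerivAt (matching σ c n τ e)
      ((τ + e) * besselClifford (n + 3 : ℕ) (τ + e + t) * singularBranch σ c (n + 1) t) t := by
  have hA : ∀ k : ℕ, HasDerivAt (fun t => besselClifford k (τ + e + t))
      (besselClifford (k + 1 : ℕ) (τ + e + t)) t := fun k => by
    simpa using (hasDerivAt_besselClifford_natCast k (τ + e + t)).comp_const_add (τ + e) t
  refine (((hA (n + 1)).mul (hasDerivAt_singularBranch (c := c) (n + 1) ht)).sub
    (((hasDerivAt_id t).mul (hA (n + 2))).mul
      (hasDerivAt_singularBranch (c := c) n ht))).congr_deriv ?_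
  simp only [id, Pi.mul_apply, one_mul]
  rw [besselClifford_succ_eq n]
  linear_combination besselClifford (n + 2 : ℕ) (τ + e + t) * singularBranch_add_two σ c n t

/-- The limit of the derivative of `matching` in `t` at the origin. -/
def matchingSlope (n : ℕ) (τ : ℂ) : ℂ :=
  τ * besselClifford (n + 3 : ℕ) τ * ((-1) ^ n * n.factorial)

lemma matchingSlope_ne_zero {n : ℕ} {x : ℝ} (hx : besselClifford (n + 1 : ℕ) x = 0) :
    matchingSlope n x ≠ 0 := by
  have hrec : (x : ℂ) * besselClifford (n + 3 : ℕ) x =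
      -((n : ℂ) + 2) * besselClifford (n + 2 : ℕ) x := by
    linear_combination hx - besselClifford_succ_eq n x
  have hn2 : -((n : ℂ) + 2) ≠ 0 := neg_ne_zero.2 (by exact_mod_cast (n + 1).succ_ne_zero)
  rw [matchingSlope, hrec]
  exact mul_ne_zero (mul_ne_zero hn2 (besselClifford_add_two_ne_zero n hx))
    (neg_one_pow_mul_factorial_ne_zero n)

lemma tendsto_deriv_matching {σ : ℝ} (hσ : |σ| = 1) (c : ℂ) (n : ℕ) (τ : ℂ) :
    Tendsto (fun p : ℂ × ℂ =>
      (τ + p.1) * besselClifford (n + 3 : ℕ) (τ + p.1 + p.2) * singularBranch σ c (n + 1) p.2)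
      (𝓝 0) (𝓝 (matchingSlope n τ)) := by
  have hcont : Continuous fun p : ℂ × ℂ =>
      (τ + p.1) * besselClifford (n + 3 : ℕ) (τ + p.1 + p.2) := by
    have := continuous_besselClifford (n + 3 : ℕ)
    fun_prop
  have hA := hcont.tendsto 0
  simp only [Prod.fst_zero, Prod.snd_zero, add_zero] at hA
  exact hA.mul ((tendsto_singularBranch hσ c n).comp (continuous_snd.tendsto (0 : ℂ × ℂ)))

lemma exists_approximatesLinearOn_matching {σ : ℝ} (hσ : |σ| = 1) (c : ℂ) {n : ℕ} {τ : ℂ}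
    (hD : matchingSlope n τ ≠ 0) :
    ∃ δ > 0, ∀ e : ℂ, ‖e‖ < δ → ApproximatesLinearOn (matching σ c n τ e)
      (ContinuousLinearMap.toSpanSingleton ℂ (matchingSlope n τ))
      (halfPlane σ ∩ Metric.ball 0 δ) (‖matchingSlope n τ‖₊ / 2) := by
  obtain ⟨δ, hδ, hclose⟩ := Metric.eventually_nhds_iff_ball.1 ((tendsto_deriv_matching hσ c n τ
    ).eventually (Metric.closedBall_mem_nhds _ (half_pos (norm_pos_iff.2 hD))))
  refine ⟨δ, hδ, fun e he => ?_⟩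
  refine approximatesLinearOn_of_norm_deriv_sub_le ((convex_halfPlane σ).inter (convex_ball 0 δ))
    (fun z hz => hasDerivAt_matching n τ e hz.1) fun z hz => ?_
  have hmem : (e, z) ∈ Metric.ball (0 : ℂ × ℂ) δ := by
    rw [mem_ball_zero_iff, Prod.norm_def]
    exact max_lt he (mem_ball_zero_iff.1 hz.2)
  rw [NNReal.coe_div, coe_nnnorm, NNReal.coe_ofNat]
  rw [← dist_eq_norm]
  exact hclose (e, z) hmem
/-- The number `(n+1)/(n+2)`. -/
def modeRatio (n : ℕ) : ℝ := (n + 1) / (n + 2)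

lemma modeRatio_pos (n : ℕ) : 0 < modeRatio n := by
  unfold modeRatio
  positivity

lemma modeRatio_le_one (n : ℕ) : modeRatio n ≤ 1 := by
  unfold modeRatio
  rw [div_le_one (by positivity)]
  linarith

/-- The first-order approximation `-(n+1)/(n+2) e` of the zero `t` of `matching`. -/
def approxZero (n : ℕ) (e : ℝ) : ℂ := ((-(modeRatio n * e) : ℝ) : ℂ)

lemma norm_approxZero (n : ℕ) (e : ℝ) : ‖approxZero n e‖ = modeRatio n * |e| := by
  rw [approxZero, Complex.norm_real, Real.norm_eq_abs, abs_neg, abs_mul,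
    abs_of_pos (modeRatio_pos n)]

lemma norm_approxZero_le (n : ℕ) (e : ℝ) : ‖approxZero n e‖ ≤ |e| := by
  rw [norm_approxZero]
  exact mul_le_of_le_one_left (abs_nonneg e) (modeRatio_le_one n)

lemma approxZero_isBigO (n : ℕ) : approxZero n =O[𝓝[≠] 0] fun e : ℝ => e :=
  IsBigO.of_bound 1 (Eventually.of_forall fun e => by simpa using norm_approxZero_le n e)

lemma tendsto_approxZero (n : ℕ) : Tendsto (approxZero n) (𝓝[≠] 0) (𝓝 0) :=
  (approxZero_isBigO n).trans_tendsto (tendsto_id.mono_left nhdsWithin_le_nhds)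

lemma approxZero_mem_halfPlane {σ : ℝ} (n : ℕ) {e : ℝ} (he : σ * e < 0) :
    approxZero n e ∈ halfPlane σ := by
  rw [approxZero, mem_halfPlane, Complex.ofReal_re]
  nlinarith [modeRatio_pos n]

lemma closedBall_approxZero_subset {σ : ℝ} (hσ : |σ| = 1) (n : ℕ) {e : ℝ} (he : σ * e < 0) :
    Metric.closedBall (approxZero n e) (‖approxZero n e‖ / 2) ⊆ halfPlane σ := by
  intro t ht
  rw [mem_closedBall_iff_norm, norm_approxZero, approxZero] at ht
  have hre := (Complex.abs_re_le_norm _).trans ht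
  rw [Complex.sub_re, Complex.ofReal_re] at hre
  have hσre : |σ * (t.re - -(modeRatio n * e))| ≤ modeRatio n * |e| / 2 := by
    rwa [abs_mul, hσ, one_mul]
  have habs : |e| = -(σ * e) := by rw [← abs_of_neg he, abs_mul, hσ, one_mul]
  rw [habs] at hσre
  have hlower := (abs_le.1 hσre).1
  rw [mem_halfPlane]
  nlinarith [mul_pos (modeRatio_pos n) (neg_pos.2 he)]

/-- The order of magnitude of `matching` at `approxZero`. -/
def errorScale (n : ℕ) (e : ℝ) : ℝ := e ^ 2 * (1 + (if n = 0 then 1 else 0) * Real.log |e|)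

lemma errorScale_zero (e : ℝ) : errorScale 0 e = e ^ 2 * (1 + Real.log |e|) := by
  rw [errorScale, if_pos rfl, one_mul]

lemma errorScale_of_ne_zero {n : ℕ} (hn : n ≠ 0) (e : ℝ) : errorScale n e = e ^ 2 := by
  rw [errorScale, if_neg hn, zero_mul, add_zero, mul_one]

lemma tendsto_log_abs : Tendsto (fun e : ℝ => Real.log |e|) (𝓝[≠] 0) atBot := by
  simpa using Real.tendsto_log_nhdsNE_zero

lemma one_add_abs_log_isBigO :
    (fun e : ℝ => 1 + |Real.log (abs e)|) =O[𝓝[≠] 0] fun e => 1 + Real.log |e| := by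
  refine IsBigO.of_bound 3 ?_
  filter_upwards [tendsto_log_abs.eventually_le_atBot (-2)] with e he
  generalize Real.log |e| = L at he ⊢
  rw [Real.norm_of_nonneg (by positivity), Real.norm_eq_abs, abs_of_nonpos (by linarith),
    abs_of_nonpos (by linarith)]
  linarith

lemma one_isBigO_one_add_log :
    (fun _ : ℝ => (1 : ℝ)) =O[𝓝[≠] 0] fun e => 1 + Real.log |e| := by
  refine IsBigO.trans (IsBigO.of_bound 1 (Eventually.of_forall fun e => ?_)) one_add_abs_log_isBigO
  rw [norm_one, one_mul, Real.norm_of_nonneg (by positivity)]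
  linarith [abs_nonneg (Real.log |e|)]

lemma sq_isBigO_errorScale (n : ℕ) : (fun e : ℝ => e ^ 2) =O[𝓝[≠] 0] errorScale n := by
  rcases eq_or_ne n 0 with rfl | hn
  · exact ((isBigO_refl (fun e : ℝ => e ^ 2) (𝓝[≠] 0)).mul one_isBigO_one_add_log).congr
      (fun e => mul_one _) fun e => (errorScale_zero e).symm
  · exact (isBigO_refl _ _).congr_right fun e => (errorScale_of_ne_zero hn e).symm

lemma errorScale_isLittleO (n : ℕ) : errorScale n =o[𝓝[≠] 0] fun e : ℝ => e := by
  have hlim : Tendsto (fun e : ℝ => e * (1 + (if n = 0 then 1 else 0) * Real.log |e|)) (𝓝[≠] 0)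
      (𝓝 0) := by
    have hcont : Continuous fun e : ℝ => e + (if n = 0 then 1 else 0) * (e * Real.log e) :=
      continuous_id.add (continuous_const.mul Real.continuous_mul_log)
    have hcont0 := (hcont.tendsto 0).mono_left (nhdsWithin_le_nhds (s := {0}ᶜ))
    simp only [zero_mul, mul_zero, add_zero] at hcont0
    refine hcont0.congr fun e => ?_
    rw [Real.log_abs]
    ring
  have hmul := (isBigO_refl (fun e : ℝ => e) (𝓝[≠] 0)).mul_isLittleO ((isLittleO_one_iff ℝ).2 hlim)
  simp only [mul_one] at hmul
  refine hmul.congr_left fun e => ?_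
  rw [errorScale]
  ring

lemma one_add_abs_log_mul_isBigO {r : ℝ} (hr : r ≠ 0) :
    (fun e : ℝ => 1 + |Real.log (r * |e|)|) =O[𝓝[≠] 0] fun e => 1 + Real.log |e| := by
  refine IsBigO.trans (IsBigO.of_bound (1 + |Real.log r|) ?_) one_add_abs_log_isBigO
  filter_upwards [self_mem_nhdsWithin] with e he
  rw [Real.norm_of_nonneg (by positivity), Real.norm_of_nonneg (by positivity),
    Real.log_mul hr (abs_ne_zero.2 he)]
  have := abs_add_le (Real.log r) (Real.log |e|)
  nlinarith [abs_nonneg (Real.log r), abs_nonneg (Real.log |e|)]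

lemma approxZero_mul_singularBranch_sub_isBigO {σ : ℝ} (hσ : |σ| = 1) (c : ℂ) (n : ℕ) :
    (fun e : ℝ => approxZero n e *
      (singularBranch σ c (n + 1) (approxZero n e) - (-1) ^ n * n.factorial)) =O[𝓝[≠] 0]
      errorScale n := by
  rcases n with _ | n
  · have hS : (fun e : ℝ => singularBranch σ c 1 (approxZero 0 e) - 1) =O[𝓝[≠] 0]
        fun e : ℝ => e * (1 + Real.log |e|) := by
      refine ((singularBranch_one_sub_isBigO hσ c).comp_tendsto (tendsto_approxZero 0)).trans ?_
      refine (approxZero_isBigO 0).norm_left.mul ?_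
      exact (one_add_abs_log_mul_isBigO (modeRatio_pos 0).ne').congr_left fun e => by
        rw [norm_approxZero]
    refine ((approxZero_isBigO 0).mul hS).congr (fun e => by simp) fun e => ?_
    rw [errorScale_zero]
    ring
  · have hS := (singularBranch_add_two_sub_isBigO hσ c n).comp_tendsto (tendsto_approxZero (n + 1))
    refine (((approxZero_isBigO (n + 1)).mul (hS.trans (approxZero_isBigO (n + 1)))).congr_right
      fun e => ?_).trans (sq_isBigO_errorScale (n + 1))
    ring

lemma ofReal_add_approxZero (n : ℕ) (e : ℝ) :
    (e : ℂ) + approxZero n e = (((n : ℝ) + 2)⁻¹ * e : ℝ) := by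
  rw [approxZero, modeRatio, ← Complex.ofReal_add]
  congr 1
  field_simp
  ring

lemma ofReal_add_approxZero_isBigO (n : ℕ) :
    (fun e : ℝ => (e : ℂ) + approxZero n e) =O[𝓝[≠] 0] fun e : ℝ => e :=
  (Complex.isBigO_ofReal_left.2 (isBigO_refl _ _)).add (approxZero_isBigO n)

lemma first_order_balance (n : ℕ) (e : ℝ) :
    ((e : ℂ) + approxZero n e) * ((-1) ^ (n + 1) * (n + 1).factorial) =
      approxZero n e * ((-1) ^ n * n.factorial) := by
  have hn2 : (n : ℂ) + 2 ≠ 0 := by exact_mod_cast (n + 1).succ_ne_zero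
  rw [ofReal_add_approxZero, approxZero, modeRatio, Nat.factorial_succ]
  push_cast
  field_simp
  ring

lemma matching_approxZero_isBigO {σ : ℝ} (hσ : |σ| = 1) (c : ℂ) {n : ℕ} {τ : ℂ}
    (hτ : besselClifford (n + 1 : ℕ) τ = 0) :
    (fun e : ℝ => matching σ c n τ e (approxZero n e)) =O[𝓝[≠] 0] errorScale n := by
  set x : ℝ → ℂ := fun e => (e : ℂ) + approxZero n e
  set A : ℂ → ℂ := besselClifford (n + 1 : ℕ)
  set A' : ℂ → ℂ := besselClifford (n + 2 : ℕ)
  set S : ℝ → ℂ := fun e => singularBranch σ c (n + 1) (approxZero n e)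
  set S' : ℝ → ℂ := fun e => singularBranch σ c (n + 2) (approxZero n e)
  have hxO : x =O[𝓝[≠] 0] fun e : ℝ => e := ofReal_add_approxZero_isBigO n
  have hx0 : Tendsto x (𝓝[≠] 0) (𝓝 0) :=
    hxO.trans_tendsto (tendsto_id.mono_left nhdsWithin_le_nhds)
  have hA' : (fun e => A' (τ + x e) - A' τ) =O[𝓝[≠] 0] fun e : ℝ => e := by
    have hO := (hasDerivAt_besselClifford_natCast (n + 2) τ).isBigO_sub.comp_tendsto
      (k := fun e => τ + x e) (by simpa using hx0.const_add τ)
    exact (hO.congr_right fun e => by simp).trans hxO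
  have hA : (fun e => A (τ + x e) - x e * A' τ) =O[𝓝[≠] 0] fun e : ℝ => e ^ 2 := by
    have hdiff : Differentiable ℂ A := fun t =>
      (hasDerivAt_besselClifford_natCast (n + 1) t).differentiableAt
    have hO := (taylor_two_isBigO hdiff τ).comp_tendsto hx0
    refine (hO.trans (hxO.pow 2)).congr_left fun e => ?_
    rw [Function.comp_apply, (hasDerivAt_besselClifford_natCast (n + 1) τ).deriv, hτ, sub_zero]
  have hS' : (fun e => S' e - (-1) ^ (n + 1) * (n + 1).factorial) =O[𝓝[≠] 0] fun e : ℝ => e :=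
    ((singularBranch_add_two_sub_isBigO hσ c n).comp_tendsto (tendsto_approxZero n)).trans
      (approxZero_isBigO n)
  have hS1 : S =O[𝓝[≠] 0] fun _ => (1 : ℝ) :=
    ((tendsto_singularBranch hσ c n).comp (tendsto_approxZero n)).isBigO_one ℝ
  have hS1' : S' =O[𝓝[≠] 0] fun _ => (1 : ℝ) :=
    ((tendsto_singularBranch hσ c (n + 1)).comp (tendsto_approxZero n)).isBigO_one ℝ
  have hsq := sq_isBigO_errorScale n
  have hT₁ := ((hA.mul hS1').congr_right fun e => mul_one _).trans hsq
  have hT₂ := (((hxO.mul hS').congr_right fun e => (sq e).symm).const_mul_left (A' τ)).trans hsq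
  have hT₃ := (approxZero_mul_singularBranch_sub_isBigO hσ c n).const_mul_left (A' τ)
  have hT₄ := (((hA'.mul (approxZero_isBigO n)).mul hS1).congr_right
    (g₂ := fun e : ℝ => e ^ 2) fun e => by ring).trans hsq
  refine (((hT₁.add hT₂).sub hT₃).sub hT₄).congr_left fun e => ?_
  rw [matching, add_assoc τ]
  linear_combination -A' τ * first_order_balance n e

lemma approxZero_mem_halfPlane_inter_ball {σ : ℝ} (n : ℕ) {e δ : ℝ} (he : σ * e < 0)
    (heδ : |e| < δ) : approxZero n e ∈ halfPlane σ ∩ Metric.ball 0 δ :=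
  ⟨approxZero_mem_halfPlane n he, mem_ball_zero_iff.2 ((norm_approxZero_le n e).trans_lt heδ)⟩

lemma exists_norm_sub_approxZero_le {σ : ℝ} (hσ : |σ| = 1) (c : ℂ) {n : ℕ} {τ : ℂ}
    (hD : matchingSlope n τ ≠ 0) :
    ∃ δ > 0, ∀ e : ℝ, σ * e < 0 → |e| < δ → ∀ t ∈ halfPlane σ, ‖t‖ < δ →
      matching σ c n τ e t = 0 →
      ‖t - approxZero n e‖ ≤ 2 / ‖matchingSlope n τ‖ * ‖matching σ c n τ e (approxZero n e)‖ := by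
  obtain ⟨δ, hδ, happrox⟩ := exists_approximatesLinearOn_matching hσ c hD
  refine ⟨δ, hδ, fun e he heδ t ht htδ h0 => ?_⟩
  exact norm_sub_le_of_approximatesLinearOn hD (happrox e (by simpa using heδ))
    ⟨ht, mem_ball_zero_iff.2 htδ⟩ (approxZero_mem_halfPlane_inter_ball n he heδ) h0

lemma eventually_norm_matching_approxZero_le {σ : ℝ} (hσ : |σ| = 1) (c : ℂ) {n : ℕ} {τ : ℂ}
    (hτ : besselClifford (n + 1 : ℕ) τ = 0) (hD : matchingSlope n τ ≠ 0) :
    ∀ᶠ e : ℝ in 𝓝[≠] 0, 2 / ‖matchingSlope n τ‖ * ‖matching σ c n τ e (approxZero n e)‖ ≤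
      ‖approxZero n e‖ / 2 := by
  have hD' : 0 < ‖matchingSlope n τ‖ := norm_pos_iff.2 hD
  have hr := modeRatio_pos n
  filter_upwards [((matching_approxZero_isBigO hσ c hτ).trans_isLittleO
    (errorScale_isLittleO n)).bound (c := modeRatio n * ‖matchingSlope n τ‖ / 4)
      (by positivity)] with e he
  rw [norm_approxZero, div_mul_eq_mul_div, div_le_iff₀ hD']
  rw [Real.norm_eq_abs] at he
  linarith

lemma exists_zero_matching {σ : ℝ} (hσ : |σ| = 1) (c : ℂ) {n : ℕ} {τ : ℂ}
    (hτ : besselClifford (n + 1 : ℕ) τ = 0) (hD : matchingSlope n τ ≠ 0) :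
    ∃ δ > 0, ∀ e : ℝ, σ * e < 0 → |e| < δ → ∃ t ∈ halfPlane σ,
      matching σ c n τ e t = 0 ∧ singularBranch σ c (n + 2) t ≠ 0 ∧
      ‖t - approxZero n e‖ ≤ 2 / ‖matchingSlope n τ‖ * ‖matching σ c n τ e (approxZero n e)‖ := by
  obtain ⟨δ₁, hδ₁, happrox⟩ := exists_approximatesLinearOn_matching hσ c hD
  obtain ⟨δ₂, hδ₂, hS⟩ := Metric.eventually_nhds_iff_ball.1 <|
    (tendsto_singularBranch hσ c (n + 1)).eventually_ne (neg_one_pow_mul_factorial_ne_zero (n + 1))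
  have hev := eventually_norm_matching_approxZero_le hσ c hτ hD
  rw [eventually_nhdsWithin_iff, Metric.eventually_nhds_iff_ball] at hev
  obtain ⟨δ₃, hδ₃, hsmall⟩ := hev
  refine ⟨min (min (δ₁ / 2) (δ₂ / 2)) δ₃, by positivity, fun e he heδ => ?_⟩
  simp only [lt_min_iff] at heδ
  obtain ⟨⟨heδ₁, heδ₂⟩, heδ₃⟩ := heδ
  have he0 : e ≠ 0 := by
    rintro rfl
    simp at he
  have hradius := hsmall e (by simpa using heδ₃) he0
  set z := approxZero n e
  have hze : ‖z‖ ≤ |e| := norm_approxZero_le n e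
  have hnorm : ∀ t ∈ Metric.closedBall z (2 / ‖matchingSlope n τ‖ * ‖matching σ c n τ e z‖),
      ‖t‖ < 2 * |e| := fun t ht => by
    have htri := norm_le_norm_add_norm_sub' t z
    have hpos := abs_pos.2 he0
    linarith [mem_closedBall_iff_norm.1 ht]
  have hball : Metric.closedBall z (2 / ‖matchingSlope n τ‖ * ‖matching σ c n τ e z‖) ⊆
      halfPlane σ ∩ Metric.ball 0 δ₁ := fun t ht =>
    ⟨closedBall_approxZero_subset hσ n he (Metric.closedBall_subset_closedBall hradius ht),
      mem_ball_zero_iff.2 ((hnorm t ht).trans (by linarith))⟩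
  have heδ₁' : ‖(e : ℂ)‖ < δ₁ := by
    rw [Complex.norm_real, Real.norm_eq_abs]
    linarith
  obtain ⟨t, ht, hzero⟩ := exists_zero_of_approximatesLinearOn hD (happrox e heδ₁') hball
  exact ⟨t, (hball ht).1, hzero, hS t (mem_ball_zero_iff.2 ((hnorm t ht).trans (by linarith))),
    mem_closedBall_iff_norm.1 ht⟩
/-! ### Functions `y(|z|²) (x + κ y)^k` and Green's identity across a circle -/

/-- The linear function `x + κ y` of `z = x + i y`; for `κ = ± i` it is `z` or its conjugate. -/
def planarLin (κ z : ℂ) : ℂ := z.re + κ * z.im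

lemma planarLin_I (z : ℂ) : planarLin Complex.I z = z := by
  rw [planarLin, mul_comm]; exact Complex.re_add_im z

@[fun_prop]
lemma contDiff_normSq {k : WithTop ℕ∞} : ContDiff ℝ k Complex.normSq := by
  have hre : ContDiff ℝ k Complex.re := Complex.reCLM.contDiff
  have him : ContDiff ℝ k Complex.im := Complex.imCLM.contDiff
  exact (hre.mul hre).add (him.mul him)

@[fun_prop]
lemma contDiff_planarLin {k : WithTop ℕ∞} (κ : ℂ) : ContDiff ℝ k (planarLin κ) :=
  (Complex.ofRealCLM.contDiff.comp Complex.reCLM.contDiff).add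
    (contDiff_const.mul (Complex.ofRealCLM.contDiff.comp Complex.imCLM.contDiff))

@[fun_prop]
lemma continuous_planarLin (κ : ℂ) : Continuous (planarLin κ) :=
  (contDiff_planarLin (k := 0) κ).continuous

lemma hasLineDerivAt_inner (z v : ℂ) :
    HasLineDerivAt ℝ (fun z => ((inner ℝ z v : ℝ) : ℂ)) (Complex.normSq v) z v := by
  have hline : (fun t : ℝ => inner ℝ (z + t • v) v) =
      fun t => inner ℝ z v + t * Complex.normSq v := by
    funext t; simp [Complex.inner, Complex.normSq_apply]; ring
  have hderiv : HasDerivAt (fun t : ℝ => inner ℝ (z + t • v) v) (Complex.normSq v) 0 := by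
    rw [hline]
    simpa using ((hasDerivAt_id (0 : ℝ)).mul_const (Complex.normSq v)).const_add (inner ℝ z v)
  exact hderiv.ofReal_comp

lemma hasLineDerivAt_normSq (z v : ℂ) :
    HasLineDerivAt ℝ Complex.normSq (2 * inner ℝ z v) z v := by
  have hline : (fun t : ℝ => Complex.normSq (z + t • v)) =
      fun t => Complex.normSq z + t * (2 * inner ℝ z v) + t ^ 2 * Complex.normSq v := by
    funext t; simp [Complex.inner, Complex.normSq_apply]; ring
  rw [HasLineDerivAt, hline]
  simpa using! (((hasDerivAt_id (0 : ℝ)).mul_const (2 * inner ℝ z v)).const_add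
    (Complex.normSq z)).add ((hasDerivAt_pow 2 (0 : ℝ)).mul_const (Complex.normSq v))

lemma hasLineDerivAt_comp_normSq {y : ℝ → ℂ} {y' z : ℂ} (v : ℂ)
    (hy : HasDerivAt y y' (Complex.normSq z)) :
    HasLineDerivAt ℝ (fun z => y (Complex.normSq z)) (y' * (2 * (inner ℝ z v : ℝ))) z v := by
  have hy₀ : HasDerivAt y y' (Complex.normSq (z + (0 : ℝ) • v)) := by simpa using hy
  refine (HasDerivAt.scomp (0 : ℝ) hy₀ (hasLineDerivAt_normSq z v)).congr_deriv ?_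
  rw [Complex.real_smul]; push_cast; ring

lemma hasLineDerivAt_planarLin_pow (κ z v : ℂ) (k : ℕ) :
    HasLineDerivAt ℝ (fun z => planarLin κ z ^ k)
      (k * planarLin κ z ^ (k - 1) * planarLin κ v) z v := by
  have hline : (fun t : ℝ => planarLin κ (z + t • v)) =
      fun t : ℝ => planarLin κ z + (t : ℂ) * planarLin κ v := by
    funext t; simp [planarLin]; ring
  have hderiv : HasDerivAt (fun t : ℝ => planarLin κ (z + t • v)) (planarLin κ v) 0 := by
    rw [hline]
    simpa using (Complex.ofRealCLM.hasDerivAt.mul_const (planarLin κ v)).const_add (planarLin κ z)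
  simpa [HasLineDerivAt] using! hderiv.pow k

lemma hasLineDerivAt_mul {f g : ℂ → ℂ} {f' g' z v : ℂ} (hf : HasLineDerivAt ℝ f f' z v)
    (hg : HasLineDerivAt ℝ g g' z v) :
    HasLineDerivAt ℝ (fun z => f z * g z) (f' * g z + f z * g') z v := by
  simpa [HasLineDerivAt] using! HasDerivAt.mul hf hg

/-- The function `y(|z|²) (x + κ y)^k`: for `κ = ± i` an angular mode of order `± k`, with radial
profile `y` in the variable `s = |z|²`. -/
def modeFun (κ : ℂ) (k : ℕ) (y : ℝ → ℂ) (z : ℂ) : ℂ := y (Complex.normSq z) * planarLin κ z ^ k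

/-- The derivative of `modeFun κ k y` in the direction `v`, where `y'` is the derivative of `y`.
For `k = 0` the truncated exponent `k - 1` comes with the coefficient `0`. -/
def modeFunDeriv (κ : ℂ) (k : ℕ) (y y' : ℝ → ℂ) (v z : ℂ) : ℂ :=
  2 * ((inner ℝ z v : ℝ) * modeFun κ k y' z) + k * planarLin κ v * modeFun κ (k - 1) y z

/-- The second derivative of `modeFun κ k y` in the direction `v`, where `y'` and `y''` are the
derivatives of `y`. -/
def modeFunDeriv₂ (κ : ℂ) (k : ℕ) (y y' y'' : ℝ → ℂ) (v z : ℂ) : ℂ :=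
  4 * (inner ℝ z v : ℝ) ^ 2 * modeFun κ k y'' z + 2 * Complex.normSq v * modeFun κ k y' z +
    4 * k * (inner ℝ z v : ℝ) * planarLin κ v * modeFun κ (k - 1) y' z +
    k * (k - 1 : ℕ) * planarLin κ v ^ 2 * modeFun κ (k - 1 - 1) y z

@[fun_prop]
lemma continuous_modeFun (κ : ℂ) (k : ℕ) {y : ℝ → ℂ} (hy : Continuous y) :
    Continuous (modeFun κ k y) := by
  unfold modeFun; fun_prop

lemma hasLineDerivAt_modeFun (κ : ℂ) (k : ℕ) {y y' : ℝ → ℂ} {z : ℂ} (v : ℂ)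
    (hy : HasDerivAt y (y' (Complex.normSq z)) (Complex.normSq z)) :
    HasLineDerivAt ℝ (modeFun κ k y) (modeFunDeriv κ k y y' v z) z v := by
  refine (hasLineDerivAt_mul (hasLineDerivAt_comp_normSq v hy)
    (hasLineDerivAt_planarLin_pow κ z v k)).congr_deriv ?_
  simp only [modeFunDeriv, modeFun]; ring

lemma hasLineDerivAt_modeFunDeriv (κ : ℂ) (k : ℕ) {y y' y'' : ℝ → ℂ} {z : ℂ} (v : ℂ)
    (hy : HasDerivAt y (y' (Complex.normSq z)) (Complex.normSq z))
    (hy' : HasDerivAt y' (y'' (Complex.normSq z)) (Complex.normSq z)) :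
    HasLineDerivAt ℝ (modeFunDeriv κ k y y' v) (modeFunDeriv₂ κ k y y' y'' v z) z v := by
  refine (((hasLineDerivAt_mul (hasLineDerivAt_inner z v)
    (hasLineDerivAt_modeFun κ k v hy')).const_mul 2).add
    ((hasLineDerivAt_modeFun κ (k - 1) v hy).const_mul (k * planarLin κ v))).congr_deriv ?_
  simp only [modeFunDeriv₂, modeFunDeriv]; ring

lemma modeFunDeriv₂_one_add_I {κ : ℂ} (hκ : κ ^ 2 = -1) (k : ℕ) (y y' y'' : ℝ → ℂ) (z : ℂ) :
    modeFunDeriv₂ κ k y y' y'' 1 z + modeFunDeriv₂ κ k y y' y'' Complex.I z =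
      4 * (Complex.normSq z * y'' (Complex.normSq z) + (k + 1) * y' (Complex.normSq z)) *
        planarLin κ z ^ k := by
  have hlin : (k : ℂ) * planarLin κ z ^ (k - 1) * (z.re + κ * z.im) = k * planarLin κ z ^ k := by
    rw [← planarLin]
    cases k <;> simp [pow_succ, mul_assoc]
  have hnormSq : (Complex.normSq z : ℂ) = z.re ^ 2 + z.im ^ 2 := by
    rw [Complex.normSq_apply]; push_cast; ring
  have hinner : inner ℝ z 1 = z.re ∧ inner ℝ z Complex.I = z.im := by simp [Complex.inner]
  have hplanar : planarLin κ 1 = 1 ∧ planarLin κ Complex.I = κ := by simp [planarLin]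
  simp only [modeFunDeriv₂, modeFun, hinner, hplanar, map_one, Complex.normSq_I,
    Complex.ofReal_one, hnormSq]
  linear_combination (4 * y' (Complex.normSq z)) * hlin + (k * (k - 1 : ℕ) *
    y (Complex.normSq z) * planarLin κ z ^ (k - 1 - 1)) * hκ

lemma hasLineDerivAt_fderiv {φ : ℂ → ℂ} (hφ : ContDiff ℝ 2 φ) (v z : ℂ) :
    HasLineDerivAt ℝ (fun z => fderiv ℝ φ z v) (fderiv ℝ (fderiv ℝ φ) z v v) z v := by
  have hdiff : DifferentiableAt ℝ (fderiv ℝ φ) z :=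
    ((hφ.fderiv_right (m := 1) (by norm_num)).differentiable (by norm_num)) z
  exact ((hdiff.hasFDerivAt.clm_apply (hasFDerivAt_const v z)).hasLineDerivAt v).congr_deriv
    (by simp)

lemma laplacian_eq_fderiv (φ : ℂ → ℂ) (z : ℂ) :
    Laplacian.laplacian φ z = fderiv ℝ (fderiv ℝ φ) z 1 1 +
      fderiv ℝ (fderiv ℝ φ) z Complex.I Complex.I := by
  rw [InnerProductSpace.laplacian_eq_iteratedFDeriv_complexPlane]
  simp [iteratedFDeriv_two_apply]

lemma laplacian_eq_of_hasLineDerivAt {φ : ℂ → ℂ} (hφ : ContDiff ℝ 2 φ) {φ' φ'' : ℂ → ℂ → ℂ}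
    (hφ' : ∀ v z, HasLineDerivAt ℝ φ (φ' v z) z v)
    (hφ'' : ∀ v z, HasLineDerivAt ℝ (φ' v) (φ'' v z) z v) (z : ℂ) :
    Laplacian.laplacian φ z = φ'' 1 z + φ'' Complex.I z := by
  have hfderiv : ∀ v, fderiv ℝ (fderiv ℝ φ) z v v = φ'' v z := fun v => by
    have heq : (fun z => fderiv ℝ φ z v) = φ' v := funext fun w =>
      (((hφ.differentiable (by norm_num)) w).hasFDerivAt.hasLineDerivAt v).unique (hφ' v w)
    exact (heq ▸ hasLineDerivAt_fderiv hφ v z).unique (hφ'' v z)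
  rw [laplacian_eq_fderiv, hfderiv, hfderiv]

lemma laplacian_modeFun {κ : ℂ} (hκ : κ ^ 2 = -1) (k : ℕ) {y y' y'' : ℝ → ℂ}
    (hy : ContDiff ℝ 2 y) (hy' : ∀ s, HasDerivAt y (y' s) s)
    (hy'' : ∀ s, HasDerivAt y' (y'' s) s) (z : ℂ) :
    Laplacian.laplacian (modeFun κ k y) z =
      4 * (Complex.normSq z * y'' (Complex.normSq z) + (k + 1) * y' (Complex.normSq z)) *
        planarLin κ z ^ k := by
  rw [← modeFunDeriv₂_one_add_I hκ k y]
  exact laplacian_eq_of_hasLineDerivAt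
    ((hy.comp contDiff_normSq).mul ((contDiff_planarLin κ).pow _))
    (fun v z => hasLineDerivAt_modeFun κ k v (hy' _))
    (fun v z => hasLineDerivAt_modeFunDeriv κ k v (hy' _) (hy'' _)) z

lemma integral_eq_zero_of_hasDerivAt_off_countable {f f' : ℝ → ℂ} {s : Set ℝ}
    (hs : s.Countable) (hc : Continuous f) (hsupp : HasCompactSupport f)
    (hd : ∀ x ∉ s, HasDerivAt f (f' x) x) (hi : Integrable f') : ∫ x, f' x = 0 := by
  have hftc : ∀ a : ℝ, ∫ x in -a..a, f' x = f a - f (-a) := fun a =>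
    MeasureTheory.integral_eq_of_hasDerivAt_off_countable f f' hs hc.continuousOn
      (fun x hx => hd x hx.2) hi.intervalIntegrable
  have hlim := intervalIntegral_tendsto_integral hi tendsto_neg_atTop_atBot tendsto_id
  have hzero := hsupp.is_zero_at_infty
  rw [cocompact_eq_atBot_atTop] at hzero
  have hends : Tendsto (fun a : ℝ => f a - f (-a)) atTop (𝓝 (0 - 0)) :=
    (hzero.mono_left le_sup_right).sub ((hzero.mono_left le_sup_left).comp tendsto_neg_atTop_atBot)
  rw [sub_zero] at hends
  refine tendsto_nhds_unique hlim ?_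
  simpa [hftc] using hends

lemma countable_setOf_mul_self_eq (c : ℝ) : {x : ℝ | x * x = c}.Countable := by
  refine ((Set.toFinite {√c, -√c}).subset fun x hx => ?_).countable
  rw [Set.mem_ofPred_eq] at hx
  rw [Set.mem_insert_iff, Set.mem_singleton_iff, ← hx, Real.sqrt_mul_self_eq_abs]
  exact eq_or_eq_neg_of_abs_eq rfl

lemma isClosedEmbedding_complex_mk_left (y : ℝ) :
    IsClosedEmbedding fun x : ℝ => (⟨x, y⟩ : ℂ) := by
  refine IsClosedEmbedding.of_continuous_injective_isClosedMap
    (Complex.equivRealProdCLM.symm.continuous.comp (Continuous.prodMk_left y))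
    (fun a b hab => congrArg Complex.re hab) fun s hs => ?_
  have himage : (fun x : ℝ => (⟨x, y⟩ : ℂ)) '' s = Complex.re ⁻¹' s ∩ Complex.im ⁻¹' {y} := by
    ext w
    constructor
    · rintro ⟨x, hx, rfl⟩
      exact ⟨hx, rfl⟩
    · exact fun hw => ⟨w.re, hw.1, Complex.ext rfl hw.2.symm⟩
  rw [himage]
  exact (hs.preimage Complex.continuous_re).inter
    (isClosed_singleton.preimage Complex.continuous_im)

lemma hasDerivAt_complex_mk_left {G : ℂ → ℂ} {G' : ℂ} {x y : ℝ}
    (hG : HasLineDerivAt ℝ G G' ⟨x, y⟩ 1) : HasDerivAt (fun x : ℝ => G ⟨x, y⟩) G' x := by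
  have hshift := HasDerivAt.comp_sub_const (𝕜 := ℝ) x x
    (f := fun t : ℝ => G (⟨x, y⟩ + t • 1)) (f' := G') (by rwa [sub_self])
  refine hshift.congr_of_eventuallyEq (Eventually.of_forall fun w => ?_)
  refine congrArg G (Complex.ext ?_ ?_) <;> simp

lemma integral_lineDeriv_one_eq_zero {G G' : ℂ → ℂ} (R : ℝ) (hc : Continuous G)
    (hsupp : HasCompactSupport G) (hi : Integrable G')
    (hd : ∀ z, Complex.normSq z ≠ R → HasLineDerivAt ℝ G (G' z) z 1) : ∫ z, G' z = 0 := by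
  have hmp := Complex.volume_preserving_equiv_real_prod.symm
  rw [← hmp.integral_comp' (g := G')]
  have hi' : Integrable (fun p : ℝ × ℝ => G' (Complex.measurableEquivRealProd.symm p)) :=
    (hmp.integrable_comp_emb (MeasurableEquiv.measurableEmbedding _)).2 hi
  rw [Measure.volume_eq_prod] at hi' ⊢
  rw [integral_prod_symm _ hi']
  refine integral_eq_zero_of_ae ?_
  filter_upwards [hi'.prod_left_ae] with y hy
  have hemb := isClosedEmbedding_complex_mk_left y
  refine integral_eq_zero_of_hasDerivAt_off_countable
    (countable_setOf_mul_self_eq (R - y * y)) (hc.comp hemb.continuous)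
    (hsupp.comp_isClosedEmbedding hemb)
    (fun x hx => hasDerivAt_complex_mk_left (hd ⟨x, y⟩ fun hR => hx ?_)) hy
  rw [Set.mem_ofPred_eq, ← hR, Complex.normSq_apply, add_sub_cancel_right]

lemma integral_lineDeriv_I_eq_zero {G G' : ℂ → ℂ} (R : ℝ) (hc : Continuous G)
    (hsupp : HasCompactSupport G) (hi : Integrable G')
    (hd : ∀ z, Complex.normSq z ≠ R → HasLineDerivAt ℝ G (G' z) z Complex.I) :
    ∫ z, G' z = 0 := by
  let mulI : ℂ ≃ₗᵢ[ℝ] ℂ := rotation ⟨Complex.I, by simp [Submonoid.unitSphere]⟩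
  have hmulI : ∀ z, mulI z = Complex.I * z := fun z => rfl
  have hmp := mulI.measurePreserving
  have hemb : MeasurableEmbedding mulI := mulI.toHomeomorph.measurableEmbedding
  rw [← hmp.integral_comp hemb]
  refine integral_lineDeriv_one_eq_zero (G := fun z => G (mulI z)) R (hc.comp mulI.continuous)
    (hsupp.comp_homeomorph mulI.toHomeomorph) ((hmp.integrable_comp_emb hemb).2 hi) fun z hz => ?_
  have hline := hd (mulI z) (by simpa [hmulI] using hz)
  unfold HasLineDerivAt at hline ⊢
  convert hline using 2
  simp only [hmulI]
  congr 1
  simp [mul_add, mul_comm]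

section Green

variable {φ : ℂ → ℂ} {u : ℂ → ℂ} {u' u'' : ℂ → ℂ → ℂ} {R : ℝ}

lemma integrable_green_integrand (hφ : IsTestFunction φ) (hu : Continuous u) (v : ℂ)
    (hu'' : LocallyIntegrable (u'' v)) :
    Integrable fun z => u z * fderiv ℝ (fderiv ℝ φ) z v v - φ z * u'' v z := by
  have hφ' : ContDiff ℝ 1 (fderiv ℝ φ) := (contDiff_infty.1 hφ.1 2).fderiv_right (by norm_num)
  have hφ'' : Continuous (fderiv ℝ (fderiv ℝ φ)) := hφ'.continuous_fderiv (by norm_num)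
  have hsupp : HasCompactSupport fun z => fderiv ℝ (fderiv ℝ φ) z v v :=
    ((hφ.2.fderiv (𝕜 := ℝ)).fderiv (𝕜 := ℝ)).comp_left
      (g := fun T : ℂ →L[ℝ] ℂ →L[ℝ] ℂ => T v v) rfl
  exact ((hu.mul ((hφ''.clm_apply continuous_const).clm_apply
    continuous_const)).integrable_of_hasCompactSupport (hsupp.mul_left (f := u))).sub
    (hu''.integrable_smul_left_of_hasCompactSupport hφ.1.continuous hφ.2)

lemma integral_mul_laplacian_eq (hφ : IsTestFunction φ) (hu : Continuous u)
    (hu' : ∀ v, Continuous (u' v)) (hu'' : ∀ v, LocallyIntegrable (u'' v))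
    (hderiv : ∀ v z, HasLineDerivAt ℝ u (u' v z) z v)
    (hderiv' : ∀ v z, Complex.normSq z ≠ R → HasLineDerivAt ℝ (u' v) (u'' v z) z v) :
    ∫ z, (u z * Laplacian.laplacian φ z - φ z * (u'' 1 z + u'' Complex.I z)) = 0 := by
  have hφ₂ : ContDiff ℝ 2 φ := contDiff_infty.1 hφ.1 2
  have hφ' : ContDiff ℝ 1 (fderiv ℝ φ) := hφ₂.fderiv_right (by norm_num)
  let G : ℂ → ℂ → ℂ := fun v z => u z * fderiv ℝ φ z v - φ z * u' v z
  let G' : ℂ → ℂ → ℂ := fun v z => u z * fderiv ℝ (fderiv ℝ φ) z v v - φ z * u'' v z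
  have hG : ∀ v, Continuous (G v) := fun v =>
    (hu.mul (hφ'.continuous.clm_apply continuous_const)).sub (hφ.1.continuous.mul (hu' v))
  have hsupp : ∀ v, HasCompactSupport (G v) := fun v => by
    have hfderiv : HasCompactSupport fun z => fderiv ℝ φ z v :=
      (hφ.2.fderiv (𝕜 := ℝ)).comp_left (g := fun T : ℂ →L[ℝ] ℂ => T v) rfl
    exact (hfderiv.mul_left (f := u)).sub (hφ.2.mul_right (f' := u' v))
  have hG' : ∀ v, Integrable (G' v) := fun v => integrable_green_integrand hφ hu v (hu'' v)
  have hGderiv : ∀ v z, Complex.normSq z ≠ R → HasLineDerivAt ℝ (G v) (G' v z) z v :=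
    fun v z hz => ((hasLineDerivAt_mul (hderiv v z) (hasLineDerivAt_fderiv hφ₂ v z)).sub
      (hasLineDerivAt_mul
        (((hφ₂.differentiable (by norm_num)) z).hasFDerivAt.hasLineDerivAt v)
        (hderiv' v z hz))).congr_deriv (by simp only [G']; ring)
  calc ∫ z, (u z * Laplacian.laplacian φ z - φ z * (u'' 1 z + u'' Complex.I z))
      = ∫ z, (G' 1 z + G' Complex.I z) := by
        simp only [laplacian_eq_fderiv, G']
        congr! 2
        ring
    _ = (∫ z, G' 1 z) + ∫ z, G' Complex.I z := integral_add (hG' 1) (hG' Complex.I)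
    _ = 0 := by
      rw [integral_lineDeriv_one_eq_zero R (hG 1) (hsupp 1) (hG' 1) (hGderiv 1),
        integral_lineDeriv_I_eq_zero R (hG _) (hsupp _) (hG' _) (hGderiv _), add_zero]

end Green

lemma locallyIntegrable_mul_of_bounded {f g : ℂ → ℂ} (hf : Continuous f) (hg : Measurable g)
    (hb : ∀ K : Set ℂ, IsCompact K → ∃ C : ℝ, ∀ z ∈ K, ‖g z‖ ≤ C) :
    LocallyIntegrable fun z => f z * g z := by
  rw [locallyIntegrable_iff]
  intro K hK
  obtain ⟨C, hC⟩ := hb K hK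
  exact (hf.locallyIntegrable.integrableOn_isCompact hK).mul_bdd
    hg.aestronglyMeasurable ((ae_restrict_iff' hK.measurableSet).2 (Eventually.of_forall hC))

lemma locallyIntegrable_modeFunDeriv₂ (κ : ℂ) (k : ℕ) {y y' y'' : ℝ → ℂ} (hy : Continuous y)
    (hy' : Continuous y') (hy'' : Measurable y'')
    (hb : ∀ K : Set ℝ, IsCompact K → ∃ C : ℝ, ∀ s ∈ K, ‖y'' s‖ ≤ C) (v : ℂ) :
    LocallyIntegrable (modeFunDeriv₂ κ k y y' y'' v) := by
  let leading : ℂ → ℂ := fun z => 4 * ((inner ℝ z v : ℝ) : ℂ) ^ 2 * planarLin κ z ^ k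
  let remainder : ℂ → ℂ := fun z => 2 * Complex.normSq v * modeFun κ k y' z +
    4 * k * (inner ℝ z v : ℝ) * planarLin κ v * modeFun κ (k - 1) y' z +
    k * (k - 1 : ℕ) * planarLin κ v ^ 2 * modeFun κ (k - 1 - 1) y z
  have hleading : Continuous leading := by fun_prop
  have hremainder : Continuous remainder := by fun_prop
  have hsplit : modeFunDeriv₂ κ k y y' y'' v =
      fun z => leading z * y'' (Complex.normSq z) + remainder z := by
    funext z
    simp only [modeFunDeriv₂, modeFun, leading, remainder]; ring
  rw [hsplit]
  refine (locallyIntegrable_mul_of_bounded hleading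
    (hy''.comp Complex.continuous_normSq.measurable) fun K hK => ?_).add
    hremainder.locallyIntegrable
  obtain ⟨C, hC⟩ := hb _ (hK.image Complex.continuous_normSq)
  exact ⟨C, fun z hz => hC _ ⟨z, hz, rfl⟩⟩

lemma integral_modeFun_mul_laplacian {k : ℕ} {κ : ℂ} (hκ : κ ^ 2 = -1) {y y' y'' : ℝ → ℂ} {R : ℝ}
    (hy : ∀ s, HasDerivAt y (y' s) s) (hy'c : Continuous y')
    (hy' : ∀ s, s ≠ R → HasDerivAt y' (y'' s) s) (hy'' : Measurable y'')
    (hb : ∀ K : Set ℝ, IsCompact K → ∃ C : ℝ, ∀ s ∈ K, ‖y'' s‖ ≤ C)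
    {φ : ℂ → ℂ} (hφ : IsTestFunction φ) :
    ∫ z, (modeFun κ k y z * Laplacian.laplacian φ z -
      φ z * (4 * (Complex.normSq z * y'' (Complex.normSq z) + (k + 1) * y' (Complex.normSq z)) *
        planarLin κ z ^ k)) = 0 := by
  have hyc : Continuous y := continuous_iff_continuousAt.2 fun s => (hy s).continuousAt
  simp only [← modeFunDeriv₂_one_add_I hκ k y]
  exact integral_mul_laplacian_eq hφ (continuous_modeFun κ k hyc)
    (fun v => by unfold modeFunDeriv; fun_prop)
    (locallyIntegrable_modeFunDeriv₂ κ k hyc hy'c hy'' hb)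
    (fun v z => hasLineDerivAt_modeFun κ k v (hy _))
    (fun v z hz => hasLineDerivAt_modeFunDeriv κ k v (hy _) (hy' _ hz))

/-! ### Gluing at a point -/

lemma hasDerivAt_ite {f g f' g' : ℝ → ℂ} {R : ℝ} (hf : ∀ s ≤ R, HasDerivAt f (f' s) s)
    (hg : ∀ s, R ≤ s → HasDerivAt g (g' s) s) (h : f R = g R) (h' : f' R = g' R) (s : ℝ) :
    HasDerivAt (fun s => if s ≤ R then f s else g s) (if s ≤ R then f' s else g' s) s := by
  rcases lt_trichotomy s R with hs | rfl | hs
  · rw [if_pos hs.le]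
    refine (hf s hs.le).congr_of_eventuallyEq ?_
    filter_upwards [eventually_lt_nhds hs] with x hx using if_pos hx.le
  · rw [if_pos le_rfl]
    have hleft : HasDerivWithinAt (fun x => if x ≤ s then f x else g x) (f' s) (Set.Iic s) s :=
      (hf s le_rfl).hasDerivWithinAt.congr (fun x hx => if_pos hx) (if_pos le_rfl)
    have hright : HasDerivWithinAt (fun x => if x ≤ s then f x else g x) (f' s) (Set.Ici s) s := by
      rw [h']
      refine (hg s le_rfl).hasDerivWithinAt.congr (fun x hx => ?_) (by rw [if_pos le_rfl, h])
      rcases (Set.mem_Ici.1 hx).eq_or_lt with rfl | hx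
      · rw [if_pos le_rfl, h]
      · rw [if_neg hx.not_ge]
    rw [← hasDerivWithinAt_univ, ← Set.Iic_union_Ici (a := s)]
    exact hleft.union hright
  · rw [if_neg hs.not_ge]
    refine (hg s hs.le).congr_of_eventuallyEq ?_
    filter_upwards [eventually_gt_nhds hs] with x hx using if_neg hx.not_ge

lemma ite_eq_ite_max (f g : ℝ → ℂ) (R : ℝ) :
    (fun s => if s ≤ R then f s else g s) = fun s => if s ≤ R then f s else g (max s R) := by
  funext s
  split_ifs with hs
  · rfl
  · rw [max_eq_left (not_le.1 hs).le]

lemma continuous_comp_max {g : ℝ → ℂ} {R : ℝ} (hg : ContinuousOn g (Set.Ici R)) :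
    Continuous fun s => g (max s R) :=
  hg.comp_continuous (by fun_prop) fun s => le_max_right s R

lemma continuous_ite_of_eq {f g : ℝ → ℂ} {R : ℝ} (hf : Continuous f)
    (hg : ContinuousOn g (Set.Ici R)) (h : f R = g R) :
    Continuous fun s => if s ≤ R then f s else g s := by
  rw [ite_eq_ite_max]
  exact Continuous.if_le hf (continuous_comp_max hg) continuous_id continuous_const
    fun s hs => by subst hs; simpa using h

lemma measurable_ite_le {f g : ℝ → ℂ} {R : ℝ} (hf : Continuous f)
    (hg : ContinuousOn g (Set.Ici R)) : Measurable fun s => if s ≤ R then f s else g s := by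
  rw [ite_eq_ite_max]
  exact Measurable.ite measurableSet_Iic hf.measurable (continuous_comp_max hg).measurable

lemma exists_bound_ite_le {f g : ℝ → ℂ} {R : ℝ} (hf : Continuous f)
    (hg : ContinuousOn g (Set.Ici R)) {K : Set ℝ} (hK : IsCompact K) :
    ∃ C : ℝ, ∀ s ∈ K, ‖if s ≤ R then f s else g s‖ ≤ C := by
  obtain ⟨Cf, hCf⟩ := hK.exists_bound_of_continuousOn hf.continuousOn
  obtain ⟨Cg, hCg⟩ := hK.exists_bound_of_continuousOn (continuous_comp_max hg).continuousOn
  refine ⟨max Cf Cg, fun s hs => ?_⟩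
  split_ifs with hsR
  · exact (hCf s hs).trans (le_max_left _ _)
  · have hbound := hCg s hs
    rw [max_eq_left (not_le.1 hsR).le] at hbound
    exact hbound.trans (le_max_right _ _)

/-! ### Matched solutions are resonances -/

lemma hasDerivAt_const_mul_ofReal (c : ℂ) (s : ℝ) : HasDerivAt (fun x : ℝ => c * (x : ℂ)) c s := by
  simpa using (Complex.ofRealCLM.hasDerivAt (x := s)).const_mul c

/-- The singular solution `singularSol k` in the radial variable `s = r²`, where `L` is the value
of the logarithm at `s = R`, and `q = -λ²/4`. -/
def outerSol (L q : ℂ) (R : ℝ) (k : ℕ) (s : ℝ) : ℂ :=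
  singularSol k (L + Complex.log ((s / R : ℝ) : ℂ)) (q * s)

lemma outerSol_self (L q : ℂ) {R : ℝ} (hR : R ≠ 0) (k : ℕ) :
    outerSol L q R k R = singularSol k L (q * R) := by
  rw [outerSol, div_self hR, Complex.ofReal_one, Complex.log_one, add_zero]

lemma outerSol_add_two (L q : ℂ) (R : ℝ) (k : ℕ) (s : ℝ) :
    outerSol L q R (k + 2) s = q * s * outerSol L q R k s - (k + 1) * outerSol L q R (k + 1) s :=
  singularSol_add_two k _ _

lemma hasDerivAt_outerSol {L q : ℂ} {R : ℝ} (hq : q ≠ 0) (hR : 0 < R) (k : ℕ) {s : ℝ}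
    (hs : 0 < s) : HasDerivAt (outerSol L q R (k + 1)) (q * outerSol L q R k s) s := by
  have hR0 : (R : ℂ) ≠ 0 := by exact_mod_cast hR.ne'
  have hs0 : (s : ℂ) ≠ 0 := by exact_mod_cast hs.ne'
  have hquot : ∀ x : ℝ, q * x / (q * R) = ((x / R : ℝ) : ℂ) := fun x => by
    push_cast; field_simp
  have hslit : q * s / (q * R) ∈ Complex.slitPlane := by
    rw [hquot]
    exact Complex.ofReal_mem_slitPlane.2 (div_pos hs hR)
  have hlog : HasDerivAt (fun t : ℂ => L + Complex.log (t / (q * R))) (q * s)⁻¹ (q * s) := by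
    have hdiv : HasDerivAt (fun t : ℂ => t / (q * R)) (1 / (q * R)) (q * s) :=
      (hasDerivAt_id _).div_const _
    refine ((hdiv.clog hslit).const_add L).congr_deriv ?_
    field_simp
  have hcomp := (hasDerivAt_singularSol k hlog (mul_ne_zero hq hs0)).scomp s
    (hasDerivAt_const_mul_ofReal q s)
  simp only [Function.comp_def, hquot, smul_eq_mul] at hcomp
  exact hcomp

/-- The `j`th derivative of the inner radial profile `s ↦ besselClifford k (p s)`. -/
def innerProfile (p : ℂ) (k j : ℕ) (s : ℝ) : ℂ :=
  p ^ j * besselClifford (k + j : ℕ) (p * s)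

lemma hasDerivAt_innerProfile (p : ℂ) (k j : ℕ) (s : ℝ) :
    HasDerivAt (innerProfile p k j) (innerProfile p k (j + 1) s) s := by
  refine (((hasDerivAt_besselClifford_natCast (k + j) (p * s)).scomp s
    (hasDerivAt_const_mul_ofReal p s)).const_mul (p ^ j)).congr_deriv ?_
  rw [innerProfile, smul_eq_mul, pow_succ, mul_assoc, ← add_assoc]

lemma innerProfile_ode (p : ℂ) (k : ℕ) (s : ℝ) :
    s * innerProfile p k 2 s + (k + 1) * innerProfile p k 1 s = p * innerProfile p k 0 s := by
  simp only [innerProfile, add_zero, pow_zero, pow_one]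
  rw [besselClifford_natCast_eq k (p * s)]
  ring

/-- The outer radial profiles: `outerProfile L q R (k + j)` is the `j`th derivative of
`outerProfile L q R k`, which solves the same equation as `innerProfile q k 0`. -/
def outerProfile (L q : ℂ) (R : ℝ) (k : ℕ) (s : ℝ) : ℂ :=
  outerSol L q R k s / s ^ k

lemma hasDerivAt_outerProfile {L q : ℂ} {R : ℝ} (hq : q ≠ 0) (hR : 0 < R) (k : ℕ) {s : ℝ}
    (hs : 0 < s) :
    HasDerivAt (outerProfile L q R (k + 1)) (outerProfile L q R (k + 2) s) s := by
  have hs0 : (s : ℂ) ≠ 0 := by exact_mod_cast hs.ne'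
  have hpow : HasDerivAt (fun s : ℝ => (s : ℂ) ^ (k + 1)) ((k + 1) * s ^ k) s := by
    simpa using! (Complex.ofRealCLM.hasDerivAt (x := s)).pow (k + 1)
  refine ((hasDerivAt_outerSol hq hR k hs).div hpow (pow_ne_zero _ hs0)).congr_deriv ?_
  rw [outerProfile, outerSol_add_two]
  field_simp
  ring

lemma outerProfile_ode (L q : ℂ) (R : ℝ) (k : ℕ) {s : ℝ} (hs : s ≠ 0) :
    s * outerProfile L q R (k + 2) s + (k + 1) * outerProfile L q R (k + 1) s =
      q * outerProfile L q R k s := by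
  have hs0 : (s : ℂ) ≠ 0 := by exact_mod_cast hs
  simp only [outerProfile]
  rw [outerSol_add_two]
  field_simp
  ring

lemma memLp_restrict_of_continuous {u : ℂ → ℂ} (hu : Continuous u) {p : ENNReal} {K : Set ℂ}
    (hK : IsCompact K) : MemLp u p (volume.restrict K) := by
  obtain ⟨C, hC⟩ := hK.exists_bound_of_continuousOn hu.continuousOn
  have : IsFiniteMeasure (volume.restrict K) := ⟨by simpa using hK.measure_lt_top⟩
  refine MemLp.of_bound hu.aestronglyMeasurable C ?_
  filter_upwards [ae_restrict_mem hK.measurableSet] with z hz using hC z hz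

lemma normSq_le_sq_iff {ρ : ℝ} (hρ : 0 ≤ ρ) (z : ℂ) : Complex.normSq z ≤ ρ ^ 2 ↔ ‖z‖ ≤ ρ := by
  rw [Complex.normSq_eq_norm_sq, sq_le_sq₀ (norm_nonneg z) hρ]

lemma isSolution_modeFun_ite {ρ A : ℝ} (hρ : 0 ≤ ρ) {κ : ℂ} (hκ : κ ^ 2 = -1) (k : ℕ) {E : ℂ}
    {a b : ℕ → ℝ → ℂ} (ha : ∀ j s, HasDerivAt (a j) (a (j + 1) s) s)
    (hb : ∀ j s, ρ ^ 2 ≤ s → HasDerivAt (b j) (b (j + 1) s) s)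
    (h0 : a 0 (ρ ^ 2) = b 0 (ρ ^ 2)) (h1 : a 1 (ρ ^ 2) = b 1 (ρ ^ 2))
    (haode : ∀ s : ℝ, 4 * (s * a 2 s + (k + 1) * a 1 s) = (-A - E) * a 0 s)
    (hbode : ∀ s : ℝ, ρ ^ 2 < s → 4 * (s * b 2 s + (k + 1) * b 1 s) = -E * b 0 s) :
    IsSolution (circularWell ρ A) E
      (modeFun κ k fun s => if s ≤ ρ ^ 2 then a 0 s else b 0 s) := by
  have hac : ∀ j, Continuous (a j) := fun j =>
    continuous_iff_continuousAt.2 fun s => (ha j s).continuousAt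
  have hbc : ∀ j, ContinuousOn (b j) (Set.Ici (ρ ^ 2)) := fun j s hs =>
    (hb j s hs).continuousAt.continuousWithinAt
  set y : ℕ → ℝ → ℂ := fun j s => if s ≤ ρ ^ 2 then a j s else b j s
  have hy : ∀ s, HasDerivAt (y 0) (y 1 s) s := hasDerivAt_ite (fun s _ => ha 0 s) (hb 0) h0 h1
  have hy' : ∀ s, s ≠ ρ ^ 2 → HasDerivAt (y 1) (y 2 s) s := fun s hs => by
    rcases lt_or_gt_of_ne hs with hlt | hgt
    · simp only [y, if_pos hlt.le]
      refine (ha 1 s).congr_of_eventuallyEq ?_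
      filter_upwards [eventually_lt_nhds hlt] with x hx using if_pos hx.le
    · simp only [y, if_neg hgt.not_ge]
      refine (hb 1 s hgt.le).congr_of_eventuallyEq ?_
      filter_upwards [eventually_gt_nhds hgt] with x hx using if_neg hx.not_ge
  have hode : ∀ z : ℂ, 4 * (Complex.normSq z * y 2 (Complex.normSq z) +
      (k + 1) * y 1 (Complex.normSq z)) = (circularWell ρ A z - E) * y 0 (Complex.normSq z) := by
    intro z
    by_cases hz : ‖z‖ ≤ ρ
    · have hs := (normSq_le_sq_iff hρ z).2 hz
      simpa only [y, if_pos hs, circularWell, if_pos hz, Complex.ofReal_neg] using haode _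
    · have hs := mt (normSq_le_sq_iff hρ z).1 hz
      simpa only [y, if_neg hs, circularWell, if_neg hz, Complex.ofReal_zero, zero_sub] using
        hbode _ (not_le.1 hs)
  have hyc : Continuous (y 0) := continuous_iff_continuousAt.2 fun s => (hy s).continuousAt
  refine ⟨fun K hK => memLp_restrict_of_continuous (continuous_modeFun κ k hyc) hK,
    fun φ hφ => ?_⟩
  rw [← neg_zero, ← integral_modeFun_mul_laplacian (k := k) hκ hy
    (continuous_ite_of_eq (hac 1) (hbc 1) h1) hy' (measurable_ite_le (hac 2) (hbc 2))
    (fun K hK => exists_bound_ite_le (hac 2) (hbc 2) hK) hφ, ← integral_neg]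
  refine integral_congr_ae (Eventually.of_forall fun z => ?_)
  simp only [hode z, modeFun, y]
  ring

lemma not_modeFun_ae_eq_zero {y : ℝ → ℂ} (hy : Continuous y) (h0 : y 0 ≠ 0) (k : ℕ) :
    ¬ modeFun Complex.I k y =ᵐ[volume] 0 := fun hae => by
  have hzero := (continuous_modeFun Complex.I k hy).ae_eq_iff_eq volume continuous_const |>.1 hae
  have hpos : ∀ x : ℝ, 0 < x → y (x ^ 2) = 0 := fun x hx => by
    have hx0 := congrFun hzero (x : ℂ)
    rw [modeFun, planarLin_I, Complex.normSq_ofReal, ← pow_two] at hx0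
    exact (mul_eq_zero.1 hx0).resolve_right (pow_ne_zero _ (by exact_mod_cast hx.ne'))
  have hlim : Tendsto (fun x : ℝ => y (x ^ 2)) (𝓝[>] 0) (𝓝 (y 0)) := by
    have hcomp : Continuous fun x : ℝ => y (x ^ 2) := by fun_prop
    simpa using (hcomp.tendsto 0).mono_left nhdsWithin_le_nhds
  refine h0 (tendsto_nhds_unique hlim (tendsto_const_nhds.congr' ?_))
  filter_upwards [self_mem_nhdsWithin] with x hx using (hpos x hx).symm

lemma isOutgoing_of_mode {ρ : ℝ} {lam : ℂ} {u : ℂ → ℂ} (ℓ : ℤ) (c : ℂ)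
    (hu : ∀ z : ℂ, ρ < ‖z‖ → u z = c * outgoingFactor lam ℓ ‖z‖ * (z / (‖z‖ : ℂ)) ^ ℓ) :
    IsOutgoing ρ lam u := by
  refine ⟨Pi.single ℓ c, Eventually.of_forall fun z hz => ?_⟩
  rw [hu z hz]
  convert hasSum_single ℓ fun m hm => ?_ using 1
  · simp
  · simp [Pi.single_eq_of_ne hm]

lemma hankelOne_mul_radius (m : ℕ) {lam : ℂ} (hlam : lam ≠ 0) {ρ r : ℝ} (hρ : 0 < ρ)
    (hr : 0 < r) :
    hankelOne m (lam * r) = Complex.I / Real.pi * (-1) ^ m * ((lam * r / 2) ^ m)⁻¹ *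
      outerSol (2 * Complex.log (lam * ρ / (2 * Complex.I))) (-lam ^ 2 / 4) (ρ ^ 2) m
        (r ^ 2) := by
  have hr0 : (r : ℂ) ≠ 0 := by exact_mod_cast hr.ne'
  have hρ0 : (ρ : ℂ) ≠ 0 := by exact_mod_cast hρ.ne'
  rw [hankelOne_natCast m (mul_ne_zero hlam hr0), outerSol]
  congr 2
  · have hscale : lam * r / (2 * Complex.I) = (r / ρ : ℝ) * (lam * ρ / (2 * Complex.I)) := by
      push_cast; field_simp
    have hne : lam * ρ / (2 * Complex.I) ≠ 0 := div_ne_zero (mul_ne_zero hlam hρ0) (by simp)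
    rw [hscale, Complex.log_ofReal_mul (div_pos hr hρ) hne, ← div_pow,
      ← Complex.ofReal_log (by positivity), Real.log_pow]
    push_cast; ring
  · push_cast; ring

lemma outerProfile_mul_pow_eq_outgoingFactor (m : ℕ) {lam : ℂ} (hlam : lam ≠ 0) {ρ : ℝ}
    (hρ : 0 < ρ) {z : ℂ} (hz : z ≠ 0) :
    outerProfile (2 * Complex.log (lam * ρ / (2 * Complex.I))) (-lam ^ 2 / 4) (ρ ^ 2) m
        (Complex.normSq z) * z ^ m =
      Real.pi / Complex.I * (-1) ^ m * (lam / 2) ^ m * outgoingFactor lam m ‖z‖ *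
        (z / (‖z‖ : ℂ)) ^ (m : ℤ) := by
  have hz0 : 0 < ‖z‖ := norm_pos_iff.2 hz
  have hzc : (‖z‖ : ℂ) ≠ 0 := by exact_mod_cast hz0.ne'
  have hpi : (Real.pi : ℂ) ≠ 0 := by exact_mod_cast Real.pi_ne_zero
  have hsign : ((-1 : ℂ) ^ m) ^ 2 = 1 := by rw [← pow_mul, mul_comm, pow_mul]; simp
  rw [outgoingFactor, if_neg hlam, hankelOne_mul_radius m hlam hρ hz0, zpow_natCast, outerProfile,
    Complex.normSq_eq_norm_sq]
  simp only [div_pow, mul_pow, Complex.ofReal_pow]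
  field_simp
  rw [hsign]
  ring

lemma innerProfile_eq_outerProfile (L p q : ℂ) {R : ℝ} (hR : R ≠ 0) (k : ℕ) :
    singularSol k L (q * R) * innerProfile p k 0 R =
      R ^ k * besselClifford k (p * R) * outerProfile L q R k R := by
  have hRc : (R : ℂ) ≠ 0 := by exact_mod_cast hR
  rw [innerProfile, outerProfile, outerSol_self L q hR]
  field_simp
  rw [add_zero]

lemma innerProfile_one_eq_outerProfile {L p q : ℂ} {R : ℝ} (hR : R ≠ 0) {n : ℕ}
    (hmatch : besselClifford n (p * R) * singularSol (n + 1) L (q * R) -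
      q * R * besselClifford (n + 1 : ℕ) (p * R) * singularSol n L (q * R) = 0) :
    singularSol (n + 1) L (q * R) * innerProfile p (n + 1) 1 R =
      R ^ (n + 1) * besselClifford (n + 1 : ℕ) (p * R) * outerProfile L q R (n + 2) R := by
  have hRc : (R : ℂ) ≠ 0 := by exact_mod_cast hR
  rw [besselClifford_natCast_eq n] at hmatch
  rw [innerProfile, outerProfile, outerSol_self L q hR, singularSol_add_two, pow_one,
    ← mul_div_assoc, eq_div_iff (pow_ne_zero _ hRc)]
  linear_combination (R : ℂ) ^ (n + 1) * hmatch

lemma isResonance_of_profiles {ρ A : ℝ} (hρ : 0 ≤ ρ) {lam : ℂ}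
    (hcut : ¬ (lam.re = 0 ∧ lam.im < 0)) {k : ℕ} {a b : ℕ → ℝ → ℂ}
    (ha : ∀ j s, HasDerivAt (a j) (a (j + 1) s) s)
    (hb : ∀ j s, ρ ^ 2 ≤ s → HasDerivAt (b j) (b (j + 1) s) s)
    (h0 : a 0 (ρ ^ 2) = b 0 (ρ ^ 2)) (h1 : a 1 (ρ ^ 2) = b 1 (ρ ^ 2))
    (haode : ∀ s : ℝ, 4 * (s * a 2 s + (k + 1) * a 1 s) = (-A - lam ^ 2) * a 0 s)
    (hbode : ∀ s : ℝ, ρ ^ 2 < s → 4 * (s * b 2 s + (k + 1) * b 1 s) = -lam ^ 2 * b 0 s)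
    (hne : a 0 0 ≠ 0) {c : ℂ}
    (hout : ∀ z : ℂ, ρ < ‖z‖ → b 0 (Complex.normSq z) * z ^ k =
      c * outgoingFactor lam k ‖z‖ * (z / (‖z‖ : ℂ)) ^ (k : ℤ)) :
    IsResonance (circularWell ρ A) ρ lam := by
  have hcont : Continuous fun s => if s ≤ ρ ^ 2 then a 0 s else b 0 s :=
    continuous_ite_of_eq (continuous_iff_continuousAt.2 fun s => (ha 0 s).continuousAt)
      (fun s hs => (hb 0 s hs).continuousAt.continuousWithinAt) h0
  refine ⟨hcut, _, not_modeFun_ae_eq_zero hcont ?_ k,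
    isSolution_modeFun_ite hρ Complex.I_sq k ha hb h0 h1 haode hbode,
    isOutgoing_of_mode (k : ℤ) c fun z hz => ?_⟩
  · rwa [if_pos (sq_nonneg ρ)]
  · rw [modeFun, planarLin_I, if_neg (mt (normSq_le_sq_iff hρ z).1 hz.not_ge), hout z hz]

lemma isResonance_of_matching {ρ : ℝ} (hρ : 0 < ρ) (A : ℝ) (n : ℕ) {lam : ℂ} (hlam : lam ≠ 0)
    (hcut : ¬ (lam.re = 0 ∧ lam.im < 0)) {L t τ : ℂ}
    (hL : L = 2 * Complex.log (lam * ρ / (2 * Complex.I))) (ht : t = -lam ^ 2 * ρ ^ 2 / 4)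
    (hτ : τ = -(A + lam ^ 2) * ρ ^ 2 / 4)
    (hmatch : besselClifford n τ * singularSol (n + 1) L t -
      t * besselClifford (n + 1 : ℕ) τ * singularSol n L t = 0)
    (hS : singularSol (n + 1) L t ≠ 0) : IsResonance (circularWell ρ A) ρ lam := by
  have hR : 0 < ρ ^ 2 := by positivity
  obtain ⟨p, hp⟩ : ∃ p : ℂ, p = -(A + lam ^ 2) / 4 := ⟨_, rfl⟩
  obtain ⟨q, hq⟩ : ∃ q : ℂ, q = -lam ^ 2 / 4 := ⟨_, rfl⟩
  have hq0 : q ≠ 0 := hq ▸ div_ne_zero (neg_ne_zero.2 (pow_ne_zero 2 hlam)) (by norm_num)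
  obtain rfl : τ = p * (ρ ^ 2 : ℝ) := by rw [hp, hτ]; push_cast; ring
  obtain rfl : t = q * (ρ ^ 2 : ℝ) := by rw [hq, ht]; push_cast; ring
  -- each side of the circle is scaled by the boundary value of the other
  set α := singularSol (n + 1) L (q * (ρ ^ 2 : ℝ))
  set β : ℂ := (ρ ^ 2 : ℝ) ^ (n + 1) * besselClifford (n + 1 : ℕ) (p * (ρ ^ 2 : ℝ))
  refine isResonance_of_profiles (k := n + 1)
    (a := fun j s => α * innerProfile p (n + 1) j s)
    (b := fun j s => β * outerProfile L q (ρ ^ 2) (n + 1 + j) s) hρ.le hcut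
    (fun j s => (hasDerivAt_innerProfile p (n + 1) j s).const_mul α) (fun j s hs => ?_)
    (innerProfile_eq_outerProfile L p q hR.ne' (n + 1))
    (innerProfile_one_eq_outerProfile hR.ne' hmatch) (fun s => ?_) (fun s hs => ?_) ?_
    (c := β * (Real.pi / Complex.I * (-1) ^ (n + 1) * (lam / 2) ^ (n + 1))) fun z hz => ?_
  · have hder := hasDerivAt_outerProfile (L := L) hq0 hR (n + j) (hR.trans_le hs)
    rw [show n + j + 1 = n + 1 + j by ring, show n + j + 2 = n + 1 + (j + 1) by ring] at hder
    exact hder.const_mul β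
  · linear_combination 4 * α * innerProfile_ode p (n + 1) s +
      4 * (α * innerProfile p (n + 1) 0 s) * hp
  · linear_combination 4 * β * outerProfile_ode L q (ρ ^ 2) (n + 1) (hR.trans hs).ne' +
      4 * (β * outerProfile L q (ρ ^ 2) (n + 1) s) * hq
  · simp only [innerProfile, Complex.ofReal_zero, mul_zero, pow_zero, one_mul,
      besselClifford_natCast_zero]
    exact mul_ne_zero hS (inv_ne_zero (by exact_mod_cast Nat.factorial_ne_zero _))
  · have houter := outerProfile_mul_pow_eq_outgoingFactor (n + 1) hlam hρ
      (norm_pos_iff.1 (hρ.trans hz))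
    rw [← hL, ← hq] at houter
    simp only [add_zero]
    linear_combination β * houter

/-! ### Existence of the resonance -/

lemma cpow_half_sq (z : ℂ) : (z ^ (1 / 2 : ℂ)) ^ 2 = z := by
  rw [← Complex.cpow_nat_mul]
  norm_num

lemma ofReal_cpow_half {x : ℝ} (hx : 0 ≤ x) : (x : ℂ) ^ (1 / 2 : ℂ) = (√x : ℝ) := by
  rw [Real.sqrt_eq_rpow, Complex.ofReal_cpow hx]
  norm_num

lemma ofReal_cpow_half_of_neg {x : ℝ} (hx : x < 0) :
    (x : ℂ) ^ (1 / 2 : ℂ) = (√(-x) : ℝ) * Complex.I := by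
  rw [Complex.ofReal_cpow_of_nonpos hx.le, ← Complex.ofReal_neg, ofReal_cpow_half (by linarith),
    show (Real.pi : ℂ) * Complex.I * (1 / 2) = Real.pi / 2 * Complex.I by ring,
    Complex.exp_pi_div_two_mul_I]

lemma cpow_half_re_pos {z : ℂ} (hz : 0 < z.re) : 0 < (z ^ (1 / 2 : ℂ)).re := by
  have hz0 : z ≠ 0 := by rintro rfl; simp at hz
  have harg := abs_lt.1 (Complex.abs_arg_lt_pi_div_two_iff.2 (Or.inl hz))
  have him : (Complex.log z * (1 / 2)).im = z.arg / 2 := by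
    rw [← Complex.log_im]; simp [div_eq_mul_inv]
  rw [Complex.cpow_def_of_ne_zero hz0, Complex.exp_re, him]
  exact mul_pos (Real.exp_pos _)
    (Real.cos_pos_of_mem_Ioo ⟨by linarith [Real.pi_pos], by linarith [Real.pi_pos]⟩)

lemma norm_cpow_half_sub_sqrt_le {z : ℂ} (hz : 0 < z.re) {x : ℝ} (hx : 0 < x) :
    ‖z ^ (1 / 2 : ℂ) - (√x : ℝ)‖ ≤ ‖z - x‖ / √x := by
  have hsum : √x ≤ ‖z ^ (1 / 2 : ℂ) + (√x : ℝ)‖ := by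
    refine le_trans ?_ (Complex.re_le_norm _)
    rw [Complex.add_re, Complex.ofReal_re]
    linarith [cpow_half_re_pos hz]
  have hprod : ‖z ^ (1 / 2 : ℂ) - (√x : ℝ)‖ * ‖z ^ (1 / 2 : ℂ) + (√x : ℝ)‖ = ‖z - x‖ := by
    have hsq : ((√x : ℝ) : ℂ) ^ 2 = x := by exact_mod_cast Real.sq_sqrt hx.le
    rw [← norm_mul]
    congr 1
    linear_combination cpow_half_sq z - hsq
  rw [le_div_iff₀ (Real.sqrt_pos.2 hx), ← hprod]
  exact mul_le_mul_of_nonneg_left hsum (norm_nonneg _)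

/-- The value of `(V - λ²) ρ² / 4` in the well at `λ = 0` and depth `a²`, which is the argument
of the inner solution at the boundary. -/
def tauZero (ρ a : ℝ) : ℂ := ((-(a ^ 2 * ρ ^ 2 / 4) : ℝ) : ℂ)

/-- The square root `λ` of `-4 t / ρ²` that belongs to the branch `log (σ t) + 2 θ i` of `log t`
on the half plane `halfPlane σ`. -/
def resonanceRoot (ρ σ θ : ℝ) (t : ℂ) : ℂ :=
  2 * Complex.I / ρ * (Complex.exp (θ * Complex.I) * (σ * t) ^ (1 / 2 : ℂ))

/-- The two branches of the logarithm that are used: the principal one on the right half plane,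
which yields the bound states, and `log (-t) - πi` on the left half plane, which yields the
resonances. -/
def IsBranch (σ θ : ℝ) : Prop := (σ = 1 ∧ θ = 0) ∨ (σ = -1 ∧ θ = -(Real.pi / 2))

lemma IsBranch.abs_eq_one {σ θ : ℝ} (h : IsBranch σ θ) : |σ| = 1 := by
  rcases h with ⟨rfl, _⟩ | ⟨rfl, _⟩ <;> simp

lemma exp_neg_pi_div_two_mul_I :
    Complex.exp ((-(Real.pi / 2) : ℝ) * Complex.I) = -Complex.I := by
  rw [show ((-(Real.pi / 2) : ℝ) : ℂ) * Complex.I = -(Real.pi / 2 * Complex.I) by push_cast; ring,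
    Complex.exp_neg, Complex.exp_pi_div_two_mul_I, Complex.inv_I]

lemma IsBranch.exp_sq {σ θ : ℝ} (h : IsBranch σ θ) :
    Complex.exp (θ * Complex.I) ^ 2 = σ := by
  rcases h with ⟨rfl, rfl⟩ | ⟨rfl, rfl⟩
  · simp
  · rw [exp_neg_pi_div_two_mul_I, neg_sq, Complex.I_sq]; simp

section resonanceRoot

variable {ρ σ θ : ℝ} {t : ℂ}

lemma mul_ne_zero_of_mem_halfPlane (ht : t ∈ halfPlane σ) : (σ : ℂ) * t ≠ 0 := fun h0 => by
  have hre := mem_halfPlane.1 ht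
  rw [← Complex.re_ofReal_mul, h0] at hre
  simp at hre

lemma resonanceRoot_sq (h : IsBranch σ θ) (ht : t ∈ halfPlane σ) :
    resonanceRoot ρ σ θ t ^ 2 = -4 * t / ρ ^ 2 := by
  have hσ : (σ : ℂ) * σ = 1 := by rcases h with ⟨rfl, _⟩ | ⟨rfl, _⟩ <;> simp
  rw [resonanceRoot, mul_pow, mul_pow, cpow_half_sq, h.exp_sq,
    div_pow, mul_pow, Complex.I_sq]
  linear_combination (-4 * t / ρ ^ 2) * hσ

lemma two_mul_log_resonanceRoot (hρ : ρ ≠ 0) (h : IsBranch σ θ) (ht : t ∈ halfPlane σ) :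
    2 * Complex.log (resonanceRoot ρ σ θ t * ρ / (2 * Complex.I)) =
      branchLog σ (2 * (θ * Complex.I)) t := by
  have hρ0 : (ρ : ℂ) ≠ 0 := by exact_mod_cast hρ
  have hroot : resonanceRoot ρ σ θ t * ρ / (2 * Complex.I) =
      Complex.exp (θ * Complex.I + Complex.log (σ * t) * (1 / 2)) := by
    rw [resonanceRoot, Complex.cpow_def_of_ne_zero (mul_ne_zero_of_mem_halfPlane ht),
      Complex.exp_add]
    field_simp
  have harg : |(Complex.log (σ * t)).im| < Real.pi / 2 := by
    rw [Complex.log_im]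
    exact Complex.abs_arg_lt_pi_div_two_iff.2
      (Or.inl (by simpa only [Complex.re_ofReal_mul] using mem_halfPlane.1 ht))
  have him : (θ * Complex.I + Complex.log (σ * t) * (1 / 2)).im =
      θ + (Complex.log (σ * t)).im / 2 := by
    simp [div_eq_mul_inv]
  have hbounds := abs_lt.1 harg
  rw [hroot, Complex.log_exp, branchLog]
  · ring
  · rw [him]; rcases h with ⟨_, rfl⟩ | ⟨_, rfl⟩ <;> linarith [Real.pi_pos]
  · rw [him]; rcases h with ⟨_, rfl⟩ | ⟨_, rfl⟩ <;> linarith [Real.pi_pos]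

lemma resonanceRoot_ne_zero (hρ : ρ ≠ 0) (ht : t ∈ halfPlane σ) : resonanceRoot ρ σ θ t ≠ 0 := by
  have hρ0 : (ρ : ℂ) ≠ 0 := by exact_mod_cast hρ
  refine mul_ne_zero (div_ne_zero (mul_ne_zero two_ne_zero Complex.I_ne_zero) hρ0)
    (mul_ne_zero (Complex.exp_ne_zero _) fun h0 => mul_ne_zero_of_mem_halfPlane ht ?_)
  rw [← cpow_half_sq (σ * t), h0, zero_pow two_ne_zero]

lemma resonanceRoot_not_mem_cut (hρ : 0 < ρ) (h : IsBranch σ θ) (ht : t ∈ halfPlane σ) :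
    ¬ ((resonanceRoot ρ σ θ t).re = 0 ∧ (resonanceRoot ρ σ θ t).im < 0) := by
  have hre : 0 < ((σ * t) ^ (1 / 2 : ℂ)).re :=
    cpow_half_re_pos (by simpa only [Complex.re_ofReal_mul] using mem_halfPlane.1 ht)
  rw [resonanceRoot]
  set w := (σ * t) ^ (1 / 2 : ℂ)
  have hpos : 0 < 2 / ρ * w.re := by positivity
  rintro ⟨hre0, him⟩
  rcases h with ⟨rfl, rfl⟩ | ⟨rfl, rfl⟩
  · have heq : 2 * Complex.I / ρ * (Complex.exp ((0 : ℝ) * Complex.I) * w) =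
        ((2 / ρ : ℝ) : ℂ) * (Complex.I * w) := by
      rw [Complex.ofReal_zero, zero_mul, Complex.exp_zero]; push_cast; ring
    rw [heq, Complex.im_ofReal_mul, Complex.I_mul_im] at him
    linarith
  · have heq : 2 * Complex.I / ρ * (Complex.exp ((-(Real.pi / 2) : ℝ) * Complex.I) * w) =
        ((2 / ρ : ℝ) : ℂ) * w := by
      rw [exp_neg_pi_div_two_mul_I]; push_cast
      linear_combination (-2 / ρ * w) * Complex.I_mul_I
    rw [heq, Complex.re_ofReal_mul] at hre0
    linarith

lemma resonanceRoot_ofReal (hρ : 0 < ρ) (h : IsBranch σ θ) {μ : ℝ} (hμ : σ * μ < 0) :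
    resonanceRoot ρ σ θ ((-(μ * ρ ^ 2 / 4) : ℝ) : ℂ) = (μ : ℂ) ^ (1 / 2 : ℂ) := by
  have hρ0 : (ρ : ℂ) ≠ 0 := by exact_mod_cast hρ.ne'
  have hsqrt : ((σ : ℂ) * ((-(μ * ρ ^ 2 / 4) : ℝ) : ℂ)) ^ (1 / 2 : ℂ) =
      (√(-(σ * μ)) * (ρ / 2) : ℝ) := by
    have hσμ : 0 ≤ -(σ * μ) := by linarith
    rw [show (σ : ℂ) * ((-(μ * ρ ^ 2 / 4) : ℝ) : ℂ) = ((-(σ * μ) * (ρ / 2) ^ 2 : ℝ) : ℂ) by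
      push_cast; ring, ofReal_cpow_half (by positivity), Real.sqrt_mul hσμ,
      Real.sqrt_sq (by positivity)]
  rw [resonanceRoot, hsqrt]
  rcases h with ⟨rfl, rfl⟩ | ⟨rfl, rfl⟩
  · rw [ofReal_cpow_half_of_neg (by linarith), one_mul, Complex.ofReal_zero, zero_mul,
      Complex.exp_zero]
    push_cast
    field_simp
  · rw [ofReal_cpow_half (by linarith), exp_neg_pi_div_two_mul_I,
      neg_one_mul μ, neg_neg]
    push_cast
    field_simp
    rw [Complex.I_sq]
    ring

lemma norm_resonanceRoot_sub_le (hρ : 0 ≤ ρ) (ht : t ∈ halfPlane σ) {x : ℝ} (hx : 0 < σ * x) :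
    ‖resonanceRoot ρ σ θ t - resonanceRoot ρ σ θ x‖ ≤ 2 / ρ * (|σ| * ‖t - x‖ / √(σ * x)) := by
  have hdiff := norm_cpow_half_sub_sqrt_le (z := σ * t)
    (by simpa only [Complex.re_ofReal_mul] using mem_halfPlane.1 ht) hx
  rw [Complex.ofReal_mul, ← mul_sub, norm_mul, Complex.norm_real, Real.norm_eq_abs] at hdiff
  have hfactor : resonanceRoot ρ σ θ t - resonanceRoot ρ σ θ x = 2 * Complex.I / ρ *
      Complex.exp (θ * Complex.I) * ((σ * t) ^ (1 / 2 : ℂ) - (√(σ * x) : ℝ)) := by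
    rw [resonanceRoot, resonanceRoot, ← ofReal_cpow_half hx.le]
    push_cast
    ring
  rw [hfactor, norm_mul, norm_mul, Complex.norm_exp_ofReal_mul_I, norm_div, norm_mul,
    Complex.norm_I, Complex.norm_real, Real.norm_of_nonneg hρ]
  simp only [Complex.norm_ofNat, mul_one]
  exact mul_le_mul_of_nonneg_left hdiff (by positivity)

lemma isResonance_resonanceRoot (hρ : 0 < ρ) (a ε : ℝ) {n : ℕ} (h : IsBranch σ θ)
    (ht : t ∈ halfPlane σ)
    (hmatch : matching σ (2 * (θ * Complex.I)) n (tauZero ρ a) ((ε * ρ ^ 2 / 4 : ℝ) : ℂ) t = 0)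
    (hS : singularBranch σ (2 * (θ * Complex.I)) (n + 2) t ≠ 0) :
    IsResonance (circularWell ρ (a ^ 2 - ε)) ρ (resonanceRoot ρ σ θ t) := by
  have hρ0 : (ρ : ℂ) ≠ 0 := by exact_mod_cast hρ.ne'
  have hsq := resonanceRoot_sq (ρ := ρ) h ht
  refine isResonance_of_matching hρ _ (n + 1) (resonanceRoot_ne_zero hρ.ne' ht)
    (resonanceRoot_not_mem_cut hρ h ht) (two_mul_log_resonanceRoot hρ.ne' h ht).symm ?_ ?_
    hmatch hS
  · rw [hsq]; field_simp
  · rw [hsq, tauZero]; push_cast; field_simp; ring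

lemma norm_resonanceRoot_sub_cpow_le (hρ : 0 < ρ) (h : IsBranch σ θ) (ht : t ∈ halfPlane σ)
    {μ : ℝ} (hμ : σ * μ < 0) :
    ‖resonanceRoot ρ σ θ t - (μ : ℂ) ^ (1 / 2 : ℂ)‖ ≤
      4 / ρ ^ 2 * (‖t - ((-(μ * ρ ^ 2 / 4) : ℝ) : ℂ)‖ / √|μ|) := by
  have habs : |μ| = -(σ * μ) := by rw [← abs_of_neg hμ, abs_mul, h.abs_eq_one, one_mul]
  have hx : σ * -(μ * ρ ^ 2 / 4) = |μ| * (ρ / 2) ^ 2 := by rw [habs]; ring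
  have hμ0 : 0 < |μ| := by linarith
  have hle := norm_resonanceRoot_sub_le (θ := θ) hρ.le ht (x := -(μ * ρ ^ 2 / 4))
    (by rw [hx]; positivity)
  rw [resonanceRoot_ofReal hρ h hμ, h.abs_eq_one, one_mul, hx, Real.sqrt_mul hμ0.le,
    Real.sqrt_sq (by positivity)] at hle
  refine hle.trans_eq ?_
  field_simp
  ring

end resonanceRoot

lemma exists_resonance {ρ : ℝ} (hρ : 0 < ρ) (a : ℝ) {n : ℕ}
    (hτ : besselClifford (n + 1 : ℕ) (tauZero ρ a) = 0) {σ θ : ℝ} (h : IsBranch σ θ) :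
    ∃ ε₀ > 0, ∃ C : ℝ, ∀ ε : ℝ, σ * ε < 0 → |ε| < ε₀ → ∃ lam : ℂ,
      IsResonance (circularWell ρ (a ^ 2 - ε)) ρ lam ∧
      ‖lam - ((ε * modeRatio n : ℝ) : ℂ) ^ (1 / 2 : ℂ)‖ ≤
        C * (‖matching σ (2 * (θ * Complex.I)) n (tauZero ρ a) ((ε * ρ ^ 2 / 4 : ℝ) : ℂ)
          (approxZero n (ε * ρ ^ 2 / 4))‖ / √|ε|) := by
  obtain ⟨δ, hδ, hzero⟩ := exists_zero_matching h.abs_eq_one (2 * (θ * Complex.I)) hτ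
    (matchingSlope_ne_zero hτ)
  have hscale : 0 < ρ ^ 2 / 4 := by positivity
  have hratio := modeRatio_pos n
  refine ⟨δ / (ρ ^ 2 / 4), by positivity,
    4 / ρ ^ 2 * (2 / ‖matchingSlope n (tauZero ρ a)‖ / √(modeRatio n)), fun ε hε hεδ => ?_⟩
  have heδ : |ε * ρ ^ 2 / 4| < δ := by
    rw [mul_div_assoc, abs_mul, abs_of_pos hscale]
    exact (lt_div_iff₀ hscale).1 hεδ
  obtain ⟨t, ht, hmatch, hS, hle⟩ := hzero (ε * ρ ^ 2 / 4)
    (by rw [mul_div_assoc, ← mul_assoc]; exact mul_neg_of_neg_of_pos hε hscale) heδ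
  refine ⟨resonanceRoot ρ σ θ t, isResonance_resonanceRoot hρ a ε h ht hmatch hS, ?_⟩
  have hroot := norm_resonanceRoot_sub_cpow_le hρ h ht (μ := ε * modeRatio n)
    (by rw [← mul_assoc]; exact mul_neg_of_neg_of_pos hε hratio)
  rw [show -(ε * modeRatio n * ρ ^ 2 / 4) = -(modeRatio n * (ε * ρ ^ 2 / 4)) by ring,
    ← approxZero, abs_mul, abs_of_pos hratio, Real.sqrt_mul (abs_nonneg ε)] at hroot
  refine hroot.trans ?_
  rw [mul_assoc (4 / ρ ^ 2), div_mul_div_comm _ √(modeRatio n), mul_comm √|ε|]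
  exact mul_le_mul_of_nonneg_left (div_le_div_of_nonneg_right hle (by positivity)) (by positivity)

/-! ### Functions with an angular mode -/

/-- The angular derivative `∂_θ φ`. -/
def angularDeriv (φ : ℂ → ℂ) (z : ℂ) : ℂ := fderiv ℝ φ z (Complex.I * z)

section Rotation

variable {φ ψ : ℂ → ℂ} {ℓ : ℤ}

lemma norm_exp_mul_I_mul (α : ℝ) (z : ℂ) : ‖Complex.exp (α * Complex.I) * z‖ = ‖z‖ := by
  rw [norm_mul, Complex.norm_exp_ofReal_mul_I, one_mul]

lemma isTestFunction_comp_rotation (hφ : IsTestFunction φ) (w : Circle) :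
    IsTestFunction fun z => φ (w * z) := by
  have hrot : (fun z => φ (w * z)) = φ ∘ rotation w := by funext z; simp [rotation_apply]
  rw [hrot]
  exact ⟨hφ.1.comp (rotation w).contDiff, hφ.2.comp_homeomorph (rotation w).toHomeomorph⟩

lemma continuous_angularDeriv (hφ : IsTestFunction φ) : Continuous (angularDeriv φ) :=
  (hφ.1.continuous_fderiv (by simp)).clm_apply (by fun_prop)

lemma hasCompactSupport_angularDeriv (hφ : IsTestFunction φ) :
    HasCompactSupport (angularDeriv φ) :=
  (hφ.2.fderiv ℝ).mono fun z hz h0 => hz (by rw [angularDeriv, h0, _root_.zero_apply])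

lemma angularDeriv_comp_mul (hφ : IsTestFunction φ) (w z : ℂ) :
    angularDeriv (fun z => φ (w * z)) z = angularDeriv φ (w * z) := by
  have hφd : DifferentiableAt ℝ φ (w * z) := (hφ.1.differentiable (by simp)) _
  have hmul : HasFDerivAt (fun z : ℂ => w * z) (w • ContinuousLinearMap.id ℝ ℂ) z :=
    (hasFDerivAt_id z).const_mul _
  have hcomp := (hφd.hasFDerivAt.comp z hmul).fderiv
  simp only [Function.comp_def] at hcomp
  rw [angularDeriv, hcomp, angularDeriv]
  simp only [ContinuousLinearMap.comp_apply, _root_.smul_apply, ContinuousLinearMap.id_apply,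
    smul_eq_mul]
  congr 1; ring

lemma hasDerivAt_rotate (hφ : IsTestFunction φ) (z : ℂ) (α : ℝ) :
    HasDerivAt (fun α : ℝ => φ (Complex.exp (α * Complex.I) * z))
      (angularDeriv φ (Complex.exp (α * Complex.I) * z)) α := by
  have hexp : HasDerivAt (fun α : ℝ => Complex.exp (α * Complex.I) * z)
      (Complex.I * (Complex.exp (α * Complex.I) * z)) α := by
    have hlin : HasDerivAt (fun α : ℝ => (α : ℂ) * Complex.I) Complex.I α := by
      simpa using (Complex.ofRealCLM.hasDerivAt (x := α)).mul_const Complex.I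
    refine (hlin.cexp.mul_const z).congr_deriv ?_
    ring
  exact ((hφ.1.differentiable (by simp)) _).hasFDerivAt.comp_hasDerivAt α hexp

lemma exists_integrable_bound_rotate (hψ : LocallyIntegrable ψ) {f : ℂ → ℂ} (hf : Continuous f)
    (hfs : HasCompactSupport f) :
    ∃ g : ℂ → ℝ, Integrable g ∧
      ∀ (α : ℝ) (z : ℂ), ‖ψ z * f (Complex.exp (α * Complex.I) * z)‖ ≤ g z := by
  obtain ⟨r, hr⟩ := hfs.isCompact.isBounded.subset_closedBall (0 : ℂ)
  obtain ⟨C, hC⟩ := hf.bounded_above_of_compact_support hfs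
  have hψi : Integrable ((Metric.closedBall (0 : ℂ) r).indicator ψ) :=
    (hψ.integrableOn_isCompact (isCompact_closedBall 0 r)).integrable_indicator
      measurableSet_closedBall
  refine ⟨_, hψi.norm.mul_const C, fun α z => ?_⟩
  rw [norm_mul]
  by_cases hz : z ∈ Metric.closedBall (0 : ℂ) r
  · rw [Set.indicator_of_mem hz]
    exact mul_le_mul_of_nonneg_left (hC _) (norm_nonneg _)
  · have hrot : Complex.exp (α * Complex.I) * z ∉ tsupport f := fun hmem => hz <| by
      simpa only [mem_closedBall_zero_iff, norm_exp_mul_I_mul] using hr hmem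
    rw [image_eq_zero_of_notMem_tsupport hrot, Set.indicator_of_notMem hz]
    simp

lemma aestronglyMeasurable_mul_rotate (hψ : LocallyIntegrable ψ) {f : ℂ → ℂ} (hf : Continuous f)
    (α : ℝ) : AEStronglyMeasurable fun z => ψ z * f (Complex.exp (α * Complex.I) * z) :=
  hψ.aestronglyMeasurable.mul (hf.comp (by fun_prop)).aestronglyMeasurable

lemma hasDerivAt_integral_mul_rotate (hψ : LocallyIntegrable ψ) (hφ : IsTestFunction φ) (α : ℝ) :
    HasDerivAt (fun α : ℝ => ∫ z, ψ z * φ (Complex.exp (α * Complex.I) * z))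
      (∫ z, ψ z * angularDeriv φ (Complex.exp (α * Complex.I) * z)) α := by
  obtain ⟨g, hg, hgb⟩ := exists_integrable_bound_rotate hψ hφ.1.continuous hφ.2
  obtain ⟨g', hg', hgb'⟩ := exists_integrable_bound_rotate hψ (continuous_angularDeriv hφ)
    (hasCompactSupport_angularDeriv hφ)
  exact (hasDerivAt_integral_of_dominated_loc_of_deriv_le (s := Set.univ) univ_mem
    (Eventually.of_forall (aestronglyMeasurable_mul_rotate hψ hφ.1.continuous))
    (hg.mono' (aestronglyMeasurable_mul_rotate hψ hφ.1.continuous α)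
      (Eventually.of_forall (hgb α)))
    (aestronglyMeasurable_mul_rotate hψ (continuous_angularDeriv hφ) α)
    (Eventually.of_forall fun z β _ => hgb' β z) hg'
    (Eventually.of_forall fun z β _ => (hasDerivAt_rotate hφ z β).const_mul (ψ z))).2

lemma integral_mul_angularDeriv_rotate (hm : HasAngularMode ℓ ψ) (hφ : IsTestFunction φ) (α : ℝ) :
    ∫ z, ψ z * angularDeriv φ (Complex.exp (α * Complex.I) * z) =
      -(ℓ * Complex.I) * ∫ z, ψ z * φ (Complex.exp (α * Complex.I) * z) := by
  calc _ = ∫ z, ψ z * angularDeriv (fun z => φ (Complex.exp (α * Complex.I) * z)) z := by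
        simp only [angularDeriv_comp_mul hφ]
    _ = -∫ z, Complex.I * ℓ * ψ z * φ (Complex.exp (α * Complex.I) * z) := by
        simpa only [Circle.coe_exp, angularDeriv] using
          hm _ (isTestFunction_comp_rotation hφ (Circle.exp α))
    _ = _ := by
        rw [← integral_const_mul, ← integral_neg]
        refine integral_congr_ae (Eventually.of_forall fun z => ?_)
        ring

lemma integral_mul_rotate (hψ : LocallyIntegrable ψ) (hm : HasAngularMode ℓ ψ)
    (hφ : IsTestFunction φ) (α : ℝ) :
    Complex.exp (ℓ * α * Complex.I) * ∫ z, ψ z * φ (Complex.exp (α * Complex.I) * z) =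
      ∫ z, ψ z * φ z := by
  have hderiv : ∀ β : ℝ, HasDerivAt (fun β : ℝ => Complex.exp (ℓ * β * Complex.I) *
      ∫ z, ψ z * φ (Complex.exp (β * Complex.I) * z)) 0 β := fun β => by
    have hlin : HasDerivAt (fun β : ℝ => (ℓ : ℂ) * β * Complex.I) (ℓ * Complex.I) β := by
      simpa using (hasDerivAt_const_mul_ofReal (ℓ : ℂ) β).mul_const Complex.I
    refine (hlin.cexp.mul (hasDerivAt_integral_mul_rotate hψ hφ β)).congr_deriv ?_
    rw [integral_mul_angularDeriv_rotate hm hφ]; ring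
  simpa using is_const_of_deriv_eq_zero (fun β => (hderiv β).differentiableAt)
    (fun β => (hderiv β).deriv) α 0

lemma ae_rotate_of_hasAngularMode (hψ : LocallyIntegrable ψ) (hm : HasAngularMode ℓ ψ) (α : ℝ) :
    ∀ᵐ z, ψ (Complex.exp (α * Complex.I) * z) = Complex.exp (ℓ * α * Complex.I) * ψ z := by
  set w : Circle := Circle.exp α with hw
  have hrot : ∀ z, rotation w z = Complex.exp (α * Complex.I) * z := fun z => by
    rw [rotation_apply, hw, Circle.coe_exp]
  have hcancel : ∀ z, (w⁻¹ : Circle) * (Complex.exp (α * Complex.I) * z) = z := fun z => by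
    rw [← Circle.coe_exp, ← mul_assoc, ← Circle.coe_mul, inv_mul_cancel, Circle.coe_one, one_mul]
  have hmp := (rotation w).measurePreserving
  have hψr : LocallyIntegrable fun z => ψ (Complex.exp (α * Complex.I) * z) := by
    simp only [← hrot]
    refine (locallyIntegrable_map_homeomorph (rotation w).toHomeomorph).1 ?_
    have hmap : Measure.map (rotation w).toHomeomorph volume = volume := hmp.map_eq
    rwa [hmap]
  refine ae_eq_of_integral_contDiff_smul_eq hψr (hψ.smul (Complex.exp (ℓ * α * Complex.I)))
    fun g hg hgs => ?_
  have hφ : IsTestFunction fun z => (g z : ℂ) :=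
    ⟨Complex.ofRealCLM.contDiff.comp hg, hgs.comp_left (g := fun x : ℝ => (x : ℂ)) rfl⟩
  have hinv := integral_mul_rotate hψ hm (isTestFunction_comp_rotation hφ w⁻¹) α
  simp only [hcancel] at hinv
  have hsubst : ∫ z, ψ z * (g ((w⁻¹ : Circle) * z) : ℂ) =
      ∫ z, ψ (Complex.exp (α * Complex.I) * z) * (g z : ℂ) := by
    rw [← hmp.integral_comp (rotation w).toHomeomorph.measurableEmbedding]
    simp only [hrot, hcancel]
  calc ∫ z, g z • ψ (Complex.exp (α * Complex.I) * z)
      = ∫ z, ψ (Complex.exp (α * Complex.I) * z) * (g z : ℂ) := by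
        simp only [Complex.real_smul, mul_comm]
    _ = Complex.exp (ℓ * α * Complex.I) * ∫ z, ψ z * (g z : ℂ) := by rw [← hsubst, hinv]
    _ = ∫ z, g z • (Complex.exp (ℓ * α * Complex.I) * ψ z) := by
        rw [← integral_const_mul]
        refine integral_congr_ae (Eventually.of_forall fun z => ?_)
        simp only [Complex.real_smul]; ring

end Rotation

lemma intervalIntegral_rotate (ζ : ℂ → ℂ) (z : ℂ) :
    ∫ α in (0 : ℝ)..2 * Real.pi, ζ (Complex.exp (α * Complex.I) * z) =
      ∫ α in (0 : ℝ)..2 * Real.pi, ζ (Complex.exp (α * Complex.I) * ‖z‖) := by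
  have hper : Function.Periodic (fun α : ℝ => ζ (Complex.exp (α * Complex.I) * ‖z‖))
      (2 * Real.pi) := fun α => by
    simp only
    congr 2
    rw [show (((α + 2 * Real.pi : ℝ) : ℂ) * Complex.I) =
      α * Complex.I + 2 * Real.pi * Complex.I by push_cast; ring, Complex.exp_add,
      Complex.exp_two_pi_mul_I, mul_one]
  have hshift : ∀ α : ℝ, ζ (Complex.exp (α * Complex.I) * z) =
      ζ (Complex.exp (((α + z.arg : ℝ) : ℂ) * Complex.I) * ‖z‖) := fun α => by
    congr 1
    conv_lhs => rw [← Complex.norm_mul_exp_arg_mul_I z]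
    push_cast
    rw [add_mul, Complex.exp_add]
    ring
  have hstart := hper.intervalIntegral_add_eq z.arg 0
  rw [zero_add, add_comm] at hstart
  simp only [hshift]
  rw [intervalIntegral.integral_comp_add_right
    (fun α : ℝ => ζ (Complex.exp (α * Complex.I) * ‖z‖)), zero_add, hstart]

lemma exists_radial_of_ae_rotate {ζ : ℂ → ℂ} (hζ : StronglyMeasurable ζ)
    (h : ∀ α : ℝ, ∀ᵐ z, ζ (Complex.exp (α * Complex.I) * z) = ζ z) :
    ∃ g : ℝ → ℂ, ∀ᵐ z, ζ z = g (Complex.normSq z) := by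
  have hms : MeasurableSet {p : ℝ × ℂ | ζ (Complex.exp (p.1 * Complex.I) * p.2) = ζ p.2} := by
    refine measurableSet_eq_fun (hζ.measurable.comp ?_) (hζ.measurable.comp measurable_snd)
    exact Continuous.measurable (by fun_prop)
  have hae : ∀ᵐ z : ℂ, ∀ᵐ α : ℝ, ζ (Complex.exp (α * Complex.I) * z) = ζ z :=
    (Measure.ae_ae_comm hms).1 (Eventually.of_forall h)
  refine ⟨fun s => (2 * Real.pi : ℂ)⁻¹ *
    ∫ α in (0 : ℝ)..2 * Real.pi, ζ (Complex.exp (α * Complex.I) * (√s : ℝ)), ?_⟩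
  filter_upwards [hae] with z hz
  have hmean : ∫ α in (0 : ℝ)..2 * Real.pi, ζ (Complex.exp (α * Complex.I) * z) =
      2 * Real.pi * ζ z := by
    rw [intervalIntegral.integral_congr_ae (g := fun _ => ζ z) (hz.mono fun α hα _ => hα)]
    simp
  have hpi : (Real.pi : ℂ) ≠ 0 := by exact_mod_cast Real.pi_ne_zero
  rw [Complex.normSq_eq_norm_sq, Real.sqrt_sq (norm_nonneg z), ← intervalIntegral_rotate, hmean]
  field_simp

/-! ### Integrals of radial functions -/

section RadialIntegral

variable {E : Type*} [NormedAddCommGroup E] [NormedSpace ℝ E]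

lemma integrable_comp_normSq_iff (F : ℝ → E) :
    Integrable (fun z : ℂ => F (Complex.normSq z)) ↔ IntegrableOn F (Set.Ioi 0) := by
  have hpolar := integrable_fun_norm_addHaar (E := ℂ) (μ := volume) (f := fun r => F (r ^ 2))
  rw [Complex.finrank_real_complex] at hpolar
  simp only [Complex.normSq_eq_norm_sq]
  rw [hpolar, ← integrableOn_Ioi_comp_rpow_iff' F (p := 2) two_ne_zero]
  refine integrableOn_congr_fun (fun x _ => ?_) measurableSet_Ioi
  norm_num

lemma integral_comp_normSq (F : ℝ → E) :
    ∫ z : ℂ, F (Complex.normSq z) =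
      (volume.real (Metric.ball (0 : ℂ) 1)) • ∫ s in Set.Ioi 0, F s := by
  have hpolar := integral_fun_norm_addHaar (E := ℂ) volume (fun r => F (r ^ 2))
  rw [Complex.finrank_real_complex] at hpolar
  have hsubst : ∀ x : ℝ, (2 * x ^ ((2 : ℝ) - 1)) • F (x ^ (2 : ℝ)) =
      (2 : ℝ) • (x ^ (2 - 1) • F (x ^ 2)) := fun x => by
    rw [mul_smul]; norm_num
  simp only [Complex.normSq_eq_norm_sq]
  rw [hpolar, ← integral_comp_rpow_Ioi_of_pos (g := F) (p := 2) two_pos]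
  simp only [hsubst]
  rw [integral_smul, smul_comm]
  congr 1
  rw [← Nat.cast_smul_eq_nsmul ℝ]
  norm_num

end RadialIntegral

/-! ### Weak derivatives on the half line -/

/-- Test functions on `(0, ∞)`: smooth, with compact support contained in `(0, ∞)`. -/
def IsHalfLineTest (h : ℝ → ℝ) : Prop :=
  ContDiff ℝ ∞ h ∧ HasCompactSupport h ∧ tsupport h ⊆ Set.Ioi 0

/-- Integrability on `(0, b]` for every `b`; it gives sense to the primitives from `0` that
represent weak solutions on the half line. -/
def IntegrableNearZero (f : ℝ → ℂ) : Prop := ∀ b : ℝ, IntegrableOn f (Set.Ioc 0 b)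

section HalfLine

variable {f : ℝ → ℂ} {h k : ℝ → ℝ}

lemma isHalfLineTest_of_notMem_Icc {a b : ℝ} (hh : ContDiff ℝ ∞ h) (ha : 0 < a)
    (hab : ∀ s ∉ Set.Icc a b, h s = 0) : IsHalfLineTest h :=
  have hsub : tsupport h ⊆ Set.Icc a b :=
    closure_minimal (fun s hs => by_contra fun hc => hs (hab s hc)) isClosed_Icc
  ⟨hh, HasCompactSupport.intro isCompact_Icc hab, fun _ hs => ha.trans_le (hsub hs).1⟩

lemma IsHalfLineTest.exists_eq_zero_of_notMem_Icc (hh : IsHalfLineTest h) :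
    ∃ a > 0, ∃ b, ∀ s ∉ Set.Icc a b, h s = 0 := by
  obtain ⟨-, hcompact, hpos⟩ := hh
  have hsub : insert 1 (tsupport h) ⊆ Set.Ioi 0 := Set.insert_subset (Set.mem_Ioi.2 one_pos) hpos
  obtain ⟨a, ha, hmin⟩ := (hcompact.isCompact.insert 1).exists_isLeast (Set.insert_nonempty _ _)
  obtain ⟨b, -, hmax⟩ :=
    (hcompact.isCompact.insert 1).exists_isGreatest (Set.insert_nonempty _ _)
  exact ⟨a, hsub ha, b, fun s hs => image_eq_zero_of_notMem_tsupport fun hs' =>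
    hs ⟨hmin (Set.mem_insert_of_mem _ hs'), hmax (Set.mem_insert_of_mem _ hs')⟩⟩

lemma IsHalfLineTest.eq_zero (hh : IsHalfLineTest h) {s : ℝ} (hs : s ∉ Set.Ioi 0) : h s = 0 :=
  image_eq_zero_of_notMem_tsupport fun hc => hs (hh.2.2 hc)

lemma IsHalfLineTest.deriv (hh : IsHalfLineTest h) : IsHalfLineTest (deriv h) :=
  ⟨(contDiff_infty_iff_deriv.1 hh.1).2, hh.2.1.deriv, tsupport_deriv_subset.trans hh.2.2⟩

lemma IsHalfLineTest.hasDerivAt (hh : IsHalfLineTest h) (s : ℝ) :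
    HasDerivAt h (_root_.deriv h s) s :=
  (hh.1.differentiable (by simp) s).hasDerivAt

lemma IsHalfLineTest.hasDerivAt_ofReal (hh : IsHalfLineTest h) (s : ℝ) :
    HasDerivAt (fun s => (h s : ℂ)) ((_root_.deriv h s : ℝ) : ℂ) s :=
  (hh.hasDerivAt s).ofReal_comp

lemma IsHalfLineTest.contDiff_ofReal (hh : IsHalfLineTest h) :
    ContDiff ℝ ∞ fun s => (h s : ℂ) :=
  Complex.ofRealCLM.contDiff.comp hh.1

lemma IsHalfLineTest.integrable (hh : IsHalfLineTest h) : Integrable h :=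
  hh.1.continuous.integrable_of_hasCompactSupport hh.2.1

lemma IntegrableNearZero.locallyIntegrableOn (hf : IntegrableNearZero f) :
    LocallyIntegrableOn f (Set.Ioi 0) := fun x _ =>
  ⟨Set.Ioc 0 (x + 1), by
    rw [mem_nhdsWithin_iff_exists_mem_nhds_inter]
    exact ⟨Set.Iic (x + 1), Iic_mem_nhds (by linarith), fun y hy => ⟨hy.2, hy.1⟩⟩, hf _⟩

lemma IsHalfLineTest.integrable_mul (hh : IsHalfLineTest h) (hf : IntegrableNearZero f) :
    Integrable fun s => (h s : ℂ) * f s := by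
  have hon := hf.locallyIntegrableOn.integrableOn_compact_subset hh.2.2 hh.2.1.isCompact
  rw [← integrableOn_iff_integrable_of_support_subset (s := tsupport h)]
  · exact hon.continuousOn_mul
      (Complex.continuous_ofReal.comp hh.1.continuous).continuousOn hh.2.1.isCompact
  · intro s hs
    by_contra hc
    exact hs (by simp [image_eq_zero_of_notMem_tsupport hc])

lemma integrableNearZero_of_continuousOn (hf : ContinuousOn f (Set.Ici 0)) :
    IntegrableNearZero f := fun b =>
  ((hf.mono fun _ hs => hs.1).integrableOn_compact (isCompact_Icc (a := 0) (b := b))).mono_set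
    Set.Ioc_subset_Icc_self

lemma IsHalfLineTest.exists_deriv_eq (hk : IsHalfLineTest k) (hk₀ : ∫ s, k s = 0) :
    ∃ h, IsHalfLineTest h ∧ _root_.deriv h = k := by
  obtain ⟨a, ha, b, hab⟩ := hk.exists_eq_zero_of_notMem_Icc
  have hderiv : ∀ s, HasDerivAt (fun s => ∫ t in (0 : ℝ)..s, k t) (k s) s := fun s =>
    (hk.1.continuous.integral_hasStrictDerivAt 0 s).hasDerivAt
  have hderiv_eq : _root_.deriv (fun s => ∫ t in (0 : ℝ)..s, k t) = k :=
    funext fun s => (hderiv s).deriv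
  have hsmooth : ContDiff ℝ ∞ fun s => ∫ t in (0 : ℝ)..s, k t :=
    contDiff_infty_iff_deriv.2 ⟨fun s => (hderiv s).differentiableAt, hderiv_eq.symm ▸ hk.1⟩
  refine ⟨_, isHalfLineTest_of_notMem_Icc (b := b) hsmooth ha fun s hs => ?_, hderiv_eq⟩
  rcases lt_or_ge s a with hsa | has
  · refine intervalIntegral.integral_zero_ae (Eventually.of_forall fun t ht => hab t fun hc => ?_)
    exact (max_lt ha hsa).not_ge (hc.1.trans ht.2)
  · have hbs : b < s := not_le.1 fun hc => hs ⟨has, hc⟩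
    rw [intervalIntegral.integral_of_le (ha.le.trans has),
      setIntegral_eq_integral_of_forall_compl_eq_zero, hk₀]
    exact fun t ht => hab t fun hc => ht ⟨ha.trans_le hc.1, hc.2.trans hbs.le⟩

lemma exists_isHalfLineTest_integral_eq_one : ∃ χ, IsHalfLineTest χ ∧ ∫ s, χ s = 1 := by
  let bump : ContDiffBump (1 : ℝ) := ⟨1 / 4, 1 / 2, by norm_num, by norm_num⟩
  refine ⟨bump.normed volume, ⟨bump.contDiff_normed, bump.hasCompactSupport_normed, ?_⟩,
    bump.integral_normed⟩
  rw [bump.tsupport_normed_eq, Real.closedBall_eq_Icc]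
  exact fun s hs => lt_of_lt_of_le (by norm_num [bump]) hs.1

lemma IsHalfLineTest.exists_deriv_eq_sub {g χ : ℝ → ℝ} (hg : IsHalfLineTest g)
    (hχ : IsHalfLineTest χ) (hχ₁ : ∫ s, χ s = 1) :
    ∃ k, IsHalfLineTest k ∧ _root_.deriv k = fun s => g s - (∫ s, g s) * χ s := by
  refine IsHalfLineTest.exists_deriv_eq ⟨hg.1.sub (contDiff_const.mul hχ.1),
    hg.2.1.sub hχ.2.1.mul_left, fun s hs => ?_⟩ ?_
  · rcases tsupport_sub g (fun s => (∫ s, g s) * χ s) hs with hs | hs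
    · exact hg.2.2 hs
    · exact hχ.2.2 (tsupport_mul_subset_right hs)
  · rw [integral_sub hg.integrable (hχ.integrable.const_mul _), integral_const_mul, hχ₁, mul_one,
      sub_self]

lemma ae_eq_const_of_integral_deriv_mul (hf : IntegrableNearZero f)
    (hweak : ∀ k, IsHalfLineTest k → ∫ s, ((deriv k s : ℝ) : ℂ) * f s = 0) :
    ∃ c : ℂ, ∀ᵐ s, s ∈ Set.Ioi (0 : ℝ) → f s = c := by
  obtain ⟨χ, hχ, hχ₁⟩ := exists_isHalfLineTest_integral_eq_one
  set c := ∫ s, (χ s : ℂ) * f s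
  have hconst : IntegrableNearZero fun _ => c := integrableNearZero_of_continuousOn (by fun_prop)
  refine ⟨c, ?_⟩
  suffices hzero : ∀ g : ℝ → ℝ, ContDiff ℝ ∞ g → HasCompactSupport g →
      tsupport g ⊆ Set.Ioi 0 → ∫ s, g s • (f s - c) = 0 by
    filter_upwards [isOpen_Ioi.ae_eq_zero_of_integral_contDiff_smul_eq_zero
      (hf.locallyIntegrableOn.sub hconst.locallyIntegrableOn) hzero] with s hs hs₀
      using sub_eq_zero.1 (hs hs₀)
  intro g hg hgc hgs
  have hgt : IsHalfLineTest g := ⟨hg, hgc, hgs⟩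
  obtain ⟨k, hk, hkg⟩ := hgt.exists_deriv_eq_sub hχ hχ₁
  calc ∫ s, g s • (f s - c)
      = ∫ s, ((g s : ℂ) * f s - (g s : ℂ) * c) := by simp only [Complex.real_smul, mul_sub]
    _ = ∫ s, ((g s : ℂ) * f s - ((∫ s, g s : ℝ) : ℂ) * ((χ s : ℂ) * f s)) := by
        rw [integral_sub (hgt.integrable_mul hf) (hgt.integrable_mul hconst),
          integral_sub (hgt.integrable_mul hf) ((hχ.integrable_mul hf).const_mul _),
          integral_mul_const, integral_const_mul, integral_complex_ofReal]
    _ = ∫ s, ((deriv k s : ℝ) : ℂ) * f s := by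
        simp only [hkg]; push_cast; simp only [sub_mul, mul_assoc]
    _ = 0 := hweak k hk

lemma setIntegral_Ioc_mul_setIntegral_Ioc {g : ℝ → ℂ} {a b : ℝ}
    (hg : IntegrableOn g (Set.Ioc a b)) (hf : IntegrableOn f (Set.Ioc a b)) :
    ∫ s in Set.Ioc a b, g s * ∫ t in Set.Ioc a s, f t =
      ∫ t in Set.Ioc a b, (∫ s in Set.Ioc t b, g s) * f t := by
  have htriangle : MeasurableSet {p : ℝ × ℝ | p.2 ≤ p.1} :=
    measurableSet_le measurable_snd measurable_fst
  have hint := (hg.mul_prod hf).indicator htriangle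
  calc ∫ s in Set.Ioc a b, g s * ∫ t in Set.Ioc a s, f t
      = ∫ s in Set.Ioc a b, ∫ t in Set.Ioc a b, (Set.Iic s).indicator (fun t => g s * f t) t := by
        refine setIntegral_congr_fun measurableSet_Ioc fun s hs => ?_
        rw [setIntegral_indicator measurableSet_Iic, Set.Ioc_inter_Iic, inf_eq_right.2 hs.2,
          integral_const_mul]
    _ = ∫ t in Set.Ioc a b, ∫ s in Set.Ioc a b, (Set.Ici t).indicator (fun s => g s * f t) s :=
        integral_integral_swap hint
    _ = ∫ t in Set.Ioc a b, (∫ s in Set.Ioc t b, g s) * f t := by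
        refine setIntegral_congr_fun measurableSet_Ioc fun t ht => ?_
        have hinter : Set.Ioc a b ∩ Set.Ici t = Set.Icc t b :=
          Set.ext fun s => ⟨fun hs => ⟨hs.2, hs.1.2⟩, fun hs => ⟨⟨ht.1.trans_le hs.1, hs.2⟩, hs.1⟩⟩
        rw [setIntegral_indicator measurableSet_Ici, hinter, integral_mul_const,
          integral_Icc_eq_integral_Ioc]

lemma IsHalfLineTest.integral_deriv_mul_primitive (hh : IsHalfLineTest h)
    (hf : IntegrableNearZero f) :
    ∫ s, ((_root_.deriv h s : ℝ) : ℂ) * ∫ t in (0 : ℝ)..s, f t = -∫ s, (h s : ℂ) * f s := by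
  obtain ⟨a, ha, b₀, hab⟩ := hh.exists_eq_zero_of_notMem_Icc
  set b := b₀ + 1
  have hb : b ∉ Set.Icc a b₀ := fun hc => by linarith [hc.2]
  have hsupp : ∀ {k : ℝ → ℝ}, tsupport k ⊆ Set.Icc a b₀ → ∀ s ∉ Set.Ioc 0 b, k s = 0 :=
    fun hk s hs => image_eq_zero_of_notMem_tsupport fun hc =>
      hs ⟨ha.trans_le (hk hc).1, (hk hc).2.trans (by linarith)⟩
  have htsupp : tsupport h ⊆ Set.Icc a b₀ :=
    closure_minimal (fun s hs => by_contra fun hc => hs (hab s hc)) isClosed_Icc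
  have hftc : ∀ t ∈ Set.Ioc 0 b,
      ∫ s in Set.Ioc t b, ((_root_.deriv h s : ℝ) : ℂ) = -h t := fun t ht => by
    rw [← intervalIntegral.integral_of_le ht.2, intervalIntegral.integral_ofReal,
      intervalIntegral.integral_deriv_eq_sub (fun s _ => (hh.hasDerivAt s).differentiableAt)
        (hh.deriv.1.continuous.intervalIntegrable _ _), hab b hb, zero_sub, Complex.ofReal_neg]
  calc ∫ s, ((_root_.deriv h s : ℝ) : ℂ) * ∫ t in (0 : ℝ)..s, f t
      = ∫ s in Set.Ioc 0 b, ((_root_.deriv h s : ℝ) : ℂ) * ∫ t in (0 : ℝ)..s, f t :=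
        (setIntegral_eq_integral_of_forall_compl_eq_zero fun s hs => by
          rw [hsupp (tsupport_deriv_subset.trans htsupp) s hs, Complex.ofReal_zero, zero_mul]).symm
    _ = ∫ s in Set.Ioc 0 b, ((_root_.deriv h s : ℝ) : ℂ) * ∫ t in Set.Ioc 0 s, f t :=
        setIntegral_congr_fun measurableSet_Ioc fun s hs => by
          simp only [intervalIntegral.integral_of_le hs.1.le]
    _ = ∫ t in Set.Ioc 0 b, (∫ s in Set.Ioc t b, ((_root_.deriv h s : ℝ) : ℂ)) * f t :=
        setIntegral_Ioc_mul_setIntegral_Ioc hh.deriv.integrable.ofReal.integrableOn (hf b)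
    _ = ∫ t in Set.Ioc 0 b, -((h t : ℂ) * f t) :=
        setIntegral_congr_fun measurableSet_Ioc fun t ht => by simp only [hftc t ht, neg_mul]
    _ = -∫ s, (h s : ℂ) * f s := by
        rw [integral_neg, setIntegral_eq_integral_of_forall_compl_eq_zero fun s hs => by
          rw [hsupp htsupp s hs, Complex.ofReal_zero, zero_mul]]

lemma ae_eq_affine_of_integral_deriv_deriv_mul (hf : IntegrableNearZero f)
    (hweak : ∀ k, IsHalfLineTest k → ∫ s, ((deriv (deriv k) s : ℝ) : ℂ) * f s = 0) :
    ∃ c₀ c₁ : ℂ, ∀ᵐ s, s ∈ Set.Ioi (0 : ℝ) → f s = c₀ + c₁ * s := by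
  obtain ⟨χ, hχ, hχ₁⟩ := exists_isHalfLineTest_integral_eq_one
  set β := ∫ s, ((deriv χ s : ℝ) : ℂ) * f s
  have hid : IntegrableNearZero fun s : ℝ => (s : ℂ) :=
    integrableNearZero_of_continuousOn (by fun_prop)
  have hsum : IntegrableNearZero fun s : ℝ => f s + β * s := fun b =>
    (hf b).add ((hid b).const_mul β)
  have hmoment : ∀ k, IsHalfLineTest k → ∫ s : ℝ, ((deriv k s : ℝ) : ℂ) * s = -∫ s, (k s : ℂ) :=
    fun k hk => by
      simpa using hk.integral_deriv_mul_primitive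
        (integrableNearZero_of_continuousOn (f := fun _ => 1) (by fun_prop))
  have hconst : ∀ k, IsHalfLineTest k →
      ∫ s, ((deriv k s : ℝ) : ℂ) * (f s + β * s) = 0 := fun k hk => by
    obtain ⟨m, hm, hmk⟩ := hk.exists_deriv_eq_sub hχ hχ₁
    have hm₂ : ∀ s, ((deriv (deriv m) s : ℝ) : ℂ) * f s = ((deriv k s : ℝ) : ℂ) * f s -
        (∫ s, (k s : ℂ)) * (((deriv χ s : ℝ) : ℂ) * f s) := fun s => by
      have hderiv : HasDerivAt (deriv m) (deriv k s - (∫ s, k s) * deriv χ s) s :=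
        hmk ▸ (hk.hasDerivAt s).sub ((hχ.hasDerivAt s).const_mul _)
      rw [hderiv.deriv, integral_complex_ofReal]
      push_cast; ring
    have hzero := hweak m hm
    simp only [hm₂] at hzero
    rw [integral_sub (hk.deriv.integrable_mul hf) ((hχ.deriv.integrable_mul hf).const_mul _),
      integral_const_mul] at hzero
    simp only [mul_add, mul_left_comm _ β]
    rw [integral_add (hk.deriv.integrable_mul hf) ((hk.deriv.integrable_mul hid).const_mul _),
      integral_const_mul, hmoment k hk]
    linear_combination hzero
  obtain ⟨c, hc⟩ := ae_eq_const_of_integral_deriv_mul hsum hconst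
  refine ⟨c, -β, ?_⟩
  filter_upwards [hc] with s hs hs₀
  linear_combination hs hs₀

lemma IntegrableNearZero.intervalIntegrable (hf : IntegrableNearZero f) {s : ℝ} (hs : 0 ≤ s) :
    IntervalIntegrable f volume 0 s :=
  (intervalIntegrable_iff_integrableOn_Ioc_of_le hs).2 (hf s)

lemma IntegrableNearZero.congr {g : ℝ → ℂ} (hf : IntegrableNearZero f)
    (hfg : ∀ᵐ s, s ∈ Set.Ioi (0 : ℝ) → f s = g s) : IntegrableNearZero g := fun b =>
  (hf b).congr_fun_ae <| (ae_restrict_iff' measurableSet_Ioc).2 <| by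
    filter_upwards [hfg] with s hs hsb using hs hsb.1

lemma IntegrableNearZero.hasDerivAt_primitive {g : ℝ → ℂ} (hf : IntegrableNearZero f)
    (hfg : ∀ᵐ s, s ∈ Set.Ioi (0 : ℝ) → f s = g s) {s : ℝ} (hs : 0 < s) (hg : ContinuousAt g s) :
    HasDerivAt (fun s => ∫ t in (0 : ℝ)..s, f t) (g s) s := by
  have hgi := hf.congr hfg
  refine (intervalIntegral.integral_hasDerivAt_right (hgi.intervalIntegrable hs.le)
    ⟨Set.Ioc 0 (s + 1), Ioc_mem_nhds hs (by linarith), (hgi (s + 1)).1⟩ hg).congr_of_eventuallyEq ?_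
  filter_upwards [Ioi_mem_nhds hs] with x hx
  refine intervalIntegral.integral_congr_ae ?_
  filter_upwards [hfg] with t ht htx
  rw [Set.uIoc_of_le (le_of_lt hx)] at htx
  exact ht htx.1

lemma IntegrableNearZero.continuousOn_primitive (hf : IntegrableNearZero f) :
    ContinuousOn (fun s => ∫ t in (0 : ℝ)..s, f t) (Set.Ici 0) := by
  intro s hs
  have hs₀ : (0 : ℝ) ≤ s := hs
  have hcont := intervalIntegral.continuousOn_primitive_interval' (a := 0) (b₁ := 0) (b₂ := s + 1)
    (hf.intervalIntegrable (by linarith)) (by simp)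
  rw [Set.uIcc_of_le (by linarith)] at hcont
  refine (hcont s ⟨hs₀, by linarith⟩).mono_of_mem_nhdsWithin ?_
  rw [mem_nhdsWithin_iff_exists_mem_nhds_inter]
  exact ⟨Set.Iic (s + 1), Iic_mem_nhds (by linarith), fun y hy => ⟨hy.2, hy.1⟩⟩

lemma IntegrableNearZero.ofReal_mul (hf : IntegrableNearZero f) :
    IntegrableNearZero fun s => s * f s := fun b => by
  refine (hf b).bdd_mul (c := b) (by fun_prop) ?_
  filter_upwards [ae_restrict_mem measurableSet_Ioc] with s hs
  rw [Complex.norm_real, Real.norm_of_nonneg hs.1.le]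
  exact hs.2

end HalfLine

/-! ### The radial equation of a mode -/

lemma planarLin_neg_I (z : ℂ) : planarLin (-Complex.I) z = starRingEnd ℂ z := by
  apply Complex.ext <;> simp [planarLin]

-- `planarLin κ z ^ |ℓ|` is `(r e^{-iθ})^ℓ` for `ℓ ≥ 0` and `(r e^{iθ})^{-ℓ}` for `ℓ < 0`.
lemma exists_planarLin_rotate (ℓ : ℤ) :
    ∃ κ : ℂ, κ ^ 2 = -1 ∧ (∀ z, ‖planarLin κ z‖ = ‖z‖) ∧ ∀ (α : ℝ) (z : ℂ),
      Complex.exp (ℓ * α * Complex.I) * planarLin κ (Complex.exp (α * Complex.I) * z) ^ ℓ.natAbs =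
        planarLin κ z ^ ℓ.natAbs := by
  rcases Int.natAbs_eq ℓ with hℓ | hℓ
  · have hcast : (ℓ : ℂ) = (ℓ.natAbs : ℂ) := by rw [← Int.cast_natCast]; exact congrArg _ hℓ
    refine ⟨-Complex.I, by simp, fun z => by rw [planarLin_neg_I, Complex.norm_conj], fun α z => ?_⟩
    simp only [planarLin_neg_I, map_mul, mul_pow, ← Complex.exp_conj, Complex.conj_ofReal,
      Complex.conj_I, ← Complex.exp_nat_mul, ← mul_assoc, ← Complex.exp_add, hcast]
    simp
  · have hcast : (ℓ : ℂ) = -(ℓ.natAbs : ℂ) := by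
      rw [← Int.cast_natCast, ← Int.cast_neg]; exact congrArg _ hℓ
    refine ⟨Complex.I, by simp, fun z => by rw [planarLin_I], fun α z => ?_⟩
    simp only [planarLin_I, mul_pow, ← Complex.exp_nat_mul, ← mul_assoc, ← Complex.exp_add, hcast]
    simp

lemma exists_radial_of_hasAngularMode {ℓ : ℤ} {κ : ℂ} {k : ℕ} {ψ : ℂ → ℂ}
    (hψ : LocallyIntegrable ψ) (hm : HasAngularMode ℓ ψ)
    (hκ : ∀ (α : ℝ) (z : ℂ), Complex.exp (ℓ * α * Complex.I) *
      planarLin κ (Complex.exp (α * Complex.I) * z) ^ k = planarLin κ z ^ k) :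
    ∃ g : ℝ → ℂ, ∀ᵐ z, ψ z * planarLin κ z ^ k = g (Complex.normSq z) := by
  have hmeas := hψ.aestronglyMeasurable
  have hae := hmeas.ae_eq_mk
  set ψ' := hmeas.mk ψ
  have hψ' : StronglyMeasurable fun z => ψ' z * planarLin κ z ^ k :=
    hmeas.stronglyMeasurable_mk.mul ((continuous_planarLin κ).pow _).stronglyMeasurable
  obtain ⟨g, hg⟩ := exists_radial_of_ae_rotate hψ' fun α => by
    have hrot : ∀ z, rotation (Circle.exp α) z = Complex.exp (α * Complex.I) * z := fun z => by
      rw [rotation_apply, Circle.coe_exp]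
    filter_upwards [(rotation (Circle.exp α)).measurePreserving.quasiMeasurePreserving.ae hae, hae,
      ae_rotate_of_hasAngularMode hψ hm α] with z hzrot hz hmode
    rw [hrot] at hzrot
    rw [← hzrot, ← hz, hmode, ← hκ α z]
    ring
  refine ⟨g, ?_⟩
  filter_upwards [hg, hae] with z hgz hz
  rw [hz, hgz]

/-- The step function equal to `a` on `s ≤ R` and to `b` on `s > R`: the potential minus the energy,
in the variable `s = r²`. -/
def step (R : ℝ) (a b s : ℝ) : ℝ := if s ≤ R then a else b

/-- `g` solves `4 s g'' = 4 (k - 1) g' + q g` on `(0, ∞)` in the sense of distributions. When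
`g (r²) = r ^ k u(r)`, this says that `u(r) e^{±ikθ}` is a weak solution of `-Δ ψ + q ψ = 0` away
from the origin. -/
def IsWeakRadialSol (k : ℕ) (q : ℝ → ℝ) (g : ℝ → ℂ) : Prop :=
  ∀ h, IsHalfLineTest h →
    ∫ s, g s * ((-(4 * (s * deriv (deriv h) s + (k + 1) * deriv h s)) + q s * h s : ℝ) : ℂ) = 0

section RadialProfile

variable {κ : ℂ} {k : ℕ} {ψ : ℂ → ℂ} {g : ℝ → ℂ}

lemma ae_norm_sq_eq_radial (hκ : ∀ z, ‖planarLin κ z‖ = ‖z‖)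
    (hg : ∀ᵐ z, ψ z * planarLin κ z ^ k = g (Complex.normSq z)) :
    ∀ᵐ z : ℂ, ‖ψ z‖ ^ 2 = ‖g (Complex.normSq z)‖ ^ 2 * (Complex.normSq z ^ k)⁻¹ := by
  have hae_ne : ∀ᵐ z : ℂ, z ≠ 0 := (Set.countable_singleton (0 : ℂ)).ae_notMem volume
  filter_upwards [hg, hae_ne] with z hz hz₀
  have hpow : ‖z‖ ^ k ≠ 0 := pow_ne_zero _ (norm_ne_zero_iff.2 hz₀)
  rw [← hz, norm_mul, norm_pow, hκ, Complex.normSq_eq_norm_sq, pow_right_comm]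
  field_simp

lemma integrableNearZero_of_radial (hψ : LocallyIntegrable ψ)
    (hg : ∀ᵐ z, ψ z * planarLin κ z ^ k = g (Complex.normSq z)) :
    IntegrableNearZero g := fun b => by
  have hball : {z : ℂ | Complex.normSq z ≤ b} ⊆ Metric.closedBall 0 √b := fun z hz => by
    rw [mem_closedBall_zero_iff]
    exact Real.le_sqrt_of_sq_le (Complex.normSq_eq_norm_sq z ▸ hz)
  have hmeas : MeasurableSet {z : ℂ | Complex.normSq z ≤ b} :=
    (isClosed_le Complex.continuous_normSq continuous_const).measurableSet
  have hint : IntegrableOn (fun z => ψ z * planarLin κ z ^ k) (Metric.closedBall 0 √b) :=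
    (hψ.integrableOn_isCompact (isCompact_closedBall 0 _)).mul_continuousOn
      ((continuous_planarLin κ).pow _).continuousOn (isCompact_closedBall 0 _)
  have hcomp : Integrable fun z : ℂ => (Set.Iic b).indicator g (Complex.normSq z) := by
    refine ((hint.mono_set hball).integrable_indicator hmeas).congr ?_
    filter_upwards [hg] with z hz
    simp only [Set.indicator, Set.mem_ofPred_eq, Set.mem_Iic, hz]
  exact (((integrable_comp_normSq_iff _).1 hcomp).mono_set Set.Ioc_subset_Ioi_self).congr_fun
    (fun s hs => Set.indicator_of_mem (Set.mem_Iic.2 hs.2) g) measurableSet_Ioc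

lemma not_radial_ae_eq_zero (hψ : MemLp ψ 2 volume) (hne : ¬ ψ =ᵐ[volume] 0)
    (hκ : ∀ z, ‖planarLin κ z‖ = ‖z‖)
    (hg : ∀ᵐ z, ψ z * planarLin κ z ^ k = g (Complex.normSq z)) :
    ¬ ∀ᵐ s, s ∈ Set.Ioi (0 : ℝ) → g s = 0 := fun hg₀ => hne <| by
  have hzero : ∫ z, ‖ψ z‖ ^ 2 = 0 := by
    rw [integral_congr_ae (ae_norm_sq_eq_radial hκ hg),
      integral_comp_normSq fun s => ‖g s‖ ^ 2 * (s ^ k)⁻¹, setIntegral_eq_zero_of_ae_eq_zero,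
      smul_zero]
    filter_upwards [hg₀] with s hs hs₀
    rw [hs hs₀, norm_zero, zero_pow two_ne_zero, zero_mul]
  filter_upwards [(integral_eq_zero_iff_of_nonneg (fun z => by positivity)
    ((memLp_two_iff_integrable_sq_norm hψ.1).1 hψ)).1 hzero] with z hz
  simpa using hz

lemma isTestFunction_modeFun {h : ℝ → ℝ} (hh : IsHalfLineTest h) (κ : ℂ) (k : ℕ) :
    IsTestFunction (modeFun κ k fun s => (h s : ℂ)) := by
  obtain ⟨a, -, b, hab⟩ := hh.exists_eq_zero_of_notMem_Icc
  refine ⟨(hh.contDiff_ofReal.comp contDiff_normSq).mul ((contDiff_planarLin κ).pow _),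
    HasCompactSupport.intro (isCompact_closedBall (0 : ℂ) √b) fun z hz => ?_⟩
  have hzero : h (Complex.normSq z) = 0 := hab _ fun hc => hz <| by
    rw [mem_closedBall_zero_iff]
    exact Real.le_sqrt_of_sq_le (Complex.normSq_eq_norm_sq z ▸ hc.2)
  rw [modeFun, hzero, Complex.ofReal_zero, zero_mul]

lemma isWeakRadialSol_of_isSolution {ρ A E : ℝ} (hρ : 0 ≤ ρ) (hκ : κ ^ 2 = -1)
    (hs : IsSolution (circularWell ρ A) (E : ℂ) ψ)
    (hg : ∀ᵐ z, ψ z * planarLin κ z ^ k = g (Complex.normSq z)) :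
    IsWeakRadialSol k (step (ρ ^ 2) (-A - E) (-E)) g := fun h hh => by
  set K : ℝ → ℝ := fun s => -(4 * (s * deriv (deriv h) s + (k + 1) * deriv h s)) +
    step (ρ ^ 2) (-A - E) (-E) s * h s with hK
  have hweak := hs.2 _ (isTestFunction_modeFun hh κ k)
  have hradial : ∀ᵐ z, ψ z * (-(Laplacian.laplacian (modeFun κ k fun s => (h s : ℂ)) z) +
      ((circularWell ρ A z : ℂ) - E) * modeFun κ k (fun s => (h s : ℂ)) z) =
      (fun s => g s * (K s : ℂ)) (Complex.normSq z) := by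
    filter_upwards [hg] with z hz
    rw [laplacian_modeFun hκ k (contDiff_infty.1 hh.contDiff_ofReal 2)
      hh.hasDerivAt_ofReal hh.deriv.hasDerivAt_ofReal]
    simp only [← hz, circularWell, hK, modeFun, step, ← normSq_le_sq_iff hρ z]
    split_ifs <;> push_cast <;> ring
  rw [integral_congr_ae hradial, integral_comp_normSq fun s => g s * (K s : ℂ)] at hweak
  have hvol : volume.real (Metric.ball (0 : ℂ) 1) ≠ 0 :=
    (ENNReal.toReal_pos (Metric.measure_ball_pos _ _ one_pos).ne' measure_ball_lt_top.ne).ne'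
  rw [← (smul_eq_zero.1 hweak).resolve_left hvol, setIntegral_eq_integral_of_forall_compl_eq_zero]
  intro s hs
  simp only [hK, hh.eq_zero hs, hh.deriv.eq_zero hs, hh.deriv.deriv.eq_zero hs]
  simp

end RadialProfile

lemma exists_radial_profile {ρ A E : ℝ} {ℓ : ℤ} (hρ : 0 ≤ ρ) {ψ : ℂ → ℂ}
    (hψ : MemLp ψ 2 volume) (hne : ¬ ψ =ᵐ[volume] 0) (hm : HasAngularMode ℓ ψ)
    (hs : IsSolution (circularWell ρ A) (E : ℂ) ψ) :
    ∃ g : ℝ → ℂ, IntegrableOn (fun s => ‖g s‖ ^ 2 * (s ^ ℓ.natAbs)⁻¹) (Set.Ioi 0) ∧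
      IntegrableNearZero g ∧ (¬ ∀ᵐ s, s ∈ Set.Ioi (0 : ℝ) → g s = 0) ∧
      IsWeakRadialSol ℓ.natAbs (step (ρ ^ 2) (-A - E) (-E)) g := by
  have hloc : LocallyIntegrable ψ := hψ.locallyIntegrable (by norm_num)
  obtain ⟨κ, hκ, hnorm, hrot⟩ := exists_planarLin_rotate ℓ
  obtain ⟨g, hg⟩ := exists_radial_of_hasAngularMode hloc hm hrot
  have hint := (memLp_two_iff_integrable_sq_norm hψ.1).1 hψ
  exact ⟨g, (integrable_comp_normSq_iff fun s => ‖g s‖ ^ 2 * (s ^ ℓ.natAbs)⁻¹).1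
      (hint.congr (ae_norm_sq_eq_radial hnorm hg)), integrableNearZero_of_radial hloc hg,
    not_radial_ae_eq_zero hψ hne hnorm hg, isWeakRadialSol_of_isSolution hρ hκ hs hg⟩

/-! ### Regularity of weak solutions of the radial equation -/

lemma continuousAt_step {R s : ℝ} (a b : ℝ) (hs : s ≠ R) : ContinuousAt (step R a b) s := by
  rcases hs.lt_or_gt with h | h
  · refine continuousAt_const.congr (f := fun _ => a) ?_
    filter_upwards [Iio_mem_nhds h] with x hx using (if_pos (le_of_lt hx)).symm
  · refine continuousAt_const.congr (f := fun _ => b) ?_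
    filter_upwards [Ioi_mem_nhds h] with x hx using (if_neg (not_le.2 hx)).symm

lemma IntegrableNearZero.step_mul {f : ℝ → ℂ} (hf : IntegrableNearZero f) (R a b : ℝ) :
    IntegrableNearZero fun s => (step R a b s : ℂ) * f s := fun c => by
  refine (hf c).bdd_mul (c := |a| + |b|) ?_ (Eventually.of_forall fun s => ?_)
  · exact (Complex.measurable_ofReal.comp (Measurable.ite measurableSet_Iic measurable_const
      measurable_const)).aestronglyMeasurable
  · rw [Complex.norm_real, Real.norm_eq_abs, step]
    split_ifs
    · linarith [abs_nonneg b]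
    · linarith [abs_nonneg a]

section Regularity

variable {k : ℕ} {q : ℝ → ℝ} {g P Q : ℝ → ℂ}

lemma IsWeakRadialSol.integral_deriv_deriv_mul_eq_zero (hw : IsWeakRadialSol k q g)
    (hg : IntegrableNearZero g) (hqg : IntegrableNearZero fun s => (q s : ℂ) * g s)
    (hPi : IntegrableNearZero P) (hQi : IntegrableNearZero Q)
    (hP : ∀ h, IsHalfLineTest h →
      ∫ s, ((deriv h s : ℝ) : ℂ) * P s = -∫ s, (h s : ℂ) * ((q s : ℂ) * g s))
    (hQ : ∀ h, IsHalfLineTest h →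
      ∫ s, ((deriv h s : ℝ) : ℂ) * Q s = -∫ s, (h s : ℂ) * (4 * (k + 1) * g s + P s))
    {h : ℝ → ℝ} (hh : IsHalfLineTest h) :
    ∫ s, ((deriv (deriv h) s : ℝ) : ℂ) * (Q s - 4 * (s * g s)) = 0 := by
  have hqgh := hh.integrable_mul hqg
  have hgh := hh.deriv.integrable_mul fun c => (hg c).const_mul (4 * (k + 1) : ℂ)
  have hPh := hh.deriv.integrable_mul hPi
  have hsgh := hh.deriv.deriv.integrable_mul fun c => (hg.ofReal_mul c).const_mul 4
  have hQh := hh.deriv.deriv.integrable_mul hQi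
  have hlower : Integrable fun s => (h s : ℂ) * ((q s : ℂ) * g s) -
      ((deriv h s : ℝ) : ℂ) * (4 * (k + 1) * g s) := hqgh.sub hgh
  have hterms : ∀ s, g s * ((-(4 * (s * deriv (deriv h) s + (k + 1) * deriv h s)) +
      q s * h s : ℝ) : ℂ) = (h s : ℂ) * (q s * g s) - ((deriv h s : ℝ) : ℂ) *
        (4 * (k + 1) * g s) - ((deriv (deriv h) s : ℝ) : ℂ) * (4 * (s * g s)) := fun s => by
    push_cast; ring
  have hweak := hw h hh
  simp only [hterms] at hweak
  rw [integral_sub hlower hsgh, integral_sub hqgh hgh] at hweak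
  have hQderiv := hQ _ hh.deriv
  simp only [mul_add] at hQderiv
  rw [integral_add (by simpa only [mul_add] using hgh) hPh] at hQderiv
  simp only [mul_sub]
  rw [integral_sub hQh hsgh]
  simp only [mul_add] at hweak
  linear_combination hweak - hP h hh + hQderiv

lemma IsWeakRadialSol.exists_integral_eq (hw : IsWeakRadialSol k q g)
    (hg : IntegrableNearZero g) (hqg : IntegrableNearZero fun s => (q s : ℂ) * g s)
    (hP : P = fun s => ∫ t in (0 : ℝ)..s, (q t : ℂ) * g t)
    (hQ : Q = fun s => ∫ t in (0 : ℝ)..s, (4 * (k + 1) * g t + P t)) :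
    ∃ c₀ c₁ : ℂ, ∀ᵐ s, s ∈ Set.Ioi (0 : ℝ) → g s = (Q s - c₀ - c₁ * s) / (4 * s) := by
  have hPi : IntegrableNearZero P :=
    integrableNearZero_of_continuousOn (hP ▸ hqg.continuousOn_primitive)
  have hQ' : IntegrableNearZero fun s => 4 * (k + 1) * g s + P s := fun c =>
    ((hg c).const_mul _).add (hPi c)
  have hQi : IntegrableNearZero Q :=
    integrableNearZero_of_continuousOn (hQ ▸ hQ'.continuousOn_primitive)
  obtain ⟨c₀, c₁, hc⟩ := ae_eq_affine_of_integral_deriv_deriv_mul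
    (fun c => (hQi c).sub ((hg.ofReal_mul c).const_mul 4)) fun h hh =>
      hw.integral_deriv_deriv_mul_eq_zero hg hqg hPi hQi
        (fun h hh => hP ▸ hh.integral_deriv_mul_primitive hqg)
        (fun h hh => by rw [← hh.integral_deriv_mul_primitive hQ', hQ]) hh
  refine ⟨c₀, c₁, ?_⟩
  filter_upwards [hc] with s hs hs₀
  have hs' : (s : ℂ) ≠ 0 := Complex.ofReal_ne_zero.2 (ne_of_gt hs₀)
  rw [eq_div_iff (by simpa using hs')]
  have haffine := hs hs₀
  rw [Pi.sub_apply] at haffine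
  linear_combination -haffine

lemma hasDerivAt_div_four_mul {N : ℝ → ℂ} {N' : ℂ} {s : ℝ} (hs : 0 < s) (hN : HasDerivAt N N' s) :
    HasDerivAt (fun s : ℝ => N s / (4 * s)) ((N' - 4 * (N s / (4 * s))) / (4 * s)) s := by
  have hs₀ : (s : ℂ) ≠ 0 := Complex.ofReal_ne_zero.2 hs.ne'
  refine (hN.div (hasDerivAt_const_mul_ofReal 4 s) (by simpa using hs₀)).congr_deriv ?_
  field_simp

lemma IsWeakRadialSol.exists_regular (hw : IsWeakRadialSol k q g) (hg : IntegrableNearZero g)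
    (hqg : IntegrableNearZero fun s => (q s : ℂ) * g s) :
    ∃ G G₁ : ℝ → ℂ, (∀ᵐ s, s ∈ Set.Ioi (0 : ℝ) → g s = G s) ∧
      (∀ s > 0, HasDerivAt G (G₁ s) s) ∧ (∀ s > 0, ContinuousAt G₁ s) ∧
      ∀ s > 0, ContinuousAt q s →
        HasDerivAt G₁ ((4 * (k - 1) * G₁ s + q s * G s) / (4 * s)) s := by
  set P : ℝ → ℂ := fun s => ∫ t in (0 : ℝ)..s, (q t : ℂ) * g t with hP
  set Q : ℝ → ℂ := fun s => ∫ t in (0 : ℝ)..s, (4 * (k + 1) * g t + P t) with hQ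
  obtain ⟨c₀, c₁, hgG⟩ := hw.exists_integral_eq hg hqg hP hQ
  set G : ℝ → ℂ := fun s => (Q s - c₀ - c₁ * s) / (4 * s)
  set G₁ : ℝ → ℂ := fun s => (4 * k * G s + P s - c₁) / (4 * s)
  have hPi : IntegrableNearZero P := integrableNearZero_of_continuousOn hqg.continuousOn_primitive
  have hQ' : IntegrableNearZero fun s => 4 * (k + 1) * g s + P s := fun c =>
    ((hg c).const_mul _).add (hPi c)
  have hne : ∀ s : ℝ, 0 < s → (4 * s : ℂ) ≠ 0 := fun s hs => by simpa using hs.ne'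
  have hPc : ∀ s > 0, ContinuousAt P s := fun s hs =>
    hqg.continuousOn_primitive.continuousAt (Ici_mem_nhds hs)
  have hGc : ∀ s > 0, ContinuousAt G s := fun s hs =>
    (((hQ'.continuousOn_primitive.continuousAt (Ici_mem_nhds hs)).sub continuousAt_const).sub
      (by fun_prop)).div (by fun_prop) (hne s hs)
  have hGd : ∀ s > 0, HasDerivAt G (G₁ s) s := fun s hs => by
    have hQd : HasDerivAt Q (4 * (k + 1) * G s + P s) s :=
      hQ'.hasDerivAt_primitive (g := fun s => 4 * (k + 1) * G s + P s)
        (by filter_upwards [hgG] with t ht ht₀; rw [ht ht₀]) hs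
        ((continuousAt_const.mul (hGc s hs)).add (hPc s hs))
    refine (hasDerivAt_div_four_mul hs
      ((hQd.sub_const c₀).sub (hasDerivAt_const_mul_ofReal c₁ s))).congr_deriv ?_
    rw [Pi.sub_apply]
    ring
  refine ⟨G, G₁, hgG, hGd, fun s hs => (((continuousAt_const.mul (hGc s hs)).add
    (hPc s hs)).sub continuousAt_const).div (by fun_prop) (hne s hs), fun s hs hq => ?_⟩
  have hPd : HasDerivAt P (q s * G s) s :=
    hqg.hasDerivAt_primitive (g := fun s => (q s : ℂ) * G s)
      (by filter_upwards [hgG] with t ht ht₀; rw [ht ht₀]) hs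
      ((Complex.continuous_ofReal.continuousAt.comp hq).mul (hGc s hs))
  refine (hasDerivAt_div_four_mul hs
    ((((hGd s hs).const_mul (4 * k : ℂ)).add hPd).sub_const c₁)).congr_deriv ?_
  rw [Pi.add_apply]
  ring

end Regularity

/-! ### Solutions of the radial equation -/

/-- `f` solves `s f'' = (k - 1) f' + q f` on `I`, with `f₁ = f'`. -/
def IsRadialSol (k : ℕ) (q : ℂ) (I : Set ℝ) (f f₁ : ℝ → ℂ) : Prop :=
  ∀ s ∈ I, HasDerivAt f (f₁ s) s ∧ HasDerivAt f₁ (((k - 1) * f₁ s + q * f s) / s) s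

section RadialSol

variable {k : ℕ} {I : Set ℝ} {f f₁ g g₁ h h₁ : ℝ → ℂ}

lemma IsRadialSol.exists_wronskian_eq {q : ℂ} (hI : IsOpen I) (hI' : IsPreconnected I)
    (hpos : ∀ s ∈ I, 0 < s) (hf : IsRadialSol k q I f f₁) (hg : IsRadialSol k q I g g₁) :
    ∃ C : ℂ, ∀ s ∈ I, s * (f₁ s * g s - f s * g₁ s) = C * (s : ℂ) ^ k := by
  have hpow : ∀ s ∈ I, (s : ℂ) ^ k ≠ 0 := fun s hs =>
    pow_ne_zero _ (Complex.ofReal_ne_zero.2 (hpos s hs).ne')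
  have hderiv : ∀ s ∈ I,
      HasDerivAt (fun s : ℝ => s * (f₁ s * g s - f s * g₁ s) / (s : ℂ) ^ k) 0 s := fun s hs => by
    have hs₀ : (s : ℂ) ≠ 0 := Complex.ofReal_ne_zero.2 (hpos s hs).ne'
    have hw : HasDerivAt (fun s : ℝ => f₁ s * g s - f s * g₁ s) _ s :=
      ((hf s hs).2.mul (hg s hs).1).sub ((hf s hs).1.mul (hg s hs).2)
    refine ((Complex.ofRealCLM.hasDerivAt.mul hw).div (hasDerivAt_pow k (s : ℂ)).comp_ofReal
      (hpow s hs)).congr_deriv ?_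
    rcases k with - | k
    · simp only [Complex.ofRealCLM_apply, Pi.mul_apply]
      field_simp
      simp
      ring
    · simp only [Complex.ofRealCLM_apply, Pi.mul_apply, Nat.add_sub_cancel]
      push_cast
      field_simp
      simp
      ring
  obtain ⟨C, hC⟩ := hI.exists_is_const_of_deriv_eq_zero hI'
    (fun s hs => (hderiv s hs).differentiableAt.differentiableWithinAt)
    (fun s hs => (hderiv s hs).deriv)
  exact ⟨C, fun s hs => by rw [← hC s hs, div_mul_cancel₀ _ (hpow s hs)]⟩

lemma IsRadialSol.exists_eq_combination {q : ℂ} (hI : IsOpen I) (hI' : IsPreconnected I)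
    (hpos : ∀ s ∈ I, 0 < s) (hf : IsRadialSol k q I f f₁) (hg : IsRadialSol k q I g g₁)
    (hh : IsRadialSol k q I h h₁) {C : ℂ} (hC₀ : C ≠ 0)
    (hC : ∀ s ∈ I, s * (g₁ s * h s - g s * h₁ s) = C * (s : ℂ) ^ k) :
    ∃ α β : ℂ, ∀ s ∈ I, f s = α * g s + β * h s ∧ f₁ s = α * g₁ s + β * h₁ s := by
  obtain ⟨A, hA⟩ := hf.exists_wronskian_eq hI hI' hpos hh
  obtain ⟨B, hB⟩ := hg.exists_wronskian_eq hI hI' hpos hf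
  refine ⟨A / C, B / C, fun s hs => ?_⟩
  have hpow : (s : ℂ) ^ k ≠ 0 := pow_ne_zero _ (Complex.ofReal_ne_zero.2 (hpos s hs).ne')
  have hAs := hA s hs
  have hBs := hB s hs
  have hCs := hC s hs
  constructor
  · field_simp
    refine mul_right_cancel₀ hpow ?_
    linear_combination -f s * hCs + g s * hAs + h s * hBs
  · field_simp
    refine mul_right_cancel₀ hpow ?_
    linear_combination -f₁ s * hCs + g₁ s * hAs + h₁ s * hBs

lemma hasDerivAt_comp_const_mul_ofReal {F : ℂ → ℂ} {F' q : ℂ} {s : ℝ}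
    (hF : HasDerivAt F F' (q * s)) : HasDerivAt (fun s : ℝ => F (q * s)) (q * F') s := by
  rw [← smul_eq_mul]
  exact hF.scomp s (hasDerivAt_const_mul_ofReal q s)

lemma isRadialSol_of_recurrence {n : ℕ} {q : ℂ} (hpos : ∀ s ∈ I, 0 < s) {S : ℕ → ℂ → ℂ}
    (hS : ∀ k, ∀ s ∈ I, HasDerivAt (S (k + 1)) (S k (q * s)) (q * s))
    (hrec : ∀ k t, S (k + 2) t = t * S k t - (k + 1) * S (k + 1) t) :
    IsRadialSol (n + 2) q I (fun s => S (n + 2) (q * s)) fun s => q * S (n + 1) (q * s) :=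
  fun s hs => by
  refine ⟨hasDerivAt_comp_const_mul_ofReal (hS _ s hs),
    ((hasDerivAt_comp_const_mul_ofReal (hS _ s hs)).const_mul _).congr_deriv ?_⟩
  have hs₀ : (s : ℂ) ≠ 0 := Complex.ofReal_ne_zero.2 (hpos s hs).ne'
  beta_reduce
  rw [hrec]
  push_cast
  field_simp
  ring

lemma ofReal_mul_ofReal_mem_halfPlane {σ q s : ℝ} (hq : 0 < σ * q) (hs : 0 < s) :
    (q : ℂ) * s ∈ halfPlane σ := by
  rw [mem_halfPlane, ← Complex.ofReal_mul, Complex.ofReal_re, ← mul_assoc]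
  exact mul_pos hq hs

lemma IsRadialSol.exists_eq_regularSol_add_singularBranch {n : ℕ} {q σ : ℝ} (hσ : |σ| = 1)
    (hq : 0 < σ * q) (hI : IsOpen I) (hI' : IsPreconnected I) (hpos : ∀ s ∈ I, 0 < s)
    (hf : IsRadialSol (n + 2) q I f f₁) :
    ∃ α β : ℂ, ∀ s ∈ I,
      f s = α * regularSol (n + 2) (q * s) + β * singularBranch σ 0 (n + 2) (q * s) ∧
      f₁ s = α * (q * regularSol (n + 1) (q * s)) +
        β * (q * singularBranch σ 0 (n + 1) (q * s)) := by
  have hq₀ : (q : ℂ) ≠ 0 := Complex.ofReal_ne_zero.2 (right_ne_zero_of_mul hq.ne')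
  have hmem : ∀ s ∈ I, (q : ℂ) * s ∈ halfPlane σ := fun s hs =>
    ofReal_mul_ofReal_mem_halfPlane hq (hpos s hs)
  refine hf.exists_eq_combination hI hI' hpos
    (isRadialSol_of_recurrence hpos (fun k s _ => hasDerivAt_regularSol k _) regularSol_add_two)
    (isRadialSol_of_recurrence hpos (fun k s hs => hasDerivAt_singularBranch k (hmem s hs))
      fun k t => singularBranch_add_two σ 0 k t)
    (C := q ^ (n + 2) * (-1) ^ (n + 1))
    (mul_ne_zero (pow_ne_zero _ hq₀) (pow_ne_zero _ (by norm_num))) fun s hs => ?_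
  rw [← wronskian_besselClifford_singularBranch hσ 0 n (hmem s hs)]
  simp only [regularSol]
  ring

end RadialSol

/-! ### Square integrable solutions of the radial equation -/

lemma inv_factorial_sq_mul_pow_le (k : ℕ) {t : ℝ} (ht : 0 < t) :
    ((k.factorial : ℝ)⁻¹) ^ 2 * t ^ k ≤ ‖regularSol k t‖ ^ 2 * (t ^ k)⁻¹ := by
  obtain ⟨a, ha, hle⟩ := exists_ofReal_eq_besselClifford_natCast k t
  have hle' := hle ht.le
  calc ((k.factorial : ℝ)⁻¹) ^ 2 * t ^ k ≤ a ^ 2 * t ^ k := by gcongr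
    _ = ‖regularSol k t‖ ^ 2 * (t ^ k)⁻¹ := by
      rw [regularSol, ha, norm_mul, norm_pow, Complex.norm_real, Complex.norm_real,
        Real.norm_of_nonneg ht.le, Real.norm_eq_abs, mul_pow, sq_abs]
      field_simp

lemma not_integrableAtFilter_regularSol (k : ℕ) :
    ¬ IntegrableAtFilter (fun t : ℝ => ‖regularSol k t‖ ^ 2 * (t ^ k)⁻¹) atTop := fun hint => by
  have hO : (fun t : ℝ => t⁻¹) =O[atTop] fun t : ℝ => ‖regularSol k t‖ ^ 2 * (t ^ k)⁻¹ := by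
    refine IsBigO.of_bound ((((k.factorial : ℝ)⁻¹) ^ 2)⁻¹) ?_
    filter_upwards [eventually_ge_atTop 1] with t ht
    have ht₀ : 0 < t := one_pos.trans_le ht
    rw [Real.norm_of_nonneg (by positivity), Real.norm_of_nonneg (by positivity), inv_mul_eq_div,
      le_div_iff₀' (by positivity)]
    refine le_trans ?_ (inv_factorial_sq_mul_pow_le k ht₀)
    gcongr
    exact (inv_le_one_of_one_le₀ ht).trans (one_le_pow₀ ht)
  obtain ⟨T, hT⟩ := integrableAtFilter_atTop_iff.1 <| hO.integrableAtFilter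
    (measurable_inv.stronglyMeasurable.aestronglyMeasurable.stronglyMeasurableAtFilter) hint
  exact not_integrableOn_Ici_inv hT

/-- The combination `a * regularSol + b * singularBranch` of the two model solutions comes from a
function that is square integrable at infinity in the plane. -/
def IsDecaying (k : ℕ) (a b : ℂ) : Prop :=
  IntegrableAtFilter (fun t : ℝ => ‖a * regularSol k t + b * singularBranch 1 0 k t‖ ^ 2 *
    (t ^ k)⁻¹) atTop

lemma continuousOn_singularBranch (σ : ℝ) (c : ℂ) (n : ℕ) :
    ContinuousOn (singularBranch σ c (n + 1)) (halfPlane σ) := fun _ ht =>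
  (hasDerivAt_singularBranch n ht).continuousAt.continuousWithinAt

lemma continuousOn_decaying_integrand (n : ℕ) (a b : ℂ) :
    ContinuousOn (fun t : ℝ => ‖a * regularSol (n + 1) t + b * singularBranch 1 0 (n + 1) t‖ ^ 2 *
      (t ^ (n + 1))⁻¹) (Set.Ioi 0) := by
  have hreg : ContinuousOn (fun t : ℝ => regularSol (n + 1) t) (Set.Ioi 0) :=
    ((continuous_regularSol _).comp Complex.continuous_ofReal).continuousOn
  have hsing : ContinuousOn (fun t : ℝ => singularBranch 1 0 (n + 1) t) (Set.Ioi 0) :=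
    (continuousOn_singularBranch 1 0 n).comp Complex.continuous_ofReal.continuousOn
      fun t ht => by simpa [mem_halfPlane] using ht
  exact (((hreg.const_smul a).add (hsing.const_smul b)).norm.pow 2).mul
    ((continuousOn_id.pow _).inv₀ fun t ht => pow_ne_zero _ (ne_of_gt ht))

lemma IsDecaying.const_mul {k : ℕ} {a b : ℂ} (h : IsDecaying k a b) (c : ℂ) :
    IsDecaying k (c * a) (c * b) := by
  refine (IntegrableAtFilter.smul h (‖c‖ ^ 2)).congr (.of_forall fun t => ?_)
  simp only [Pi.smul_apply, smul_eq_mul]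
  rw [mul_assoc c, mul_assoc c, ← mul_add, norm_mul, mul_pow, mul_assoc]

lemma IsDecaying.add {n : ℕ} {a b a' b' : ℂ} (h : IsDecaying (n + 1) a b)
    (h' : IsDecaying (n + 1) a' b') : IsDecaying (n + 1) (a + a') (b + b') := by
  refine IsBigO.integrableAtFilter ?_ ?_ (IntegrableAtFilter.add h h')
  · refine IsBigO.of_bound 2 ?_
    filter_upwards [eventually_gt_atTop 0] with t ht
    rw [Real.norm_of_nonneg (by positivity), Pi.add_apply, Real.norm_of_nonneg (by positivity),
      ← add_mul, ← mul_assoc]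
    gcongr
    rw [add_mul a, add_mul b, add_add_add_comm]
    exact (pow_le_pow_left₀ (norm_nonneg _) (norm_add_le _ _) 2).trans add_sq_le
  · exact ⟨Set.Ioi 0, Ioi_mem_atTop 0,
      (continuousOn_decaying_integrand n _ _).aestronglyMeasurable measurableSet_Ioi⟩

lemma IsDecaying.eq_zero {k : ℕ} {a : ℂ} (h : IsDecaying k a 0) : a = 0 := by
  by_contra ha
  refine not_integrableAtFilter_regularSol k
    ((h.const_mul a⁻¹).congr (.of_forall fun t => ?_))
  simp [ha]

lemma exists_decaying_ratio (n : ℕ) : ∃ c : ℂ, ∀ a b, IsDecaying (n + 1) a b → a = b * c := by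
  by_cases h : ∃ a b, IsDecaying (n + 1) a b ∧ b ≠ 0
  · obtain ⟨a, b, hab, hb⟩ := h
    refine ⟨a / b, fun a' b' hab' => ?_⟩
    have hzero : b' * a + -b * a' = 0 := by
      refine IsDecaying.eq_zero (k := n + 1) ?_
      have hcomb := (hab.const_mul b').add (hab'.const_mul (-b))
      rwa [neg_mul b b', mul_comm b' b, add_neg_cancel] at hcomb
    field_simp
    linear_combination -hzero
  · push Not at h
    refine ⟨0, fun a b hab => ?_⟩
    obtain rfl := h a b hab
    rw [hab.eq_zero, zero_mul]

lemma isDecaying_of_integrableOn {k : ℕ} {q R : ℝ} (hq : 0 < q) {a b : ℂ} {G : ℝ → ℂ}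
    (hG : ∀ s ∈ Set.Ioi R, G s = a * regularSol k (q * s) + b * singularBranch 1 0 k (q * s))
    (hint : IntegrableOn (fun s => ‖G s‖ ^ 2 * (s ^ k)⁻¹) (Set.Ioi R)) :
    IsDecaying k a b := by
  refine ⟨Set.Ioi (q * R), Ioi_mem_atTop _, ?_⟩
  rw [← integrableOn_Ioi_comp_mul_left_iff _ R hq]
  refine IntegrableOn.congr_fun (hint.const_mul ((q ^ k)⁻¹)) (fun s hs => ?_) measurableSet_Ioi
  simp only [hG s hs, Complex.ofReal_mul, mul_pow, mul_inv]
  ring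

lemma not_integrableOn_Ioo_sq_norm_mul_inv_pow {k : ℕ} (hk : k ≠ 0) {R : ℝ} (hR : 0 < R)
    {G : ℝ → ℂ} {L : ℂ} (hL : L ≠ 0) (hG : Tendsto G (𝓝[>] 0) (𝓝 L)) :
    ¬ IntegrableOn (fun s => ‖G s‖ ^ 2 * (s ^ k)⁻¹) (Set.Ioo 0 R) := fun hint => by
  have hO : (fun s : ℝ => s⁻¹) =O[𝓝[>] 0] fun s => ‖G s‖ ^ 2 * (s ^ k)⁻¹ := by
    refine IsBigO.of_bound ((‖L‖ / 2) ^ 2)⁻¹ ?_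
    have hlarge : ∀ᶠ s in 𝓝[>] 0, ‖L‖ / 2 < ‖G s‖ :=
      hG.norm.eventually (lt_mem_nhds (half_lt_self (norm_pos_iff.2 hL)))
    filter_upwards [hlarge, Ioo_mem_nhdsGT one_pos] with s hs hs₁
    have hs₀ : 0 < s := hs₁.1
    rw [Real.norm_of_nonneg (by positivity), Real.norm_of_nonneg (by positivity), inv_mul_eq_div,
      le_div_iff₀' (by positivity)]
    gcongr
    exact pow_le_of_le_one hs₀.le hs₁.2.le hk
  obtain ⟨S, hS, hSint⟩ := hO.integrableAtFilter
    measurable_inv.stronglyMeasurable.aestronglyMeasurable.stronglyMeasurableAtFilter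
    ⟨_, Ioo_mem_nhdsGT hR, hint⟩
  obtain ⟨r, hr, hrS⟩ := mem_nhdsGT_iff_exists_Ioc_subset.1 hS
  have hinv : IntervalIntegrable (fun s : ℝ => s⁻¹) volume 0 r :=
    (intervalIntegrable_iff_integrableOn_Ioc_of_le (le_of_lt hr)).2 (hSint.mono_set hrS)
  rcases intervalIntegrable_inv_iff.1 hinv with h | h
  · exact (ne_of_lt hr) h
  · exact h Set.left_mem_uIcc

lemma eq_zero_of_integrableOn_Ioo {n : ℕ} {q R : ℝ} (hR : 0 < R) {a b : ℂ} {G : ℝ → ℂ}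
    (hG : ∀ s ∈ Set.Ioo 0 R,
      G s = a * regularSol (n + 1) (q * s) + b * singularBranch (-1) 0 (n + 1) (q * s))
    (hint : IntegrableOn (fun s => ‖G s‖ ^ 2 * (s ^ (n + 1))⁻¹) (Set.Ioo 0 R)) :
    b = 0 := by
  by_contra hb
  refine not_integrableOn_Ioo_sq_norm_mul_inv_pow n.succ_ne_zero hR
    (mul_ne_zero hb (neg_one_pow_mul_factorial_ne_zero n)) ?_ hint
  have hscale : Tendsto (fun s : ℝ => (q : ℂ) * s) (𝓝[>] 0) (𝓝 0) := by
    have hcont : Continuous fun s : ℝ => (q : ℂ) * s := by fun_prop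
    simpa using (hcont.tendsto 0).mono_left nhdsWithin_le_nhds
  have hreg : Tendsto (regularSol (n + 1)) (𝓝 0) (𝓝 0) := by
    simpa [regularSol] using (continuous_regularSol (n + 1)).tendsto 0
  have hsum := ((hreg.comp hscale).const_mul a).add
    (((tendsto_singularBranch (σ := -1) (by simp) 0 n).comp hscale).const_mul b)
  rw [mul_zero, zero_add] at hsum
  refine hsum.congr' ?_
  filter_upwards [Ioo_mem_nhdsGT hR] with s hs
  exact (hG s hs).symm

/-! ### The matching condition at a negative eigenvalue -/

lemma IsRadialSol.exists_eq_regularSol {n : ℕ} {p R : ℝ} (hp : p < 0) (hR : 0 < R)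
    {G G₁ : ℝ → ℂ} (hG : IsRadialSol (n + 2) p (Set.Ioo 0 R) G G₁)
    (hGc : ContinuousOn G (Set.Ioi 0)) (hG₁c : ContinuousOn G₁ (Set.Ioi 0))
    (hint : IntegrableOn (fun s => ‖G s‖ ^ 2 * (s ^ (n + 2))⁻¹) (Set.Ioi 0)) :
    ∃ α : ℂ, ∀ s ∈ Set.Ioc 0 R, G s = α * regularSol (n + 2) (p * s) ∧
      G₁ s = α * (p * regularSol (n + 1) (p * s)) := by
  obtain ⟨α, β, h⟩ := hG.exists_eq_regularSol_add_singularBranch (σ := -1) (by simp) (by linarith)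
    isOpen_Ioo isPreconnected_Ioo fun s hs => hs.1
  obtain rfl : β = 0 := eq_zero_of_integrableOn_Ioo hR (fun s hs => (h s hs).1)
    (hint.mono_set Set.Ioo_subset_Ioi_self)
  have hreg : ∀ k, Continuous fun s : ℝ => regularSol k (p * s) := fun k =>
    (continuous_regularSol k).comp (by fun_prop)
  have hclosure : Set.Ioc 0 R ⊆ closure (Set.Ioo 0 R) := by
    rw [closure_Ioo hR.ne]; exact Set.Ioc_subset_Icc_self
  have heq : Set.EqOn G (fun s => α * regularSol (n + 2) (p * s)) (Set.Ioc 0 R) :=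
    Set.EqOn.of_subset_closure (fun s hs => by simpa using (h s hs).1)
      (hGc.mono Set.Ioc_subset_Ioi_self) ((hreg _).const_mul α).continuousOn
      Set.Ioo_subset_Ioc_self hclosure
  have heq₁ : Set.EqOn G₁ (fun s => α * (p * regularSol (n + 1) (p * s))) (Set.Ioc 0 R) :=
    Set.EqOn.of_subset_closure (fun s hs => by simpa using (h s hs).2)
      (hG₁c.mono Set.Ioc_subset_Ioi_self) (((hreg _).const_mul _).const_mul α).continuousOn
      Set.Ioo_subset_Ioc_self hclosure
  exact ⟨α, fun s hs => ⟨heq hs, heq₁ hs⟩⟩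

lemma singularBranch_eq_add (σ : ℝ) (c : ℂ) (k : ℕ) (t : ℂ) :
    singularBranch σ c k t = singularBranch σ 0 k t + c * regularSol k t := by
  simp only [singularBranch, branchLog, add_zero]
  exact singularSol_add k _ c t

lemma IsRadialSol.exists_eq_singularBranch {n : ℕ} {c : ℂ}
    (hc : ∀ a b, IsDecaying (n + 2) a b → a = b * c) {q R : ℝ} (hq : 0 < q) (hR : 0 < R)
    {G G₁ : ℝ → ℂ} (hG : IsRadialSol (n + 2) q (Set.Ioi R) G G₁)
    (hGc : ContinuousOn G (Set.Ioi 0)) (hG₁c : ContinuousOn G₁ (Set.Ioi 0))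
    (hint : IntegrableOn (fun s => ‖G s‖ ^ 2 * (s ^ (n + 2))⁻¹) (Set.Ioi 0)) :
    ∃ b : ℂ, ∀ s ∈ Set.Ici R, G s = b * singularBranch 1 c (n + 2) (q * s) ∧
      G₁ s = b * (q * singularBranch 1 c (n + 1) (q * s)) := by
  have hpos : Set.Ici R ⊆ Set.Ioi 0 := Set.Ici_subset_Ioi.2 hR
  obtain ⟨a, b, h⟩ := hG.exists_eq_regularSol_add_singularBranch (σ := 1) (by simp) (by linarith)
    isOpen_Ioi isPreconnected_Ioi fun s hs => hpos (Set.Ioi_subset_Ici_self hs)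
  obtain rfl : a = b * c := hc a b <| isDecaying_of_integrableOn hq (fun s hs => (h s hs).1)
    (hint.mono_set (Set.Ioi_subset_Ioi hR.le))
  have hsing : ∀ k, ContinuousOn (fun s : ℝ => singularBranch 1 c (k + 1) (q * s)) (Set.Ici R) :=
    fun k => (continuousOn_singularBranch 1 c k).comp (by fun_prop) fun s hs =>
      ofReal_mul_ofReal_mem_halfPlane (by linarith) (hpos hs)
  have hclosure : Set.Ici R ⊆ closure (Set.Ioi R) := (closure_Ioi R).ge
  have heq : Set.EqOn G (fun s => b * singularBranch 1 c (n + 2) (q * s)) (Set.Ici R) :=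
    Set.EqOn.of_subset_closure
      (fun s hs => by rw [(h s hs).1, singularBranch_eq_add 1 c]; ring)
      (hGc.mono hpos) ((hsing _).const_smul b) Set.Ioi_subset_Ici_self hclosure
  have heq₁ : Set.EqOn G₁ (fun s => b * (q * singularBranch 1 c (n + 1) (q * s))) (Set.Ici R) :=
    Set.EqOn.of_subset_closure
      (fun s hs => by rw [(h s hs).2, singularBranch_eq_add 1 c]; ring)
      (hG₁c.mono hpos) (((hsing _).const_smul (q : ℂ)).const_smul b) Set.Ioi_subset_Ici_self
      hclosure
  exact ⟨b, fun s hs => ⟨heq hs, heq₁ hs⟩⟩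

lemma eq_zero_of_mul_regularSol_eq_zero {n : ℕ} {p R : ℝ} (hp : p ≠ 0) (hR : R ≠ 0) {α : ℂ}
    (h : α * regularSol (n + 2) (p * R) = 0) (h₁ : α * (p * regularSol (n + 1) (p * R)) = 0) :
    α = 0 := by
  by_contra hα
  have hp' : (p : ℂ) ≠ 0 := Complex.ofReal_ne_zero.2 hp
  simp only [regularSol, mul_eq_zero, hα, pow_eq_zero_iff', hp', Complex.ofReal_ne_zero.2 hR,
    or_self, false_and, false_or] at h h₁
  rw [← Complex.ofReal_mul] at h h₁
  exact besselClifford_add_two_ne_zero n h₁ h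

lemma IsRadialSol.matching_eq_zero {n : ℕ} {c : ℂ}
    (hc : ∀ a b, IsDecaying (n + 2) a b → a = b * c) {p q R : ℝ} (hp : p < 0) (hq : 0 < q)
    (hR : 0 < R) {G G₁ : ℝ → ℂ} (hin : IsRadialSol (n + 2) p (Set.Ioo 0 R) G G₁)
    (hout : IsRadialSol (n + 2) q (Set.Ioi R) G G₁)
    (hGc : ContinuousOn G (Set.Ioi 0)) (hG₁c : ContinuousOn G₁ (Set.Ioi 0))
    (hint : IntegrableOn (fun s => ‖G s‖ ^ 2 * (s ^ (n + 2))⁻¹) (Set.Ioi 0))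
    (hne : ∃ s ∈ Set.Ioi 0, G s ≠ 0) {τ e : ℂ} (hτ : τ + e + q * R = p * R) :
    matching 1 c n τ e (q * R) = 0 := by
  obtain ⟨α, hα⟩ := hin.exists_eq_regularSol hp hR hGc hG₁c hint
  obtain ⟨b, hb⟩ := hout.exists_eq_singularBranch hc hq hR hGc hG₁c hint
  have hGR : b * singularBranch 1 c (n + 2) (q * R) = α * regularSol (n + 2) (p * R) :=
    (hb R Set.self_mem_Ici).1.symm.trans (hα R ⟨hR, le_rfl⟩).1
  have hG₁R : b * (q * singularBranch 1 c (n + 1) (q * R)) =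
      α * (p * regularSol (n + 1) (p * R)) :=
    (hb R Set.self_mem_Ici).2.symm.trans (hα R ⟨hR, le_rfl⟩).2
  have hb₀ : b ≠ 0 := by
    rintro rfl
    obtain rfl : α = 0 := eq_zero_of_mul_regularSol_eq_zero hp.ne hR.ne'
      (by rw [← hGR, zero_mul]) (by rw [← hG₁R, zero_mul])
    obtain ⟨s, hs, hGs⟩ := hne
    rcases le_total s R with h | h
    · exact hGs (by rw [(hα s ⟨hs, h⟩).1, zero_mul])
    · exact hGs (by rw [(hb s h).1, zero_mul])
  refine (mul_eq_zero.1 (?_ : b * _ = 0)).resolve_left hb₀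
  simp only [regularSol] at hGR hG₁R
  rw [matching, hτ]
  linear_combination besselClifford (n + 1 : ℕ) (p * R) * hGR -
    R * besselClifford (n + 2 : ℕ) (p * R) * hG₁R

lemma exists_matching_eq_zero_of_isSolution (n : ℕ) :
    ∃ c : ℂ, ∀ {ρ A E : ℝ} {ℓ : ℤ} {ψ : ℂ → ℂ}, 0 < ρ → ℓ.natAbs = n + 2 → 0 < A + E → E < 0 →
      MemLp ψ 2 volume → ¬ ψ =ᵐ[volume] 0 → HasAngularMode ℓ ψ →
      IsSolution (circularWell ρ A) (E : ℂ) ψ → ∀ {τ e : ℂ}, τ + e = ((-(A * ρ ^ 2 / 4) : ℝ) : ℂ) →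
      matching 1 c n τ e ((-(E / 4) * ρ ^ 2 : ℝ) : ℂ) = 0 := by
  obtain ⟨c, hc⟩ := exists_decaying_ratio (n + 1)
  refine ⟨c, fun {ρ A E ℓ ψ} hρ hℓ hAE hE hψ hne hm hs {τ e} hτ => ?_⟩
  obtain ⟨g, hg_sq, hg, hg_ne, hw⟩ := exists_radial_profile hρ.le hψ hne hm hs
  rw [hℓ] at hg_sq hw
  obtain ⟨G, G₁, hgG, hG, hG₁c, hG₁⟩ := hw.exists_regular hg (hg.step_mul _ _ _)
  have hint : IntegrableOn (fun s => ‖G s‖ ^ 2 * (s ^ (n + 2))⁻¹) (Set.Ioi 0) :=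
    hg_sq.congr_fun_ae <| (ae_restrict_iff' measurableSet_Ioi).2 <| by
      filter_upwards [hgG] with s hs hs₀
      rw [hs hs₀]
  have hG_ne : ∃ s ∈ Set.Ioi 0, G s ≠ 0 := by
    by_contra! hzero
    exact hg_ne (hgG.mono fun s hs hs₀ => (hs hs₀).trans (hzero s hs₀))
  have hradial : ∀ {a : ℝ} {I : Set ℝ}, (∀ s ∈ I, 0 < s ∧ s ≠ ρ ^ 2 ∧
      step (ρ ^ 2) (-A - E) (-E) s = 4 * a) → IsRadialSol (n + 2) a I G G₁ := fun hI s hs => by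
    obtain ⟨hs₀, hsR, hstep⟩ := hI s hs
    refine ⟨hG s hs₀, (hG₁ s hs₀ (continuousAt_step _ _ hsR)).congr_deriv ?_⟩
    have hs' : (s : ℂ) ≠ 0 := Complex.ofReal_ne_zero.2 hs₀.ne'
    rw [hstep]
    push_cast
    field_simp
  have hin : IsRadialSol (n + 2) (-((A + E) / 4) : ℝ) (Set.Ioo 0 (ρ ^ 2)) G G₁ :=
    hradial fun s hs => ⟨hs.1, hs.2.ne, by rw [step, if_pos hs.2.le]; ring⟩
  have hout : IsRadialSol (n + 2) (-(E / 4) : ℝ) (Set.Ioi (ρ ^ 2)) G G₁ :=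
    hradial fun s hs => ⟨(sq_nonneg ρ).trans_lt hs, ne_of_gt hs,
      by rw [step, if_neg (not_le.2 hs)]; ring⟩
  rw [Complex.ofReal_mul]
  refine hin.matching_eq_zero hc (by linarith) (by linarith) (by positivity) hout
    (fun s hs => (hG s hs).continuousAt.continuousWithinAt)
    (fun s hs => (hG₁c s hs).continuousWithinAt) hint hG_ne ?_
  rw [hτ]
  push_cast
  ring

/-! ### Asymptotics of the resonances and of the eigenvalue -/

lemma errorScale_mul_isBigO (n : ℕ) {k : ℝ} (hk : 0 < k) :
    (fun ε : ℝ => errorScale n (ε * k)) =O[𝓝[≠] 0] errorScale n := by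
  have hsum : (fun ε : ℝ => k ^ 2 * errorScale n ε +
      k ^ 2 * (if n = 0 then 1 else 0) * Real.log k * ε ^ 2) =O[𝓝[≠] 0] errorScale n :=
    ((isBigO_refl _ _).const_mul_left _).add ((sq_isBigO_errorScale n).const_mul_left _)
  refine hsum.congr' ?_ EventuallyEq.rfl
  filter_upwards [self_mem_nhdsWithin] with ε hε
  simp only [errorScale]
  rw [abs_mul, abs_of_pos hk, Real.log_mul (abs_ne_zero.2 hε) hk.ne']
  ring

lemma tendsto_mul_const_nhdsNE {k : ℝ} (hk : k ≠ 0) :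
    Tendsto (fun ε : ℝ => ε * k) (𝓝[≠] 0) (𝓝[≠] 0) := by
  refine tendsto_nhdsWithin_iff.2 ⟨?_, ?_⟩
  · simpa using ((continuous_mul_const k).tendsto 0).mono_left nhdsWithin_le_nhds
  · filter_upwards [self_mem_nhdsWithin] with ε hε using mul_ne_zero hε hk

lemma matching_approxZero_mul_isBigO {σ : ℝ} (hσ : |σ| = 1) (c : ℂ) {n : ℕ} {τ : ℂ}
    (hτ : besselClifford (n + 1 : ℕ) τ = 0) {k : ℝ} (hk : 0 < k) :
    (fun ε : ℝ => matching σ c n τ ((ε * k : ℝ) : ℂ) (approxZero n (ε * k))) =O[𝓝[≠] 0]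
      errorScale n :=
  ((matching_approxZero_isBigO hσ c hτ).comp_tendsto (tendsto_mul_const_nhdsNE hk.ne')).trans
    (errorScale_mul_isBigO n hk)

lemma errorScale_div_sqrt {ε : ℝ} (n : ℕ) (hε : ε ≠ 0) :
    errorScale n ε / √|ε| =
      |ε| ^ (3 / 2 : ℝ) * (1 + (if n = 0 then 1 else 0) * Real.log |ε|) := by
  have hpos : 0 < |ε| := abs_pos.2 hε
  have hpow : |ε| ^ (3 / 2 : ℝ) = ε ^ 2 / √|ε| := by
    rw [Real.sqrt_eq_rpow, ← sq_abs ε, ← Real.rpow_natCast, ← Real.rpow_sub hpos]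
    norm_num
  rw [hpow, errorScale]
  ring

lemma exists_resonance_branch {ρ : ℝ} (hρ : 0 < ρ) (a : ℝ) {n : ℕ}
    (hτ : besselClifford (n + 1 : ℕ) (tauZero ρ a) = 0) {σ θ : ℝ} (h : IsBranch σ θ) :
    ∃ ε₀ > 0, ∃ lam : ℝ → ℂ,
      (∀ ε : ℝ, σ * ε < 0 → |ε| < ε₀ → IsResonance (circularWell ρ (a ^ 2 - ε)) ρ (lam ε)) ∧
      (fun ε : ℝ => lam ε - ((ε * modeRatio n : ℝ) : ℂ) ^ (1 / 2 : ℂ)) =O[𝓝[{ε | σ * ε < 0}] 0]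
        fun ε : ℝ => |ε| ^ (3 / 2 : ℝ) * (1 + (if n = 0 then 1 else 0) * Real.log |ε|) := by
  obtain ⟨ε₀, hε₀, C, hres⟩ := exists_resonance hρ a hτ h
  choose! lam hlam hle using hres
  have hne : {ε : ℝ | σ * ε < 0} ⊆ {0}ᶜ := fun ε hε h0 => by
    simp [Set.mem_singleton_iff.1 h0] at hε
  refine ⟨ε₀, hε₀, lam, hlam, ?_⟩
  have hbound : (fun ε : ℝ => lam ε - ((ε * modeRatio n : ℝ) : ℂ) ^ (1 / 2 : ℂ))
      =O[𝓝[{ε | σ * ε < 0}] 0] fun ε : ℝ => ‖matching σ (2 * (θ * Complex.I)) n (tauZero ρ a)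
        ((ε * ρ ^ 2 / 4 : ℝ) : ℂ) (approxZero n (ε * ρ ^ 2 / 4))‖ * (√|ε|)⁻¹ := by
    refine IsBigO.of_bound C ?_
    filter_upwards [self_mem_nhdsWithin, nhdsWithin_le_nhds (Metric.ball_mem_nhds 0 hε₀)]
      with ε hε hball
    rw [Real.norm_of_nonneg (by positivity), ← div_eq_mul_inv]
    exact hle ε hε (mem_ball_zero_iff.1 hball)
  have hmatch := matching_approxZero_mul_isBigO h.abs_eq_one (2 * (θ * Complex.I)) hτ
    (k := ρ ^ 2 / 4) (by positivity)
  simp only [← mul_div_assoc] at hmatch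
  refine (hbound.trans ((hmatch.norm_left.mono (nhdsWithin_mono 0 hne)).mul
    (isBigO_refl _ _))).congr' EventuallyEq.rfl ?_
  filter_upwards [self_mem_nhdsWithin] with ε hε
  rw [← div_eq_mul_inv, errorScale_div_sqrt n (hne hε)]

lemma exists_resonance_family {ρ : ℝ} (hρ : 0 < ρ) (a : ℝ) {n : ℕ}
    (hτ : besselClifford (n + 1 : ℕ) (tauZero ρ a) = 0) :
    ∃ ε₀ > 0, ∃ lam : ℝ → ℂ,
      (∀ ε : ℝ, 0 < |ε| → |ε| < ε₀ → IsResonance (circularWell ρ (a ^ 2 - ε)) ρ (lam ε)) ∧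
      (fun ε : ℝ => lam ε - ((ε * modeRatio n : ℝ) : ℂ) ^ (1 / 2 : ℂ)) =O[𝓝[≠] 0]
        fun ε : ℝ => |ε| ^ (3 / 2 : ℝ) * (1 + (if n = 0 then 1 else 0) * Real.log |ε|) := by
  obtain ⟨δ₁, hδ₁, lam₁, hlam₁, hO₁⟩ := exists_resonance_branch hρ a hτ (σ := 1) (θ := 0)
    (Or.inl ⟨rfl, rfl⟩)
  obtain ⟨δ₂, hδ₂, lam₂, hlam₂, hO₂⟩ := exists_resonance_branch hρ a hτ (σ := -1)
    (θ := -(Real.pi / 2)) (Or.inr ⟨rfl, rfl⟩)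
  simp only [one_mul, neg_mul, neg_lt_zero] at hlam₁ hlam₂ hO₁ hO₂
  refine ⟨min δ₁ δ₂, lt_min hδ₁ hδ₂, fun ε => if ε < 0 then lam₁ ε else lam₂ ε,
    fun ε hε hlt => ?_, ?_⟩
  · rw [lt_min_iff] at hlt
    beta_reduce
    split_ifs with hneg
    · exact hlam₁ ε hneg hlt.1
    · exact hlam₂ ε ((not_lt.1 hneg).lt_of_ne' (abs_pos.1 hε)) hlt.2
  · rw [← nhdsLT_sup_nhdsGT, isBigO_sup]
    refine ⟨hO₁.congr' ?_ EventuallyEq.rfl, hO₂.congr' ?_ EventuallyEq.rfl⟩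
    · filter_upwards [self_mem_nhdsWithin] with ε hε
      rw [if_pos hε]
    · filter_upwards [self_mem_nhdsWithin] with ε hε
      rw [if_neg (not_lt.2 (le_of_lt hε))]

section Eigenvalue

variable {α : Type*} {l : Filter α} {σ : ℝ} {n : ℕ} {τ c : ℂ} {e : α → ℝ} {t : α → ℂ}

lemma besselClifford_eq_zero_of_matching_eq_zero [l.NeBot] (hσ : |σ| = 1)
    (he : Tendsto e l (𝓝 0)) (ht : Tendsto t l (𝓝 0))
    (hmatch : ∀ᶠ x in l, matching σ c n τ (e x) (t x) = 0) :
    besselClifford (n + 1 : ℕ) τ = 0 := by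
  have harg : Tendsto (fun x => τ + e x + t x) l (𝓝 τ) := by
    simpa using (((Complex.continuous_ofReal.tendsto 0).comp he).const_add τ).add ht
  have hreg : ∀ k : ℕ, Tendsto (fun x => besselClifford k (τ + e x + t x)) l
      (𝓝 (besselClifford k τ)) := fun k => ((continuous_besselClifford k).tendsto τ).comp harg
  have hsing := fun k => (tendsto_singularBranch hσ c k).comp ht
  have hlim : Tendsto (fun x => matching σ c n τ (e x) (t x)) l _ :=
    ((hreg (n + 1)).mul (hsing (n + 1))).sub ((ht.mul (hreg (n + 2))).mul (hsing n))
  have hzero := tendsto_nhds_unique_of_eventuallyEq hlim (tendsto_const_nhds (x := (0 : ℂ)))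
    hmatch
  rw [zero_mul, zero_mul, sub_zero] at hzero
  rwa [mul_eq_zero, or_iff_left (neg_one_pow_mul_factorial_ne_zero (n + 1))] at hzero

lemma sub_approxZero_isBigO (hσ : |σ| = 1) (hD : matchingSlope n τ ≠ 0)
    (he : Tendsto e l (𝓝 0)) (ht : Tendsto t l (𝓝 0)) (heσ : ∀ᶠ x in l, σ * e x < 0)
    (htσ : ∀ᶠ x in l, t x ∈ halfPlane σ)
    (hmatch : ∀ᶠ x in l, matching σ c n τ (e x) (t x) = 0) :
    (fun x => t x - approxZero n (e x)) =O[l]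
      fun x => matching σ c n τ (e x) (approxZero n (e x)) := by
  obtain ⟨δ, hδ, hle⟩ := exists_norm_sub_approxZero_le hσ c hD
  refine IsBigO.of_bound (2 / ‖matchingSlope n τ‖) ?_
  filter_upwards [heσ, htσ, hmatch, he.eventually (Metric.ball_mem_nhds 0 hδ),
    ht.eventually (Metric.ball_mem_nhds 0 hδ)] with x hx htx hmx hball htball
  exact hle (e x) hx (mem_ball_zero_iff.1 hball) (t x) htx (mem_ball_zero_iff.1 htball) hmx

end Eigenvalue

section Absorption

variable {ρ a ε₁ : ℝ} {ℓ : ℤ} {n : ℕ} {E : ℝ → ℝ}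

lemma exists_eventually_matching_eq_zero (hρ : 0 < ρ) (ha : 0 < a) (hℓ : ℓ.natAbs = n + 2)
    (hε₁ : 0 < ε₁)
    (hψ : ∀ ε ∈ Set.Ioo (-ε₁) 0, ∃ ψ : ℂ → ℂ,
      MemLp ψ 2 volume ∧ ¬ ψ =ᵐ[volume] 0 ∧ HasAngularMode ℓ ψ ∧
        IsSolution (circularWell ρ (a ^ 2 - ε)) (E ε) ψ)
    (hE : Tendsto E (𝓝[<] 0) (𝓝[<] 0)) :
    ∃ c : ℂ, ∀ᶠ ε in 𝓝[<] 0, matching 1 c n (tauZero ρ a) ((ε * (ρ ^ 2 / 4) : ℝ) : ℂ)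
      ((-(E ε / 4) * ρ ^ 2 : ℝ) : ℂ) = 0 := by
  obtain ⟨c, hc⟩ := exists_matching_eq_zero_of_isSolution n
  have hpos : ∀ᶠ ε in 𝓝[<] 0, 0 < a ^ 2 - ε + E ε := by
    have hlim : Tendsto (fun ε => a ^ 2 - ε + E ε) (𝓝[<] 0) (𝓝 (a ^ 2 - 0 + 0)) :=
      (tendsto_const_nhds.sub (tendsto_id.mono_left nhdsWithin_le_nhds)).add
        (hE.mono_right nhdsWithin_le_nhds)
    exact hlim.eventually (lt_mem_nhds (by simpa using pow_pos ha 2))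
  refine ⟨c, ?_⟩
  filter_upwards [hpos, hE.eventually self_mem_nhdsWithin, Ioo_mem_nhdsLT (neg_lt_zero.2 hε₁)]
    with ε hAE hEε hε
  obtain ⟨ψ, hψL, hne, hm, hs⟩ := hψ ε hε
  refine hc hρ hℓ hAE hEε hψL hne hm hs ?_
  rw [tauZero]
  push_cast
  ring

lemma critical_and_eigenvalue_isBigO (hρ : 0 < ρ) (ha : 0 < a) (hℓ : ℓ.natAbs = n + 2)
    (hε₁ : 0 < ε₁)
    (hψ : ∀ ε ∈ Set.Ioo (-ε₁) 0, ∃ ψ : ℂ → ℂ,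
      MemLp ψ 2 volume ∧ ¬ ψ =ᵐ[volume] 0 ∧ HasAngularMode ℓ ψ ∧
        IsSolution (circularWell ρ (a ^ 2 - ε)) (E ε) ψ)
    (hE : Tendsto E (𝓝[<] 0) (𝓝[<] 0)) :
    besselClifford (n + 1 : ℕ) (tauZero ρ a) = 0 ∧
      (fun ε : ℝ => E ε - modeRatio n * ε) =O[𝓝[<] 0] errorScale n := by
  obtain ⟨c, hmatch⟩ := exists_eventually_matching_eq_zero hρ ha hℓ hε₁ hψ hE
  have hρ₂ : 0 < ρ ^ 2 / 4 := by positivity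
  have hNE : 𝓝[<] (0 : ℝ) ≤ 𝓝[≠] 0 := nhdsWithin_mono 0 fun ε hε => ne_of_lt hε
  have he : Tendsto (fun ε : ℝ => ε * (ρ ^ 2 / 4)) (𝓝[<] 0) (𝓝 0) :=
    ((tendsto_mul_const_nhdsNE hρ₂.ne').mono_left hNE).mono_right nhdsWithin_le_nhds
  have ht : Tendsto (fun ε => ((-(E ε / 4) * ρ ^ 2 : ℝ) : ℂ)) (𝓝[<] 0) (𝓝 0) := by
    have hcont : Continuous fun x : ℝ => ((-(x / 4) * ρ ^ 2 : ℝ) : ℂ) := by fun_prop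
    simpa [Function.comp_def] using (hcont.tendsto 0).comp (hE.mono_right nhdsWithin_le_nhds)
  have hτ := besselClifford_eq_zero_of_matching_eq_zero (by simp) he ht hmatch
  refine ⟨hτ, ?_⟩
  have heσ : ∀ᶠ ε : ℝ in 𝓝[<] 0, 1 * (ε * (ρ ^ 2 / 4)) < 0 := by
    filter_upwards [self_mem_nhdsWithin] with ε hε
    rw [one_mul]
    exact mul_neg_of_neg_of_pos hε hρ₂
  have htσ : ∀ᶠ ε in 𝓝[<] 0, ((-(E ε / 4) * ρ ^ 2 : ℝ) : ℂ) ∈ halfPlane 1 := by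
    filter_upwards [hE.eventually self_mem_nhdsWithin] with ε hε
    rw [Complex.ofReal_mul]
    exact ofReal_mul_ofReal_mem_halfPlane (by linarith [show E ε < 0 from hε]) (by positivity)
  have hclose := sub_approxZero_isBigO (by simp) (matchingSlope_ne_zero hτ) he ht heσ htσ hmatch
  have hresidue := (matching_approxZero_mul_isBigO (σ := 1) (by simp) c hτ hρ₂).mono hNE
  have hO := (hclose.trans hresidue).norm_left.const_mul_left (4 / ρ ^ 2)
  refine (hO.congr_left fun ε => ?_).of_norm_left
  rw [approxZero, ← Complex.ofReal_sub, Complex.norm_real,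
    show -(E ε / 4) * ρ ^ 2 - -(modeRatio n * (ε * (ρ ^ 2 / 4))) =
      -(ρ ^ 2 / 4) * (E ε - modeRatio n * ε) by ring, norm_mul, norm_neg,
    Real.norm_of_nonneg hρ₂.le]
  field_simp

end Absorption

end

end CircularWell

theorem lemmal (ρ a₀ : ℝ) (hρ : 0 < ρ) (ha₀ : 0 < a₀) (ℓ : ℤ) (hℓ : 2 ≤ |ℓ|)
    (ε₁ : ℝ) (hε₁ : 0 < ε₁) (E : ℝ → ℝ)
    (hψ : ∀ ε ∈ Set.Ioo (-ε₁) 0, ∃ ψ : ℂ → ℂ,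
      MemLp ψ 2 volume ∧ ¬ ψ =ᵐ[volume] 0 ∧ HasAngularMode ℓ ψ ∧
        IsSolution (circularWell ρ (a₀ ^ 2 - ε)) (E ε) ψ)
    (hE : Tendsto E (𝓝[<] 0) (𝓝[<] 0)) :
    (∃ ε₀ > 0, ∃ lam : ℝ → ℂ,
      (∀ ε : ℝ, 0 < |ε| → |ε| < ε₀ →
        IsResonance (circularWell ρ (a₀ ^ 2 - ε)) ρ (lam ε)) ∧
      (fun ε : ℝ => lam ε - ((ε * ((|ℓ| : ℝ) - 1) / (|ℓ| : ℝ) : ℝ) : ℂ) ^ (1 / 2 : ℂ))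
        =O[𝓝[≠] 0]
        (fun ε : ℝ => |ε| ^ (3 / 2 : ℝ) * (1 + (if |ℓ| = 2 then 1 else 0) * Real.log |ε|))) ∧
    (fun ε : ℝ => E ε - ((|ℓ| : ℝ) - 1) / (|ℓ| : ℝ) * ε)
      =O[𝓝[<] 0]
      (fun ε : ℝ => ε ^ 2 * (1 + (if |ℓ| = 2 then 1 else 0) * Real.log |ε|)) := by
  obtain ⟨n, hn⟩ : ∃ n, ℓ.natAbs = n + 2 :=
    ⟨ℓ.natAbs - 2, by rw [Int.abs_eq_natAbs] at hℓ; omega⟩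
  have hnℤ : |ℓ| = n + 2 := by rw [Int.abs_eq_natAbs]; omega
  have hnℝ : |(ℓ : ℝ)| = n + 2 := by exact_mod_cast hnℤ
  have hratio : (|(ℓ : ℝ)| - 1) / |(ℓ : ℝ)| = CircularWell.modeRatio n := by
    rw [hnℝ, CircularWell.modeRatio]
    ring
  have hlog : (if |ℓ| = 2 then (1 : ℝ) else 0) = if n = 0 then 1 else 0 :=
    if_congr (by omega) rfl rfl
  obtain ⟨hτ, hEO⟩ := CircularWell.critical_and_eigenvalue_isBigO hρ ha₀ hn hε₁ hψ hE
  simp only [hlog, mul_div_assoc, hratio]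
  exact ⟨CircularWell.exists_resonance_family hρ a₀ hτ, hEO⟩
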